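/- Let $N\ge 3$, $1<j<N$, and let $\lambda_1\le\dots\le\lambda_N$ be real with $\lambda_{j-1}<\lambda_j=\lambda_{j+1}<\lambda_{j+2}$ (the last inequality being void if $j+1=N$); put $\Lambda=\mathrm{diag}(\lambda_1,\dots,\lambda_N)$. Let $V:[0,\infty)\to\mathbb C^{N\times N}$ be locally integrable with $V(t)^*=V(t)$ and $V_{mm}(t)=0$ for all $t\ge 0$ and all $m$, and assume \[ I''(V)=\sum_{m=1}^{j-1}\sum_{l=j}^{j+1}\frac{1}{|\lambda_l-\lambda_m|}\int_0^\infty|V_{ml}(\tau)|^2\,d\tau+\sum_{m=1}^{j+1}\sum_{l=j+2}^{N}\frac{1}{|\lambda_l-\lambda_m|}\int_0^\infty|V_{ml}(\tau)|^2\,d\tau<\infty . \] For $k\in\mathbb R$ and $t\ge 0$ let $X(t,k)$ and $\Psi(0,t,k)$ be the (absolutely continuous) solutions of \[ \partial_tX=i(k\Lambda+V(t))X,\quad X(0,k)=I_{N\times N}, \] \[ \partial_t\Psi(0,t,k)=i\left(k\lambda_jI_{2\times2}+\begin{bmatrix}0&V_{j,j+1}(t)\\ V_{j+1,j}(t)&0\end{bmatrix}\right)\Psi(0,t,k),\quad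 \Psi(0,0,k)=I_{2\times 2}, \] and let $Y(t,k)=P_{\{j,j+1\}}X(t,k)P_{\{j,j+1\}}$ be the $2\times2$ block of $X(t,k)$ in rows and columns $j,j+1$. Then there is an absolute constant $C$ (independent of $N$, $j$, $\lambda$, $V$ and $t$) such that for all $t\ge 0$ \[ \int_{\mathbb R}\|Y(t,k)-\Psi(0,t,k)\|^2\,dk\le C\,I''(V). \] Moreover, there is a measurable $\tilde Y(\infty,\cdot):\mathbb R\to\mathbb C^{2\times2}$ with \[ \lim_{t\to\infty}\int_{\mathbb R}\|\Psi^{-1}(0,t,k)Y(t,k)-\tilde Y(\infty,k)\|^2\,dk=0,\qquad \int_{\mathbb R}\|\tilde Y(\infty,k)-I\|^2\,dk\le C\,I''(V). \] Here $\|\cdot\|$ is the operator norm on $\mathbb C^2$. -/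

import Mathlib

open MeasureTheory Set Filter Topology
open scoped ENNReal NNReal

noncomputable section

/-- `X` is the (Carathéodory) solution on `[τ, ∞)` of the matrix Cauchy problem
`X' = A(t) X`, `X(τ) = I`, for a locally integrable coefficient `A`: it is continuous and
satisfies `X(t) = I + ∫_τ^t A(s) X(s) ds`, the integral being taken entry by entry. -/
structure IsFundamentalSolution {n : Type*} [Fintype n] [DecidableEq n]
    (A : ℝ → Matrix n n ℂ) (τ : ℝ) (X : ℝ → Matrix n n ℂ) : Prop where
  continuousOn : ContinuousOn X (Ici τ)
  integral_eq : ∀ t, τ ≤ t → ∀ a b,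
    X t a b = (1 : Matrix n n ℂ) a b + ∫ s in τ..t, (A s * X s) a b

/-- The coefficient `i (k Λ + V(t))` with `Λ = diag(lam)`. -/
def evolutionGenerator {N : ℕ} (lam : Fin N → ℝ) (V : ℝ → Matrix (Fin N) (Fin N) ℂ)
    (k t : ℝ) : Matrix (Fin N) (Fin N) ℂ :=
  Complex.I • ((k : ℂ) • Matrix.diagonal (fun m => (lam m : ℂ)) + V t)

/-- The coefficient `i (k μ I + [[0, v(t)], [w(t), 0]])` of the `2 × 2` evolution. -/
def blockGenerator (μ : ℝ) (v w : ℝ → ℂ) (k t : ℝ) : Matrix (Fin 2) (Fin 2) ℂ :=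
  Complex.I • (((k * μ : ℝ) : ℂ) • (1 : Matrix (Fin 2) (Fin 2) ℂ) + !![0, v t; w t, 0])

/-- The `2 × 2` block of `M` in rows and columns `p, q`, that is `P M P` with `P` the projection
on the coordinates `p, q`, as a `2 × 2` matrix. -/
def twoBlock {N : ℕ} (p q : Fin N) (M : Matrix (Fin N) (Fin N) ℂ) :
    Matrix (Fin 2) (Fin 2) ℂ :=
  M.submatrix ![p, q] ![p, q]

/-- The operator norm of a `2 × 2` matrix on Euclidean `ℂ²`, as an extended nonnegative real. -/
def matENorm (M : Matrix (Fin 2) (Fin 2) ℂ) : ℝ≥0∞ :=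
  ‖Matrix.toEuclideanCLM (n := Fin 2) (𝕜 := ℂ) M‖ₑ

/-- The squared `L²(ℝ, dk)` distance `∫ ‖F(k) - G(k)‖² dk` of two matrix functions. -/
def sqDistL2 (F G : ℝ → Matrix (Fin 2) (Fin 2) ℂ) : ℝ≥0∞ :=
  ∫⁻ k : ℝ, matENorm (F k - G k) ^ 2

/-- The weighted `L²` mass `|lam l - lam m|⁻¹ ∫₀^∞ |V_{ml}(τ)|² dτ` of one entry of `V`. -/
def entryMass {N : ℕ} (lam : Fin N → ℝ) (V : ℝ → Matrix (Fin N) (Fin N) ℂ) (m l : Fin N) :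
    ℝ≥0∞ :=
  ENNReal.ofReal |lam l - lam m|⁻¹ * ∫⁻ τ in Ici (0 : ℝ), ‖V τ m l‖ₑ ^ 2

/-- The quantity `I''(V)` for the double frequency at the (zero-based) indices `j, j + 1`:
the masses of the entries `(m, l)` with `m < j`, `l ∈ {j, j + 1}`, and of those with
`m ≤ j + 1`, `l ≥ j + 2`. -/
def doubleMass {N : ℕ} (lam : Fin N → ℝ) (V : ℝ → Matrix (Fin N) (Fin N) ℂ) (j : ℕ) : ℝ≥0∞ :=
  (∑ m ∈ Finset.univ.filter (fun m : Fin N => (m : ℕ) < j),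
    ∑ l ∈ Finset.univ.filter (fun l : Fin N => (l : ℕ) = j ∨ (l : ℕ) = j + 1),
      entryMass lam V m l) +
  ∑ m ∈ Finset.univ.filter (fun m : Fin N => (m : ℕ) ≤ j + 1),
    ∑ l ∈ Finset.univ.filter (fun l : Fin N => j + 2 ≤ (l : ℕ)),
      entryMass lam V m l

end

/-!
The idea is to replace the block of the propagator, which is not at the edge of the spectrum of
`Λ`, by minors, which are. The `p × p` minors of `X` with fixed columns solve the equation induced
on the `p`-th exterior power (`IsFundamentalMatrix.isEvolution_minor`), whose frequencies are the
sums of `p` of the `λ`'s. For `p = j` the multi-index `(0, …, j - 1)` has the lowest frequency; for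
`p = j + 1` the two multi-indices `(0, …, j - 1, j + a)`, `a = 0, 1`, share the lowest frequency,
and the evolution among them is `Ψ`. (Indices start at zero, so that the double frequency sits at
`j` and `j + 1`.)

Let `F(k)` be the overlap at time `t` between such low minors of `X` and the corresponding minors
of the evolution that keeps only the coupling of `j` with `j + 1`, normalized by a phase. Above the
lowest frequency the equation is dissipative for `Im k > 0`, so `F` is bounded by one in the upper
half-plane, and the energy identity gives `1 - Re F(i y) ≤ M / y` with `M` a multiple of `I''(V)`
(`IsEvolution.overlap_decay`). Every coupling out of the low multi-indices moves one index
across the boundary of the set, and its weight is the corresponding `1 / |λ_l - λ_m|`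
(`sum_norm_compoundGenerator_mulVec_sq_le`). Moreover `F` is entire in `k`, since the equation at
parameter `k` reduces, by conjugation with `X` at `k = 0`, to one with continuous coefficients and
has a power series solution (`IsFundamentalMatrix.exists_entire`). The Poisson formula on the
imaginary axis and Fatou's lemma as `y → ∞` turn the decay into `∫ (1 - Re F(k)) dk ≤ π M`
(`lintegral_one_sub_re_le`, `lintegral_one_sub_overlap_le`).

For real `k` the Laplace expansion of the `(j + 1)`-minors along their last column expresses them
as the `j`-minor times an entry of the block `Y`, up to an error that is quadratically small in
the defects. This yields a pointwise bound for `‖Y - Ψ‖²`, and for the part of the columns `j`,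
`j + 1` of `X` outside the block, by the defects of the minors (`column_defect_le`), hence the
first claim (`IsDoubleFrequency.lintegral_blockDefect_le`).

The limit follows from the same estimate for the translate `V(s + ·)`, whose propagators are
`X(s + τ) X(s)⁻¹` and `Ψ(s + τ) Ψ(s)⁻¹`: the block defect of these controls the increment of
`Ψ⁻¹ Y` from `s` to `s + τ` (`frobSq_conjTranspose_mul_sub_le`), while `I''(V(s + ·)) → 0` as
`s → ∞`. So `Ψ⁻¹ Y` is Cauchy in `L²(dk)`, and the increments from time zero, where it is the
identity, bound the limit.
-/

/-! ### Absolutely continuous functions and the product rule -/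

/-- `f` is, on `[0, ∞)`, a primitive of the locally integrable function `f'`; equivalently `f` is
locally absolutely continuous there with a.e. derivative `f'`. -/
structure IsPrimitive (f f' : ℝ → ℂ) : Prop where
  intervalIntegrable : ∀ t, 0 ≤ t → IntervalIntegrable f' volume 0 t
  eq_add_integral : ∀ t, 0 ≤ t → f t = f 0 + ∫ s in (0 : ℝ)..t, f' s

/-- The product rule for real absolutely continuous functions, in integrated form. -/
lemma integral_product_rule_real {f g f' g' : ℝ → ℝ} {T : ℝ}
    (hT : 0 ≤ T)
    (hf' : IntervalIntegrable f' volume 0 T) (hg' : IntervalIntegrable g' volume 0 T)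
    (hf : ∀ t ∈ Icc 0 T, f t = f 0 + ∫ s in (0 : ℝ)..t, f' s)
    (hg : ∀ t ∈ Icc 0 T, g t = g 0 + ∫ s in (0 : ℝ)..t, g' s) :
    ∫ s in (0 : ℝ)..T, (f' s * g s + f s * g' s) = f T * g T - f 0 * g 0 := by
  set F : ℝ → ℝ := fun t => ∫ s in (0 : ℝ)..t, f' s
  set G : ℝ → ℝ := fun t => ∫ s in (0 : ℝ)..t, g' s
  have hF : AbsolutelyContinuousOnInterval (fun t => f 0 + F t) 0 T := by
    refine AbsolutelyContinuousOnInterval.add ?_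
      (hf'.absolutelyContinuousOnInterval_intervalIntegral (by simp))
    exact (contDiff_const.contDiffOn).absolutelyContinuousOnInterval
  have hG : AbsolutelyContinuousOnInterval (fun t => g 0 + G t) 0 T := by
    refine AbsolutelyContinuousOnInterval.add ?_
      (hg'.absolutelyContinuousOnInterval_intervalIntegral (by simp))
    exact (contDiff_const.contDiffOn).absolutelyContinuousOnInterval
  have key := hF.integral_deriv_mul_eq_sub hG
  rw [← hf T ⟨hT, le_rfl⟩, ← hg T ⟨hT, le_rfl⟩] at key
  have h0f : f 0 + F 0 = f 0 := by simp [F]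
  have h0g : g 0 + G 0 = g 0 := by simp [G]
  rw [h0f, h0g] at key
  rw [← key]
  apply intervalIntegral.integral_congr_ae
  filter_upwards [hf'.ae_hasDerivAt_integral, hg'.ae_hasDerivAt_integral] with x h1 h2 hx
  have hx' : x ∈ uIcc 0 T := uIoc_subset_uIcc hx
  have hx2 : x ∈ Icc 0 T := by rwa [uIcc_of_le hT] at hx'
  have e1 := ((h1 hx' 0 (by simp)).const_add (f 0)).deriv
  have e2 := ((h2 hx' 0 (by simp)).const_add (g 0)).deriv
  simp only [F, G]
  rw [e1, e2, ← hf x hx2, ← hg x hx2]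

namespace IsPrimitive

variable {f g f' g' : ℝ → ℂ}

lemma continuousOn (h : IsPrimitive f f') : ContinuousOn f (Ici 0) := by
  intro t ht
  have ht0 : (0 : ℝ) ≤ t := ht
  have h1 : IntervalIntegrable f' volume 0 (t + 1) := h.intervalIntegrable _ (by linarith)
  have h2 : ContinuousOn (fun x => f 0 + ∫ s in (0 : ℝ)..x, f' s) (Icc 0 (t + 1)) := by
    refine continuousOn_const.add ?_
    have := intervalIntegral.continuousOn_primitive_interval
      (μ := volume) (f := f') (a := 0) (b := t + 1)
      ((intervalIntegrable_iff_integrableOn_Icc_of_le (by linarith)).1 h1 |>.mono_set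
        (by rw [uIcc_of_le (by linarith)]))
    rwa [uIcc_of_le (by linarith)] at this
  have h3 : ContinuousWithinAt f (Icc 0 (t + 1)) t :=
    (h2 t ⟨ht0, by linarith⟩).congr (fun x hx => h.eq_add_integral x hx.1)
      (h.eq_add_integral t ht0)
  refine h3.mono_of_mem_nhdsWithin ?_
  rw [mem_nhdsWithin]
  exact ⟨Iio (t + 1), isOpen_Iio, by simp, fun x hx => ⟨hx.2, le_of_lt hx.1⟩⟩

lemma congr (h : IsPrimitive f f') (hf : ∀ t, 0 ≤ t → g t = f t)
    (hf' : ∀ t, 0 ≤ t → g' t = f' t) : IsPrimitive g g' := by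
  have he : ∀ t, 0 ≤ t → EqOn f' g' (uIoc 0 t) := fun t ht s hs => by
    rw [uIoc_of_le ht] at hs
    exact (hf' s hs.1.le).symm
  refine ⟨fun t ht => (h.intervalIntegrable t ht).congr (he t ht), fun t ht => ?_⟩
  rw [hf t ht, hf 0 le_rfl, h.eq_add_integral t ht]
  congr 1
  apply intervalIntegral.integral_congr_ae
  exact Eventually.of_forall fun s hs => he t ht hs

lemma const (c : ℂ) : IsPrimitive (fun _ => c) (fun _ => 0) :=
  ⟨fun t _ => by simp, fun t _ => by simp⟩

lemma add (hf : IsPrimitive f f') (hg : IsPrimitive g g') :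
    IsPrimitive (fun t => f t + g t) (fun t => f' t + g' t) := by
  refine ⟨fun t ht => (hf.intervalIntegrable t ht).add (hg.intervalIntegrable t ht),
    fun t ht => ?_⟩
  rw [intervalIntegral.integral_add (hf.intervalIntegrable t ht) (hg.intervalIntegrable t ht),
    hf.eq_add_integral t ht, hg.eq_add_integral t ht]
  ring

lemma const_mul (c : ℂ) (hf : IsPrimitive f f') :
    IsPrimitive (fun t => c * f t) (fun t => c * f' t) := by
  refine ⟨fun t ht => (hf.intervalIntegrable t ht).const_mul c, fun t ht => ?_⟩
  rw [intervalIntegral.integral_const_mul, hf.eq_add_integral t ht]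
  ring

lemma sub (hf : IsPrimitive f f') (hg : IsPrimitive g g') :
    IsPrimitive (fun t => f t - g t) (fun t => f' t - g' t) :=
  (hf.add (hg.const_mul (-1))).congr (fun t _ => by ring) (fun t _ => by ring)

lemma conj (hf : IsPrimitive f f') :
    IsPrimitive (fun t => star (f t)) (fun t => star (f' t)) := by
  refine ⟨fun t ht => ?_, fun t ht => ?_⟩
  · have := hf.intervalIntegrable t ht
    rw [intervalIntegrable_iff] at this ⊢
    exact (Complex.conjCLE.toContinuousLinearMap).integrable_comp this
  · rw [hf.eq_add_integral t ht, star_add]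
    congr 1
    exact ((Complex.conjCLE.toContinuousLinearMap).intervalIntegral_comp_comm
      (hf.intervalIntegrable t ht)).symm

lemma sum {ι : Type*} (s : Finset ι) {F F' : ι → ℝ → ℂ} (h : ∀ i ∈ s, IsPrimitive (F i) (F' i)) :
    IsPrimitive (fun t => ∑ i ∈ s, F i t) (fun t => ∑ i ∈ s, F' i t) := by
  classical
  induction s using Finset.induction_on with
  | empty => simpa using const 0
  | insert a s ha ih =>
    simp only [Finset.sum_insert ha]
    exact (h a (by simp)).add (ih fun i hi => h i (by simp [hi]))

lemma re_eq (h : IsPrimitive f f') {t : ℝ} (ht : 0 ≤ t) :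
    (f t).re = (f 0).re + ∫ s in (0 : ℝ)..t, (f' s).re := by
  rw [h.eq_add_integral t ht, Complex.add_re]
  congr 1
  exact (Complex.reCLM.intervalIntegral_comp_comm (h.intervalIntegrable t ht)).symm

lemma im_eq (h : IsPrimitive f f') {t : ℝ} (ht : 0 ≤ t) :
    (f t).im = (f 0).im + ∫ s in (0 : ℝ)..t, (f' s).im := by
  rw [h.eq_add_integral t ht, Complex.add_im]
  congr 1
  exact (Complex.imCLM.intervalIntegral_comp_comm (h.intervalIntegrable t ht)).symm

lemma intervalIntegrable_re (h : IsPrimitive f f') {t : ℝ} (ht : 0 ≤ t) :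
    IntervalIntegrable (fun s => (f' s).re) volume 0 t := by
  have := h.intervalIntegrable t ht
  rw [intervalIntegrable_iff] at this ⊢
  exact Complex.reCLM.integrable_comp this

lemma intervalIntegrable_im (h : IsPrimitive f f') {t : ℝ} (ht : 0 ≤ t) :
    IntervalIntegrable (fun s => (f' s).im) volume 0 t := by
  have := h.intervalIntegrable t ht
  rw [intervalIntegrable_iff] at this ⊢
  exact Complex.imCLM.integrable_comp this

lemma intervalIntegrable_mul_continuousOn {h k : ℝ → ℂ} {t : ℝ} (ht : 0 ≤ t)
    (hh : IntervalIntegrable h volume 0 t) (hk : ContinuousOn k (Ici 0)) :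
    IntervalIntegrable (fun s => h s * k s) volume 0 t :=
  hh.mul_continuousOn (hk.mono (by rw [uIcc_of_le ht]; exact fun x hx => hx.1))

lemma mul (hf : IsPrimitive f f') (hg : IsPrimitive g g') :
    IsPrimitive (fun t => f t * g t) (fun t => f' t * g t + f t * g' t) := by
  have hint : ∀ t, 0 ≤ t → IntervalIntegrable (fun t => f' t * g t + f t * g' t) volume 0 t := by
    intro t ht
    refine (intervalIntegrable_mul_continuousOn ht (hf.intervalIntegrable t ht)
      hg.continuousOn).add ?_
    simpa only [mul_comm] using intervalIntegrable_mul_continuousOn ht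
      (hg.intervalIntegrable t ht) hf.continuousOn
  refine ⟨hint, fun t ht => ?_⟩
  have rr := integral_product_rule_real ht (hf.intervalIntegrable_re ht)
    (hg.intervalIntegrable_re ht) (fun s hs => hf.re_eq hs.1) (fun s hs => hg.re_eq hs.1)
  have ii := integral_product_rule_real ht (hf.intervalIntegrable_im ht)
    (hg.intervalIntegrable_im ht) (fun s hs => hf.im_eq hs.1) (fun s hs => hg.im_eq hs.1)
  have ri := integral_product_rule_real ht (hf.intervalIntegrable_re ht)
    (hg.intervalIntegrable_im ht) (fun s hs => hf.re_eq hs.1) (fun s hs => hg.im_eq hs.1)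
  have ir := integral_product_rule_real ht (hf.intervalIntegrable_im ht)
    (hg.intervalIntegrable_re ht) (fun s hs => hf.im_eq hs.1) (fun s hs => hg.re_eq hs.1)
  have ci : ∀ {φ φ' ψ ψ' : ℝ → ℝ}, IntervalIntegrable φ' volume 0 t →
      IntervalIntegrable ψ' volume 0 t → ContinuousOn φ (Ici 0) → ContinuousOn ψ (Ici 0) →
      IntervalIntegrable (fun s => φ' s * ψ s + φ s * ψ' s) volume 0 t := by
    intro φ φ' ψ ψ' h1 h2 h3 h4
    have hsub : uIcc 0 t ⊆ Ici (0 : ℝ) := by rw [uIcc_of_le ht]; exact fun x hx => hx.1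
    exact (h1.mul_continuousOn (h4.mono hsub)).add (h2.continuousOn_mul (h3.mono hsub))
  have cfr : ContinuousOn (fun s => (f s).re) (Ici 0) :=
    Complex.continuous_re.comp_continuousOn hf.continuousOn
  have cfi : ContinuousOn (fun s => (f s).im) (Ici 0) :=
    Complex.continuous_im.comp_continuousOn hf.continuousOn
  have cgr : ContinuousOn (fun s => (g s).re) (Ici 0) :=
    Complex.continuous_re.comp_continuousOn hg.continuousOn
  have cgi : ContinuousOn (fun s => (g s).im) (Ici 0) :=
    Complex.continuous_im.comp_continuousOn hg.continuousOn
  apply Complex.ext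
  · have e := Complex.reCLM.intervalIntegral_comp_comm (hint t ht)
    simp only [Complex.reCLM_apply] at e
    rw [Complex.add_re, ← e]
    have : (fun s => (f' s * g s + f s * g' s).re) = fun s =>
        ((f' s).re * (g s).re + (f s).re * (g' s).re) -
        ((f' s).im * (g s).im + (f s).im * (g' s).im) := by
      ext s; simp only [Complex.add_re, Complex.mul_re]; ring
    rw [this, intervalIntegral.integral_sub
      (ci (hf.intervalIntegrable_re ht) (hg.intervalIntegrable_re ht) cfr cgr)
      (ci (hf.intervalIntegrable_im ht) (hg.intervalIntegrable_im ht) cfi cgi), rr, ii]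
    simp only [Complex.mul_re]; ring
  · have e := Complex.imCLM.intervalIntegral_comp_comm (hint t ht)
    simp only [Complex.imCLM_apply] at e
    rw [Complex.add_im, ← e]
    have : (fun s => (f' s * g s + f s * g' s).im) = fun s =>
        ((f' s).re * (g s).im + (f s).re * (g' s).im) +
        ((f' s).im * (g s).re + (f s).im * (g' s).re) := by
      ext s; simp only [Complex.add_im, Complex.mul_im]; ring
    rw [this, intervalIntegral.integral_add
      (ci (hf.intervalIntegrable_re ht) (hg.intervalIntegrable_im ht) cfr cgi)
      (ci (hf.intervalIntegrable_im ht) (hg.intervalIntegrable_re ht) cfi cgr), ri, ir]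
    simp only [Complex.mul_im]; ring

lemma prod {ι : Type*} [DecidableEq ι] (s : Finset ι) {F F' : ι → ℝ → ℂ}
    (h : ∀ i ∈ s, IsPrimitive (F i) (F' i)) :
    IsPrimitive (fun t => ∏ i ∈ s, F i t)
      (fun t => ∑ i ∈ s, F' i t * ∏ i' ∈ s.erase i, F i' t) := by
  induction s using Finset.induction_on with
  | empty => simpa using const 1
  | insert a s ha ih =>
    refine ((h a (by simp)).mul (ih fun i hi => h i (by simp [hi]))).congr
      (fun t _ => by rw [Finset.prod_insert ha]) (fun t _ => ?_)
    rw [Finset.sum_insert ha, Finset.erase_insert ha, Finset.mul_sum]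
    congr 1
    refine Finset.sum_congr rfl fun i hi => ?_
    have hne : a ≠ i := fun e => ha (e ▸ hi)
    rw [Finset.erase_insert_of_ne hne, Finset.prod_insert (by simp [ha])]
    ring

lemma of_hasDerivAt (h : ∀ t, HasDerivAt f (f' t) t) (hc : Continuous f') : IsPrimitive f f' := by
  refine ⟨fun t _ => hc.intervalIntegrable _ _, fun t _ => ?_⟩
  rw [intervalIntegral.integral_eq_sub_of_hasDerivAt (fun x _ => h x) (hc.intervalIntegrable _ _)]
  ring

lemma exp_mul (c : ℂ) :
    IsPrimitive (fun t => Complex.exp (c * t)) (fun t => c * Complex.exp (c * t)) := by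
  refine of_hasDerivAt (fun t => ?_) (by fun_prop)
  have h1 : HasDerivAt (fun t : ℝ => c * (t : ℂ)) c t := by
    simpa using (Complex.ofRealCLM.hasDerivAt (x := t)).const_mul c
  simpa [mul_comm] using h1.cexp

lemma eq_of_deriv_zero (h : IsPrimitive f fun _ => 0) {t : ℝ} (ht : 0 ≤ t) : f t = f 0 := by
  simpa using h.eq_add_integral t ht

end IsPrimitive

/-! ### Evolutions with a spectral parameter: energy and overlap -/

/-- `u` solves `u' = i (k D + H(t)) u` on `[0, ∞)`, where `D = diag(d)`. The spectral parameter `k`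
may be complex. -/
def IsEvolution {ι : Type*} [Fintype ι] (k : ℂ) (d : ι → ℝ) (H : ℝ → Matrix ι ι ℂ)
    (u : ℝ → ι → ℂ) : Prop :=
  ∀ i, IsPrimitive (fun t => u t i)
    (fun t => Complex.I * (k * d i * u t i + ∑ j, H t i j * u t j))

section Evolution

variable {ι : Type*} [Fintype ι]

lemma norm_sum_star_mul_sq_le (w u : ι → ℂ) :
    ‖∑ i, star (w i) * u i‖ ^ 2 ≤ (∑ i, ‖w i‖ ^ 2) * ∑ i, ‖u i‖ ^ 2 := by
  have h1 : ‖∑ i, star (w i) * u i‖ ≤ ∑ i, ‖w i‖ * ‖u i‖ := by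
    refine (norm_sum_le _ _).trans (le_of_eq ?_)
    simp
  calc ‖∑ i, star (w i) * u i‖ ^ 2 ≤ (∑ i, ‖w i‖ * ‖u i‖) ^ 2 := by gcongr
    _ ≤ _ := Finset.sum_mul_sq_le_sq_mul_sq _ _ _

lemma sum_star_mul_hermitian {H : Matrix ι ι ℂ} (hH : H.IsHermitian) (w u : ι → ℂ) :
    ∑ i, star (w i) * ∑ j, H i j * u j = ∑ j, star (∑ i, H j i * w i) * u j := by
  simp_rw [Finset.mul_sum, star_sum, Finset.sum_mul]
  rw [Finset.sum_comm]
  refine Finset.sum_congr rfl fun j _ => Finset.sum_congr rfl fun i _ => ?_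
  rw [star_mul', hH.apply i j]; ring

lemma IsEvolution.pairing {k k' : ℂ} {d d' : ι → ℝ} {H H' : ℝ → Matrix ι ι ℂ}
    {u w : ℝ → ι → ℂ} (hu : IsEvolution k d H u) (hw : IsEvolution k' d' H' w) :
    IsPrimitive (fun t => ∑ i, star (w t i) * u t i)
      (fun t => ∑ i, (star (Complex.I * (k' * d' i * w t i + ∑ j, H' t i j * w t j)) * u t i +
        star (w t i) * (Complex.I * (k * d i * u t i + ∑ j, H t i j * u t j)))) :=
  IsPrimitive.sum _ fun i _ => (hw i).conj.mul (hu i)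

/-- The energy identity for `u' = i (k D + H) u`: the Hermitian part `H` does not contribute, and
the dissipation is `2 Im k ⟨D u, u⟩`. -/
lemma IsEvolution.energy {k : ℂ} {d : ι → ℝ} {H : ℝ → Matrix ι ι ℂ} {u : ℝ → ι → ℂ}
    (hu : IsEvolution k d H u) (hH : ∀ t, 0 ≤ t → (H t).IsHermitian) {t : ℝ} (ht : 0 ≤ t) :
    ∑ i, ‖u t i‖ ^ 2 + 2 * k.im * ∫ s in (0 : ℝ)..t, ∑ i, d i * ‖u s i‖ ^ 2 =
      ∑ i, ‖u 0 i‖ ^ 2 := by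
  have h := hu.pairing hu
  have hd : ∀ s, 0 ≤ s → ((∑ i, -(2 * k.im * (d i * ‖u s i‖ ^ 2)) : ℝ) : ℂ) =
      ∑ i, (star (Complex.I * (k * d i * u s i + ∑ j, H s i j * u s j)) * u s i +
        star (u s i) * (Complex.I * (k * d i * u s i + ∑ j, H s i j * u s j))) := by
    intro s hs
    have e := sum_star_mul_hermitian (hH s hs) (u s) (u s)
    have hI : star Complex.I = -Complex.I := Complex.conj_I
    have hk : Complex.I * (k - star k) = -(2 * k.im : ℝ) := by
      apply Complex.ext
      · simp; ring
      · simp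
    have e2 : ∀ i, (star (Complex.I * (k * d i * u s i + ∑ j, H s i j * u s j)) * u s i +
        star (u s i) * (Complex.I * (k * d i * u s i + ∑ j, H s i j * u s j))) =
        (Complex.I * (k - star k)) * (d i * (star (u s i) * u s i)) +
        (Complex.I * (star (u s i) * ∑ j, H s i j * u s j) -
          Complex.I * (star (∑ j, H s i j * u s j) * u s i)) := by
      intro i
      rw [star_mul', star_add, star_mul', star_mul', hI]
      have : star ((d i : ℝ) : ℂ) = d i := Complex.conj_ofReal _
      rw [this]; ring
    rw [Finset.sum_congr rfl fun i _ => e2 i, Finset.sum_add_distrib, Finset.sum_sub_distrib,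
      ← Finset.mul_sum, ← Finset.mul_sum, ← Finset.mul_sum, e, sub_self, add_zero, hk]
    push_cast
    rw [Finset.mul_sum]
    refine Finset.sum_congr rfl fun i _ => ?_
    have : star (u s i) * u s i = (‖u s i‖ : ℂ) ^ 2 := Complex.conj_mul' _
    rw [this]; ring
  have h2 := (h.congr (fun _ _ => rfl) hd).re_eq ht
  have hn : ∀ s, (∑ i, star (u s i) * u s i).re = ∑ i, ‖u s i‖ ^ 2 := by
    intro s
    rw [Complex.re_sum]
    refine Finset.sum_congr rfl fun i _ => ?_
    have : star (u s i) * u s i = ((‖u s i‖ ^ 2 : ℝ) : ℂ) := by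
      push_cast; exact Complex.conj_mul' _
    rw [this, Complex.ofReal_re]
  rw [hn, hn] at h2
  simp only [Complex.ofReal_re] at h2
  rw [h2]
  have : (fun s => ∑ i, -(2 * k.im * (d i * ‖u s i‖ ^ 2))) =
      fun s => -(2 * k.im) * ∑ i, d i * ‖u s i‖ ^ 2 := by
    ext s; rw [Finset.mul_sum]; exact Finset.sum_congr rfl fun i _ => by ring
  rw [this, intervalIntegral.integral_const_mul]; ring

lemma IsEvolution.sum_norm_sq_le {k : ℂ} {d : ι → ℝ} {H : ℝ → Matrix ι ι ℂ} {u : ℝ → ι → ℂ}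
    (hu : IsEvolution k d H u) (hH : ∀ t, 0 ≤ t → (H t).IsHermitian) (hk : 0 ≤ k.im)
    (hd : ∀ i, 0 ≤ d i) {t : ℝ} (ht : 0 ≤ t) :
    ∑ i, ‖u t i‖ ^ 2 ≤ ∑ i, ‖u 0 i‖ ^ 2 := by
  rw [← hu.energy hH ht]
  have : 0 ≤ ∫ s in (0 : ℝ)..t, ∑ i, d i * ‖u s i‖ ^ 2 := by
    refine intervalIntegral.integral_nonneg ht fun s _ => Finset.sum_nonneg fun i _ => ?_
    exact mul_nonneg (hd i) (sq_nonneg _)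
  have := mul_nonneg (mul_nonneg zero_le_two hk) this
  linarith

lemma IsEvolution.sum_norm_sq_eq {k : ℂ} {d : ι → ℝ} {H : ℝ → Matrix ι ι ℂ} {u : ℝ → ι → ℂ}
    (hu : IsEvolution k d H u) (hH : ∀ t, 0 ≤ t → (H t).IsHermitian) (hk : k.im = 0)
    {t : ℝ} (ht : 0 ≤ t) :
    ∑ i, ‖u t i‖ ^ 2 = ∑ i, ‖u 0 i‖ ^ 2 := by
  rw [← hu.energy hH ht, hk]; simp

/-- Removing the phase `exp (i k μ t)` shifts all frequencies by `μ`. -/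
lemma IsEvolution.gauge {k : ℂ} {d : ι → ℝ} {H : ℝ → Matrix ι ι ℂ} {u : ℝ → ι → ℂ}
    (hu : IsEvolution k d H u) (μ : ℝ) :
    IsEvolution k (fun i => d i - μ) H
      (fun t i => Complex.exp (-(Complex.I * k * μ) * t) * u t i) := by
  intro i
  refine ((IsPrimitive.exp_mul (-(Complex.I * k * μ))).mul (hu i)).congr (fun _ _ => rfl)
    fun t _ => ?_
  have : ∑ j, H t i j * (Complex.exp (-(Complex.I * k * μ) * t) * u t j) =
      Complex.exp (-(Complex.I * k * μ) * t) * ∑ j, H t i j * u t j := by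
    rw [Finset.mul_sum]; exact Finset.sum_congr rfl fun j _ => by ring
  simp only [this]
  push_cast
  ring

/-- The decay estimate on the imaginary axis. Here `w` is an evolution inside the kernel of
`D = diag(d) ≥ 0` and `u` starts from the same vector; then the overlap of `u` and `w` at
`k = i y` differs from `1` by at most `y⁻¹ ∫ m`, where `m` controls the coupling
`(H - H') w` of `w` to the complement of the kernel, weighted by `1 / d`. -/
lemma IsEvolution.overlap_decay {y : ℝ} (hy : 0 < y) {d : ι → ℝ} (hd : ∀ i, 0 ≤ d i)
    {H H' : ℝ → Matrix ι ι ℂ} (hH : ∀ t, 0 ≤ t → (H t).IsHermitian)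
    (hH' : ∀ t, 0 ≤ t → (H' t).IsHermitian) {u w : ℝ → ι → ℂ}
    (hu : IsEvolution (Complex.I * y) d H u) (hw : IsEvolution 0 d H' w)
    (h0 : u 0 = w 0) {n : ℝ} (hn : 0 < n) (hn0 : ∑ i, ‖w 0 i‖ ^ 2 = n)
    (hdw : ∀ t, 0 ≤ t → ∀ i, d i = 0 ∨ w t i = 0)
    (hker : ∀ t, 0 ≤ t → ∀ i, d i = 0 → ∑ j, (H t i j - H' t i j) * w t j = 0)
    {m : ℝ → ℝ} {t : ℝ} (ht : 0 ≤ t) (hm : IntervalIntegrable m volume 0 t)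
    (hρ : ∀ s, 0 ≤ s → ∑ i, ‖∑ j, (H s i j - H' s i j) * w s j‖ ^ 2 / d i ≤ m s * n) :
    y * (1 - ((∑ i, star (w t i) * u t i) / n).re) ≤ ∫ s in (0 : ℝ)..t, m s := by
  set ρ : ℝ → ι → ℂ := fun s i => ∑ j, (H s i j - H' s i j) * w s j with hρdef
  have hwt : ∀ s, 0 ≤ s → ∑ i, ‖w s i‖ ^ 2 = n := fun s hs => by
    rw [hw.sum_norm_sq_eq hH' (by simp) hs, hn0]
  have hpair : IsPrimitive (fun t => ∑ i, star (w t i) * u t i)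
      (fun t => Complex.I * ∑ i, star (ρ t i) * u t i) := by
    refine (hu.pairing hw).congr (fun _ _ => rfl) fun s hs => ?_
    have e1 := sum_star_mul_hermitian (hH s hs) (w s) (u s)
    have hI : star Complex.I = -Complex.I := Complex.conj_I
    have e2 : ∀ i, (star (Complex.I * (0 * d i * w s i + ∑ j, H' s i j * w s j)) * u s i +
        star (w s i) * (Complex.I * (Complex.I * y * d i * u s i + ∑ j, H s i j * u s j))) =
        Complex.I * (star (w s i) * ∑ j, H s i j * u s j) -
          Complex.I * (star (∑ j, H' s i j * w s j) * u s i) := by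
      intro i
      rw [star_mul', hI, zero_mul, zero_mul, zero_add]
      rcases hdw s hs i with h | h
      · rw [h]; push_cast; ring
      · rw [h, star_zero]; ring
    rw [Finset.sum_congr rfl fun i _ => e2 i, Finset.sum_sub_distrib, ← Finset.mul_sum,
      ← Finset.mul_sum, e1, ← mul_sub, ← Finset.sum_sub_distrib]
    congr 1
    refine Finset.sum_congr rfl fun i _ => ?_
    rw [← sub_mul, ← star_sub, ← Finset.sum_sub_distrib]
    simp only [hρdef, sub_mul]
  have hre := hpair.re_eq ht
  have hstart : (∑ i, star (w 0 i) * u 0 i).re = n := by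
    rw [h0, ← hn0, Complex.re_sum]
    refine Finset.sum_congr rfl fun i _ => ?_
    have : star (w 0 i) * w 0 i = ((‖w 0 i‖ ^ 2 : ℝ) : ℂ) := by
      push_cast; exact Complex.conj_mul' _
    rw [this, Complex.ofReal_re]
  rw [hstart] at hre
  set a : ℂ := (∑ i, star (w t i) * u t i) / n with ha
  have hsum : ∑ i, star (w t i) * u t i = n * a := by
    rw [ha, mul_div_cancel₀ _ (by exact_mod_cast hn.ne')]
  rw [hsum] at hre
  have hre' : ((n : ℂ) * a).re = n * a.re := by simp
  rw [hre'] at hre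
  -- the dissipated energy controls the coupling term
  have hen := hu.energy hH ht
  have him : (Complex.I * (y : ℂ)).im = y := by simp
  rw [him, h0, hn0] at hen
  set Q := ∫ s in (0 : ℝ)..t, ∑ i, d i * ‖u s i‖ ^ 2 with hQ
  have hcs : n * ‖a‖ ^ 2 ≤ ∑ i, ‖u t i‖ ^ 2 := by
    have h1 := norm_sum_star_mul_sq_le (w t) (u t)
    rw [hsum, hwt t ht, norm_mul, mul_pow, Complex.norm_real, Real.norm_eq_abs, sq_abs] at h1
    have : n * (n * ‖a‖ ^ 2) ≤ n * ∑ i, ‖u t i‖ ^ 2 := by linarith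
    exact le_of_mul_le_mul_left this hn
  have hQint : IntervalIntegrable (fun s => ∑ i, d i * ‖u s i‖ ^ 2) volume 0 t := by
    refine ContinuousOn.intervalIntegrable ?_
    rw [uIcc_of_le ht]
    refine continuousOn_finsetSum _ fun i _ => ?_
    have := ((hu i).continuousOn.mono (fun x hx => hx.1 : Icc 0 t ⊆ Ici 0)).norm
    exact continuousOn_const.mul (this.pow 2)
  have hkey : n - n * a.re ≤ y / 2 * Q + n / (2 * y) * ∫ s in (0 : ℝ)..t, m s := by
    have e : n - n * a.re =
        ∫ s in (0 : ℝ)..t, -(Complex.I * ∑ i, star (ρ s i) * u s i).re := by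
      rw [intervalIntegral.integral_neg]; linarith
    rw [e, hQ, ← intervalIntegral.integral_const_mul, ← intervalIntegral.integral_const_mul,
      ← intervalIntegral.integral_add (hQint.const_mul _) (hm.const_mul _)]
    refine intervalIntegral.integral_mono_on ht (hpair.intervalIntegrable_re ht).neg
      ((hQint.const_mul _).add (hm.const_mul _)) fun s hs => ?_
    have h1 : -(Complex.I * ∑ i, star (ρ s i) * u s i).re ≤ ∑ i, ‖ρ s i‖ * ‖u s i‖ := by
      refine (neg_le_abs _).trans ((Complex.abs_re_le_norm _).trans ?_)
      rw [norm_mul, Complex.norm_I, one_mul]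
      refine (norm_sum_le _ _).trans (le_of_eq ?_)
      simp
    have h2 : ∑ i, ‖ρ s i‖ * ‖u s i‖ ≤
        ∑ i, (y / 2 * (d i * ‖u s i‖ ^ 2) + 1 / (2 * y) * (‖ρ s i‖ ^ 2 / d i)) := by
      refine Finset.sum_le_sum fun i _ => ?_
      rcases (hd i).eq_or_lt with h | h
      · have h0 : ρ s i = 0 := hker s hs.1 i h.symm
        rw [h0, ← h]; simp
      · have e3 : y / 2 * (d i * ‖u s i‖ ^ 2) + 1 / (2 * y) * (‖ρ s i‖ ^ 2 / d i) -
            ‖ρ s i‖ * ‖u s i‖ = (y * d i * ‖u s i‖ - ‖ρ s i‖) ^ 2 / (2 * y * d i) := by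
          field_simp; ring
        have : 0 ≤ (y * d i * ‖u s i‖ - ‖ρ s i‖) ^ 2 / (2 * y * d i) := by positivity
        linarith
    rw [Finset.sum_add_distrib, ← Finset.mul_sum, ← Finset.mul_sum] at h2
    have h3 : 1 / (2 * y) * ∑ i, ‖ρ s i‖ ^ 2 / d i ≤ 1 / (2 * y) * (m s * n) := by
      have := hρ s hs.1
      gcongr
    have h4 : 1 / (2 * y) * (m s * n) = n / (2 * y) * m s := by ring
    linarith
  -- the final energy is at least `n ‖a‖²`, so the dissipated energy is at most `2 n (1 - Re a)`
  have hsq : 2 * a.re - 1 ≤ ‖a‖ ^ 2 := by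
    have : a.re ^ 2 ≤ ‖a‖ ^ 2 := by
      rw [← sq_abs a.re]; exact pow_le_pow_left₀ (abs_nonneg _) (Complex.abs_re_le_norm a) 2
    nlinarith [sq_nonneg (a.re - 1)]
  have hyQ : 2 * y * Q ≤ 2 * n * (1 - a.re) := by nlinarith
  set J := ∫ s in (0 : ℝ)..t, m s
  have h5 : n * (1 - a.re) ≤ n / y * J := by
    have : n / (2 * y) * J = n / y * J / 2 := by field_simp
    linarith
  have h6 : y * (n * (1 - a.re)) ≤ y * (n / y * J) := by gcongr
  have h7 : y * (n / y * J) = n * J := by field_simp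
  have : n * (y * (1 - a.re)) ≤ n * J := by linarith
  exact le_of_mul_le_mul_left this hn

end Evolution

/-! ### Analytic dependence on a parameter -/

section EntireSolutions

variable {n : Type*} [Fintype n]

/-- Coefficients of the expansion in powers of `k` of the solution of `φ' = k L(t) φ`,
`φ(0) = v`. -/
noncomputable def powerCoeff (L : ℝ → Matrix n n ℂ) (v : n → ℂ) : ℕ → ℝ → n → ℂ
  | 0 => fun _ => v
  | m + 1 => fun t i => ∫ s in (0 : ℝ)..t, ∑ j, L s i j * powerCoeff L v m s j

variable {L : ℝ → Matrix n n ℂ} {v : n → ℂ}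

lemma continuous_powerCoeff (hL : ∀ i j, Continuous fun t => L t i j) (m : ℕ) (i : n) :
    Continuous fun t => powerCoeff L v m t i := by
  induction m generalizing i with
  | zero => exact continuous_const
  | succ m ih =>
    refine intervalIntegral.continuous_primitive (fun a b => ?_) 0
    exact (continuous_finsetSum _ fun j _ => (hL i j).mul (ih j)).intervalIntegrable _ _

lemma norm_powerCoeff_le (hL : ∀ i j, Continuous fun t => L t i j) {T ℓ w : ℝ} (hℓ0 : 0 ≤ ℓ)
    (hℓ : ∀ s ∈ Icc 0 T, ∀ i j, ‖L s i j‖ ≤ ℓ) (hv : ∀ i, ‖v i‖ ≤ w) (m : ℕ) {s : ℝ}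
    (hs : s ∈ Icc 0 T) (i : n) :
    ‖powerCoeff L v m s i‖ ≤ w * ((Fintype.card n * ℓ) * s) ^ m / m.factorial := by
  induction m generalizing s i with
  | zero => simpa [powerCoeff] using hv i
  | succ m ih =>
    have hw : 0 ≤ w := (norm_nonneg _).trans (hv i)
    have hbound : ∀ r ∈ Icc 0 s, ‖∑ j, L r i j * powerCoeff L v m r j‖ ≤
        Fintype.card n * (ℓ * (w * ((Fintype.card n * ℓ) * r) ^ m / m.factorial)) := by
      intro r hr
      have hrT : r ∈ Icc 0 T := ⟨hr.1, hr.2.trans hs.2⟩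
      refine (norm_sum_le _ _).trans ?_
      refine (Finset.sum_le_card_nsmul _ _
        (ℓ * (w * ((Fintype.card n * ℓ) * r) ^ m / m.factorial)) fun j _ => ?_).trans ?_
      · rw [norm_mul]
        exact mul_le_mul (hℓ r hrT i j) (ih hrT j) (norm_nonneg _) hℓ0
      · simp
    simp only [powerCoeff]
    refine (intervalIntegral.norm_integral_le_integral_norm hs.1).trans ?_
    refine (intervalIntegral.integral_mono_on hs.1 ?_ ?_ hbound).trans (le_of_eq ?_)
    · exact (continuous_finsetSum _ fun j _ => (hL i j).mul
        (continuous_powerCoeff hL m j)).norm.intervalIntegrable _ _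
    · exact Continuous.intervalIntegrable (by fun_prop) _ _
    · have : (fun r : ℝ => (Fintype.card n : ℝ) *
          (ℓ * (w * ((Fintype.card n * ℓ) * r) ^ m / m.factorial))) =
          fun r => (w * (Fintype.card n * ℓ) ^ (m + 1) / m.factorial) * r ^ m := by
        ext r; rw [mul_pow]; ring
      rw [this, intervalIntegral.integral_const_mul, integral_pow, Nat.factorial_succ]
      push_cast
      field_simp
      ring

/-- A linear equation `φ' = k L(t) φ` with continuous coefficient has a solution that is entire in
the parameter `k`. -/
lemma exists_entire_solution (hL : ∀ i j, Continuous fun t => L t i j) (v : n → ℂ) :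
    ∃ φ : ℂ → ℝ → n → ℂ,
      (∀ k i, IsPrimitive (fun t => φ k t i) (fun t => k * ∑ j, L t i j * φ k t j)) ∧
      (∀ k, φ k 0 = v) ∧ ∀ t, 0 ≤ t → ∀ i, Differentiable ℂ fun k => φ k t i := by
  have hbd : ∀ T : ℝ, ∃ A w : ℝ, 0 ≤ A ∧ 0 ≤ w ∧ ∀ m, ∀ s ∈ Icc 0 T, ∀ i,
      ‖powerCoeff L v m s i‖ ≤ w * A ^ m / m.factorial := by
    intro T
    have h1 : ∀ i j, ∃ C, ∀ s ∈ Icc 0 T, ‖L s i j‖ ≤ C := fun i j =>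
      isCompact_Icc.exists_bound_of_continuousOn (hL i j).continuousOn
    choose C hC using h1
    set ℓ := ∑ i, ∑ j, |C i j|
    have hℓ : ∀ s ∈ Icc 0 T, ∀ i j, ‖L s i j‖ ≤ ℓ := fun s hs i j =>
      (hC i j s hs).trans <| (le_abs_self _).trans <|
      (Finset.single_le_sum (f := fun j => |C i j|) (fun _ _ => abs_nonneg _)
        (Finset.mem_univ j)).trans <|
      Finset.single_le_sum (f := fun i => ∑ j, |C i j|)
        (fun _ _ => Finset.sum_nonneg fun _ _ => abs_nonneg _) (Finset.mem_univ i)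
    have hℓ0 : 0 ≤ ℓ := Finset.sum_nonneg fun _ _ => Finset.sum_nonneg fun _ _ => abs_nonneg _
    have hw : ∀ i, ‖v i‖ ≤ ∑ i, ‖v i‖ := fun i =>
      Finset.single_le_sum (f := fun i => ‖v i‖) (fun _ _ => norm_nonneg _) (Finset.mem_univ i)
    have hw0 : 0 ≤ ∑ i, ‖v i‖ := Finset.sum_nonneg fun _ _ => norm_nonneg _
    refine ⟨Fintype.card n * ℓ * |T|, ∑ i, ‖v i‖, by positivity, hw0, fun m s hs i => ?_⟩
    refine (norm_powerCoeff_le hL hℓ0 hℓ hw m hs i).trans ?_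
    have hs0 := hs.1
    have : s ≤ |T| := hs.2.trans (le_abs_self _)
    gcongr
  have hsumm : ∀ w A r : ℝ, Summable fun m : ℕ => r ^ m * (w * A ^ m / m.factorial) := by
    intro w A r
    have : (fun m : ℕ => r ^ m * (w * A ^ m / m.factorial)) =
        fun m : ℕ => w * ((r * A) ^ m / m.factorial) := by
      ext m; rw [mul_pow]; ring
    rw [this]
    exact (Real.summable_pow_div_factorial _).mul_left _
  have hnorm : ∀ {T : ℝ} {A w : ℝ}, (∀ m, ∀ s ∈ Icc 0 T, ∀ i,
      ‖powerCoeff L v m s i‖ ≤ w * A ^ m / m.factorial) → ∀ (k : ℂ) (r : ℝ), ‖k‖ ≤ r →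
      ∀ m, ∀ s ∈ Icc 0 T, ∀ i, ‖k ^ m * powerCoeff L v m s i‖ ≤
        r ^ m * (w * A ^ m / m.factorial) := by
    intro T A w h k r hk m s hs i
    rw [norm_mul, norm_pow]
    exact mul_le_mul (pow_le_pow_left₀ (norm_nonneg _) hk m) (h m s hs i) (norm_nonneg _)
      (pow_nonneg ((norm_nonneg _).trans hk) m)
  set φ : ℂ → ℝ → n → ℂ := fun k t i => ∑' m : ℕ, k ^ m * powerCoeff L v m t i with hφ
  have hsum : ∀ k t, 0 ≤ t → ∀ i, HasSum (fun m : ℕ => k ^ m * powerCoeff L v m t i) (φ k t i) := by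
    intro k t ht i
    obtain ⟨A, w, hA, hw, h⟩ := hbd t
    exact (Summable.of_norm_bounded (hsumm w A ‖k‖)
      fun m => hnorm h k _ le_rfl m t ⟨ht, le_rfl⟩ i).hasSum
  have hcont : ∀ k t i, ContinuousOn (fun s => φ k s i) (Icc 0 t) := by
    intro k t i
    obtain ⟨A, w, hA, hw, h⟩ := hbd t
    exact continuousOn_tsum (fun m => (continuous_const.mul
      (continuous_powerCoeff hL m i)).continuousOn) (hsumm w A ‖k‖)
      fun m s hs => hnorm h k _ le_rfl m s hs i
  have h00 : ∀ k, φ k 0 = v := by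
    intro k
    ext i
    refine (hsum k 0 le_rfl i).unique ?_
    have : (fun m : ℕ => k ^ m * powerCoeff L v m 0 i) = fun m => if m = 0 then v i else 0 := by
      ext m
      cases m <;> simp [powerCoeff]
    rw [this]
    exact hasSum_ite_eq 0 (v i)
  refine ⟨φ, fun k i => ⟨fun t ht => ?_, fun t ht => ?_⟩, h00, fun t ht i => ?_⟩
  · refine ContinuousOn.intervalIntegrable ?_
    rw [uIcc_of_le ht]
    exact continuousOn_const.mul (continuousOn_finsetSum _ fun j _ =>
      (hL i j).continuousOn.mul (hcont k t j))
  · obtain ⟨A, w, hA, hw, h⟩ := hbd t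
    obtain ⟨ℓ, hℓ⟩ : ∃ ℓ : n → ℝ, ∀ j, ∀ s ∈ Icc 0 t, ‖L s i j‖ ≤ ℓ j := by
      choose C hC using fun j => isCompact_Icc.exists_bound_of_continuousOn
        (s := Icc 0 t) (hL i j).continuousOn
      exact ⟨C, hC⟩
    have hdom := intervalIntegral.hasSum_integral_of_dominated_convergence (μ := volume)
      (a := 0) (b := t)
      (F := fun (m : ℕ) s => k * ∑ j, L s i j * (k ^ m * powerCoeff L v m s j))
      (f := fun s => k * ∑ j, L s i j * φ k s j)
      (bound := fun m _ => ‖k‖ * ∑ j, ℓ j * (‖k‖ ^ m * (w * A ^ m / m.factorial)))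
      (fun m => (continuous_const.mul (continuous_finsetSum _ fun j _ => (hL i j).mul
        (continuous_const.mul (continuous_powerCoeff hL m j)))).aestronglyMeasurable)
      (fun m => Eventually.of_forall fun s hs => by
        rw [uIoc_of_le ht] at hs
        have hs' : s ∈ Icc 0 t := ⟨hs.1.le, hs.2⟩
        rw [norm_mul]
        refine mul_le_mul_of_nonneg_left ((norm_sum_le _ _).trans
          (Finset.sum_le_sum fun j _ => ?_)) (norm_nonneg _)
        rw [norm_mul]
        exact mul_le_mul (hℓ j s hs') (hnorm h k _ le_rfl m s hs' j) (norm_nonneg _)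
          ((norm_nonneg _).trans (hℓ j s hs')))
      (Eventually.of_forall fun s _ => by
        refine Summable.mul_left _ (summable_sum fun j _ => (hsumm w A ‖k‖).mul_left _))
      (by simp)
      (Eventually.of_forall fun s hs => by
        rw [uIoc_of_le ht] at hs
        exact (hasSum_sum fun j _ => (hsum k s hs.1.le j).mul_left _).mul_left _)
    have hterm : ∀ m : ℕ, ∫ s in (0 : ℝ)..t, k * ∑ j, L s i j * (k ^ m * powerCoeff L v m s j) =
        k ^ (m + 1) * powerCoeff L v (m + 1) t i := by
      intro m
      simp only [powerCoeff]
      rw [← intervalIntegral.integral_const_mul]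
      congr 1
      ext s
      rw [Finset.mul_sum, Finset.mul_sum]
      exact Finset.sum_congr rfl fun j _ => by ring
    have := (hasSum_nat_add_iff (f := fun m => k ^ m * powerCoeff L v m t i) 1).1
      (hdom.congr_fun fun m => (hterm m).symm)
    rw [h00]
    refine ((hsum k t ht i).unique this).trans ?_
    simp [powerCoeff, add_comm]
  · obtain ⟨A, w, hA, hw, h⟩ := hbd t
    intro k
    have hopen : IsOpen (Metric.ball (0 : ℂ) (‖k‖ + 1)) := Metric.isOpen_ball
    have := Complex.differentiableOn_tsum_of_summable_norm (hsumm w A (‖k‖ + 1))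
      (fun m => ((differentiable_id.pow m).mul_const (powerCoeff L v m t i)).differentiableOn)
      hopen fun m z hz =>
        hnorm h z _ (by simpa using (mem_ball_zero_iff.1 hz).le) m t ⟨ht, le_rfl⟩ i
    exact (this k (by simp)).differentiableAt (hopen.mem_nhds (by simp))

end EntireSolutions

/-! ### Fundamental matrices -/

section FundamentalMatrix

variable {n : Type*} [Fintype n]

lemma IsEvolution.sub {k : ℂ} {d : n → ℝ} {H : ℝ → Matrix n n ℂ} {u w : ℝ → n → ℂ}
    (hu : IsEvolution k d H u) (hw : IsEvolution k d H w) :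
    IsEvolution k d H fun t i => u t i - w t i := fun i =>
  ((hu i).sub (hw i)).congr (fun _ _ => rfl) fun t _ => by
    simp only [mul_sub, Finset.sum_sub_distrib]; ring

/-- Evolutions with real spectral parameter are determined by their initial value. -/
lemma IsEvolution.unique {k : ℂ} {d : n → ℝ} {H : ℝ → Matrix n n ℂ} {u w : ℝ → n → ℂ}
    (hu : IsEvolution k d H u) (hw : IsEvolution k d H w)
    (hH : ∀ t, 0 ≤ t → (H t).IsHermitian) (hk : k.im = 0) (h0 : u 0 = w 0) {t : ℝ} (ht : 0 ≤ t) :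
    u t = w t := by
  have h := (hu.sub hw).sum_norm_sq_eq hH hk ht
  simp only [h0, sub_self, norm_zero, ne_eq, OfNat.ofNat_ne_zero, not_false_eq_true, zero_pow,
    Finset.sum_const_zero] at h
  ext i
  have := (Finset.sum_eq_zero_iff_of_nonneg fun _ _ => sq_nonneg _).1 h i (Finset.mem_univ i)
  exact sub_eq_zero.1 (norm_eq_zero.1 (pow_eq_zero_iff two_ne_zero |>.1 this))

lemma IsEvolution.inner_eq {k : ℂ} {d : n → ℝ} {H : ℝ → Matrix n n ℂ} {u w : ℝ → n → ℂ}
    (hu : IsEvolution k d H u) (hw : IsEvolution k d H w)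
    (hH : ∀ t, 0 ≤ t → (H t).IsHermitian) (hk : k.im = 0) {t : ℝ} (ht : 0 ≤ t) :
    ∑ i, star (w t i) * u t i = ∑ i, star (w 0 i) * u 0 i := by
  refine ((hu.pairing hw).congr (fun _ _ => rfl) fun s hs => ?_).eq_of_deriv_zero ht
  have e := sum_star_mul_hermitian (hH s hs) (w s) (u s)
  have hI : star Complex.I = -Complex.I := Complex.conj_I
  have hk' : star k = k := Complex.conj_eq_iff_im.2 hk
  have e2 : ∀ i, (star (Complex.I * (k * d i * w s i + ∑ j, H s i j * w s j)) * u s i +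
      star (w s i) * (Complex.I * (k * d i * u s i + ∑ j, H s i j * u s j))) =
      Complex.I * (star (w s i) * ∑ j, H s i j * u s j) -
        Complex.I * (star (∑ j, H s i j * w s j) * u s i) := by
    intro i
    rw [star_mul', star_add, star_mul', star_mul', hI, hk']
    have : star ((d i : ℝ) : ℂ) = d i := Complex.conj_ofReal _
    rw [this]; ring
  rw [Finset.sum_congr rfl fun i _ => e2 i, Finset.sum_sub_distrib, ← Finset.mul_sum,
    ← Finset.mul_sum, e, sub_self]

variable [DecidableEq n]

/-- `X` is a fundamental matrix on `[0, ∞)` for `i (k D + H(t))`: its columns are evolutions and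
`X(0) = 1`. -/
structure IsFundamentalMatrix (k : ℂ) (d : n → ℝ) (H : ℝ → Matrix n n ℂ)
    (X : ℝ → Matrix n n ℂ) : Prop where
  isEvolution : ∀ b, IsEvolution k d H fun t a => X t a b
  zero_eq : X 0 = 1

lemma IsFundamentalMatrix.conjTranspose_mul_self {k : ℂ} {d : n → ℝ} {H X : ℝ → Matrix n n ℂ}
    (hX : IsFundamentalMatrix k d H X) (hH : ∀ t, 0 ≤ t → (H t).IsHermitian) (hk : k.im = 0)
    {t : ℝ} (ht : 0 ≤ t) : (X t).conjTranspose * X t = 1 := by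
  ext a b
  have h := (hX.isEvolution b).inner_eq (hX.isEvolution a) hH hk ht
  rw [hX.zero_eq] at h
  simp only [Matrix.mul_apply, Matrix.conjTranspose_apply]
  rw [h]
  simp [Matrix.one_apply, apply_ite, eq_comm]

lemma IsFundamentalMatrix.mul_conjTranspose_self {k : ℂ} {d : n → ℝ} {H X : ℝ → Matrix n n ℂ}
    (hX : IsFundamentalMatrix k d H X) (hH : ∀ t, 0 ≤ t → (H t).IsHermitian) (hk : k.im = 0)
    {t : ℝ} (ht : 0 ≤ t) : X t * (X t).conjTranspose = 1 :=
  mul_eq_one_comm.1 (hX.conjTranspose_mul_self hH hk ht)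

lemma IsFundamentalMatrix.unique {k : ℂ} {d : n → ℝ} {H X Z : ℝ → Matrix n n ℂ}
    (hX : IsFundamentalMatrix k d H X) (hZ : IsFundamentalMatrix k d H Z)
    (hH : ∀ t, 0 ≤ t → (H t).IsHermitian) (hk : k.im = 0) {t : ℝ} (ht : 0 ≤ t) : X t = Z t := by
  ext a b
  exact congrFun ((hX.isEvolution b).unique (hZ.isEvolution b) hH hk
    (by rw [hX.zero_eq, hZ.zero_eq]) ht) a

lemma IsFundamentalSolution.isFundamentalMatrix {A : ℝ → Matrix n n ℂ} {X : ℝ → Matrix n n ℂ}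
    {k : ℂ} {d : n → ℝ} {H : ℝ → Matrix n n ℂ}
    (hX : IsFundamentalSolution A 0 X)
    (hA : ∀ t, A t = Complex.I • (k • Matrix.diagonal (fun m => (d m : ℂ)) + H t))
    (hH : ∀ a b, LocallyIntegrableOn (fun t => H t a b) (Ici 0)) :
    IsFundamentalMatrix k d H X := by
  have hXc : ∀ a b, ContinuousOn (fun t => X t a b) (Ici 0) := fun a b =>
    (continuous_id.matrix_elem a b).comp_continuousOn hX.continuousOn
  have hHi : ∀ a b t, 0 ≤ t → IntervalIntegrable (fun t => H t a b) volume 0 t := by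
    intro a b t ht
    rw [intervalIntegrable_iff_integrableOn_Icc_of_le ht]
    exact (hH a b).integrableOn_compact_subset (fun x hx => hx.1) isCompact_Icc
  have hform : ∀ t a b, (A t * X t) a b =
      Complex.I * (k * d a * X t a b + ∑ c, H t a c * X t c b) := by
    intro t a b
    rw [hA, Matrix.smul_mul, Matrix.add_mul, Matrix.smul_mul, Matrix.smul_apply, Matrix.add_apply,
      Matrix.smul_apply, Matrix.diagonal_mul, Matrix.mul_apply]
    simp only [smul_eq_mul]; ring
  have h0 : X 0 = 1 := by
    ext a b
    simpa using hX.integral_eq 0 le_rfl a b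
  refine ⟨fun b a => ⟨fun t ht => ?_, fun t ht => ?_⟩, h0⟩
  · have hsub : uIcc 0 t ⊆ Ici (0 : ℝ) := by rw [uIcc_of_le ht]; exact fun x hx => hx.1
    refine IntervalIntegrable.const_mul (IntervalIntegrable.add ?_ ?_) _
    · exact (continuousOn_const.mul ((hXc a b).mono hsub)).intervalIntegrable
    · have := IntervalIntegrable.sum Finset.univ
        (fun c _ => (hHi a c t ht).mul_continuousOn ((hXc c b).mono hsub))
      refine this.congr fun x _ => ?_
      simp
  · change X t a b = X 0 a b + _
    rw [h0]
    have := hX.integral_eq t ht a b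
    simp only [hform] at this
    exact this

/-- A fundamental matrix at `k = 0` extends to a family of fundamental matrices that is entire in
`k`: with `X₀` the former, `X₀ Φ` solves the equation as soon as `Φ' = i k (X₀* D X₀) Φ`, whose
coefficient is continuous. -/
lemma IsFundamentalMatrix.exists_entire {d : n → ℝ} {H X₀ : ℝ → Matrix n n ℂ} {d₀ : n → ℝ}
    (hX₀ : IsFundamentalMatrix 0 d₀ H X₀) (hH : ∀ t, 0 ≤ t → (H t).IsHermitian) :
    ∃ Z : ℂ → ℝ → Matrix n n ℂ, (∀ k, IsFundamentalMatrix k d H (Z k)) ∧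
      ∀ t, 0 ≤ t → ∀ a b, Differentiable ℂ fun k => Z k t a b := by
  set X' : ℝ → Matrix n n ℂ := fun t => X₀ (max t 0)
  set L : ℝ → Matrix n n ℂ := fun t =>
    (X' t).conjTranspose * (Matrix.diagonal (fun m => (d m : ℂ)) * X' t) with hL
  have hX'c : ∀ a b, Continuous fun t => X' t a b := fun a b =>
    (((hX₀.isEvolution b) a).continuousOn.comp_continuous (continuous_id.max continuous_const)
      fun x => mem_Ici.2 (le_max_right _ _))
  have hLc : ∀ i j, Continuous fun t => L t i j := by
    intro i j
    simp only [hL, Matrix.mul_apply, Matrix.conjTranspose_apply]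
    exact continuous_finsetSum _ fun c _ => ((hX'c c i).star).mul
      (continuous_finsetSum _ fun e _ => continuous_const.mul (hX'c e j))
  choose φ h1 h2 h3 using fun b : n => exists_entire_solution hLc (Pi.single b (1 : ℂ))
  refine ⟨fun k t => Matrix.of fun a b => ∑ c, X₀ t a c * φ b (Complex.I * k) t c,
    fun k => ⟨fun b a => ?_, ?_⟩, fun t ht a b => ?_⟩
  · refine (IsPrimitive.sum Finset.univ fun c _ =>
      ((hX₀.isEvolution c) a).mul (h1 b (Complex.I * k) c)).congr
      (fun t _ => by simp) fun t ht => ?_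
    have hmax : max t 0 = t := max_eq_left ht
    have hXL : X₀ t * L t = Matrix.diagonal (fun m => (d m : ℂ)) * X₀ t := by
      simp only [hL, X', hmax]
      rw [← Matrix.mul_assoc, hX₀.mul_conjTranspose_self hH (by simp) ht, Matrix.one_mul]
    have hXLφ : ∑ c, X₀ t a c * ∑ j, L t c j * φ b (Complex.I * k) t j =
        d a * ∑ c, X₀ t a c * φ b (Complex.I * k) t c := by
      simp_rw [Finset.mul_sum]
      rw [Finset.sum_comm]
      refine Finset.sum_congr rfl fun j _ => ?_
      have := congrFun (congrFun hXL a) j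
      rw [Matrix.mul_apply, Matrix.diagonal_mul] at this
      rw [← mul_assoc, ← this, Finset.sum_mul]
      exact Finset.sum_congr rfl fun c _ => by ring
    have hHX : ∑ j, H t a j * ∑ c, X₀ t j c * φ b (Complex.I * k) t c =
        ∑ c, (∑ j, H t a j * X₀ t j c) * φ b (Complex.I * k) t c := by
      simp_rw [Finset.mul_sum, Finset.sum_mul]
      rw [Finset.sum_comm]
      exact Finset.sum_congr rfl fun c _ => Finset.sum_congr rfl fun j _ => by ring
    simp only [Matrix.of_apply, zero_mul, zero_add]
    rw [hHX, mul_assoc k, ← hXLφ, mul_add, Finset.mul_sum, Finset.mul_sum, Finset.mul_sum,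
      ← Finset.sum_add_distrib]
    exact Finset.sum_congr rfl fun c _ => by ring
  · ext a b
    simp only [Matrix.of_apply, hX₀.zero_eq, h2]
    simp [Matrix.one_apply, Pi.single_apply]
  · simp only [Matrix.of_apply]
    refine Differentiable.fun_sum fun c _ => ?_
    exact ((h3 b t ht c).comp (differentiable_id.const_mul Complex.I)).const_mul _

end FundamentalMatrix

/-! ### Minors solve the compound equation -/

section Compound

variable {n : Type*} {p : ℕ}

lemma det_submatrix_eq_sum (X : Matrix n n ℂ) (f g : Fin p → n) :
    (X.submatrix f g).det =
      ∑ σ : Equiv.Perm (Fin p), ((Equiv.Perm.sign σ : ℤ) : ℂ) * ∏ i, X (f i) (g (σ i)) := by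
  rw [← Matrix.det_transpose, Matrix.det_apply']
  rfl

variable [DecidableEq n]

/-- The matrix induced by `W` on `p`-fold antisymmetric tensors, written on injective multi-indices
`f : Fin p ↪ n`: the entry `(c, f)` is the sum of `W (c r) (f r)` over the positions `r` off which
`c` and `f` agree. All orderings of a `p`-element set are kept, so no signs occur. -/
def compoundGenerator (p : ℕ) (W : Matrix n n ℂ) : Matrix (Fin p ↪ n) (Fin p ↪ n) ℂ :=
  fun c f => ∑ r, if ∀ i, i ≠ r → c i = f i then W (c r) (f r) else 0

lemma compoundGenerator_sub (W W' : Matrix n n ℂ) (c f : Fin p ↪ n) :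
    compoundGenerator p W c f - compoundGenerator p W' c f = compoundGenerator p (W - W') c f := by
  simp only [compoundGenerator, ← Finset.sum_sub_distrib]
  refine Finset.sum_congr rfl fun r _ => ?_
  split_ifs <;> simp

lemma compoundGenerator_isHermitian {W : Matrix n n ℂ} (hW : W.IsHermitian) :
    (compoundGenerator p W).IsHermitian := by
  ext c f
  simp only [Matrix.conjTranspose_apply, compoundGenerator, star_sum]
  refine Finset.sum_congr rfl fun r _ => ?_
  by_cases h : ∀ i, i ≠ r → c i = f i
  · rw [if_pos h, if_pos fun i hi => (h i hi).symm, hW.apply]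
  · rw [if_neg h, if_neg fun h' => h fun i hi => (h' i hi).symm, star_zero]

variable [Fintype n]

/-- Expansion of a derivative of a minor along one replaced row, in terms of injective
multi-indices: replacing row `f r` by row `l` gives zero unless the new multi-index is injective. -/
lemma sum_mul_det_update (W X : Matrix n n ℂ) (f : Fin p ↪ n) (g : Fin p → n) (r : Fin p) :
    ∑ l, W (f r) l * (X.submatrix (Function.update f r l) g).det =
      ∑ c : Fin p ↪ n, (if ∀ i, i ≠ r → f i = c i then W (f r) (c r) else 0) *
        (X.submatrix c g).det := by
  simp only [ite_mul, zero_mul]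
  rw [← Finset.sum_filter]
  have hupd : ∀ c : Fin p ↪ n, (∀ i, i ≠ r → f i = c i) → Function.update f r (c r) = c := by
    intro c hc
    ext i
    by_cases hi : i = r
    · subst hi; simp
    · rw [Function.update_of_ne hi, hc i hi]
  have h1 : ∀ c ∈ Finset.univ.filter (fun c : Fin p ↪ n => ∀ i, i ≠ r → f i = c i),
      W (f r) (c r) * (X.submatrix c g).det =
        W (f r) (c r) * (X.submatrix (Function.update f r (c r)) g).det := fun c hc => by
    rw [hupd c (Finset.mem_filter.1 hc).2]
  rw [Finset.sum_congr rfl h1, ← Finset.sum_image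
    (f := fun l => W (f r) l * (X.submatrix (Function.update f r l) g).det)
    (g := fun c : Fin p ↪ n => c r)]
  · refine (Finset.sum_subset (Finset.subset_univ _) fun l _ hl => ?_).symm
    by_cases hinj : Function.Injective (Function.update f r l)
    · refine absurd (Finset.mem_image.2 ⟨⟨_, hinj⟩, ?_, ?_⟩) hl
      · rw [Finset.mem_filter]
        exact ⟨Finset.mem_univ _, fun i hi => by simp [Function.update_of_ne hi]⟩
      · simp
    · rw [Function.Injective] at hinj
      push Not at hinj
      obtain ⟨i, i', he, hne⟩ := hinj
      rw [Matrix.det_zero_of_row_eq hne (by ext b; simp [he]), mul_zero]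
  · intro c hc c' hc' h
    ext i
    by_cases hi : i = r
    · subst hi; exact h
    · have h2 := (Finset.mem_filter.1 hc).2 i hi
      have h3 := (Finset.mem_filter.1 hc').2 i hi
      rw [← h2, h3]

/-- The `p × p` minors of a fundamental matrix with fixed columns solve the equation induced on
antisymmetric tensors. -/
lemma IsFundamentalMatrix.isEvolution_minor {k : ℂ} {d : n → ℝ} {H X : ℝ → Matrix n n ℂ}
    (hX : IsFundamentalMatrix k d H X) (g : Fin p → n) :
    IsEvolution k (fun f : Fin p ↪ n => ∑ r, d (f r)) (fun t => compoundGenerator p (H t))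
      (fun t f => ((X t).submatrix f g).det) := by
  intro f
  have hprod : ∀ σ : Equiv.Perm (Fin p), IsPrimitive
      (fun t => ∏ i, X t (f i) (g (σ i)))
      (fun t => ∑ r, (Complex.I * (k * d (f r) * X t (f r) (g (σ r)) +
        ∑ l, H t (f r) l * X t l (g (σ r)))) *
          ∏ i ∈ Finset.univ.erase r, X t (f i) (g (σ i))) := fun σ =>
    IsPrimitive.prod Finset.univ fun i _ => (hX.isEvolution (g (σ i))) (f i)
  refine (IsPrimitive.sum Finset.univ fun σ _ =>
    (hprod σ).const_mul ((Equiv.Perm.sign σ : ℤ) : ℂ)).congr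
    (fun t _ => det_submatrix_eq_sum _ _ _) fun t _ => ?_
  have hrow : ∀ (r : Fin p) (l : n), ((X t).submatrix (Function.update f r l) g).det =
      ∑ σ : Equiv.Perm (Fin p), ((Equiv.Perm.sign σ : ℤ) : ℂ) *
        (X t l (g (σ r)) * ∏ i ∈ Finset.univ.erase r, X t (f i) (g (σ i))) := by
    intro r l
    rw [det_submatrix_eq_sum]
    refine Finset.sum_congr rfl fun σ _ => ?_
    rw [← Finset.mul_prod_erase Finset.univ _ (Finset.mem_univ r), Function.update_self]
    congr 2
    refine Finset.prod_congr rfl fun i hi => ?_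
    rw [Function.update_of_ne (Finset.ne_of_mem_erase hi)]
  have hcomp : ∑ c, compoundGenerator p (H t) f c * ((X t).submatrix c g).det =
      ∑ r, ∑ l, H t (f r) l * ((X t).submatrix (Function.update f r l) g).det := by
    simp_rw [sum_mul_det_update (H t) (X t) f g, compoundGenerator, Finset.sum_mul]
    rw [Finset.sum_comm]
  have hself : ∀ r, ((X t).submatrix f g).det =
      ∑ σ : Equiv.Perm (Fin p), ((Equiv.Perm.sign σ : ℤ) : ℂ) *
        (X t (f r) (g (σ r)) * ∏ i ∈ Finset.univ.erase r, X t (f i) (g (σ i))) := fun r => by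
    rw [← hrow r (f r), Function.update_eq_self]
  have hdiag : k * ((∑ r, d (f r) : ℝ) : ℂ) * ((X t).submatrix f g).det =
      ∑ r, k * d (f r) * ((X t).submatrix f g).det := by
    push_cast
    rw [Finset.mul_sum, Finset.sum_mul]
  rw [hcomp, hdiag, ← Finset.sum_add_distrib, Finset.mul_sum]
  simp_rw [Finset.mul_sum (s := (Finset.univ : Finset (Fin p)))]
  rw [Finset.sum_comm]
  refine Finset.sum_congr rfl fun r _ => ?_
  rw [hself r]
  simp_rw [hrow, Finset.mul_sum]
  rw [Finset.sum_comm, ← Finset.sum_add_distrib, Finset.mul_sum]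
  refine Finset.sum_congr rfl fun σ _ => ?_
  set P := ∏ i ∈ Finset.univ.erase r, X t (f i) (g (σ i))
  set ε := ((Equiv.Perm.sign σ : ℤ) : ℂ)
  have e : ∑ l, H t (f r) l * (ε * (X t l (g (σ r)) * P)) =
      (∑ l, H t (f r) l * X t l (g (σ r))) * ε * P := by
    rw [Finset.sum_mul, Finset.sum_mul]
    exact Finset.sum_congr rfl fun l _ => by ring
  rw [e]
  ring

end Compound

/-! ### Multi-indices differing in one position -/

section MultiIndex

variable {n : Type*} {p : ℕ}

/-- Two different injective multi-indices that agree off the position `r` have different underlying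
sets. -/
lemma agree_off_notMem {r : Fin p} {c f : Fin p ↪ n} (h : ∀ i, i ≠ r → c i = f i)
    (hne : c ≠ f) : c r ∉ Finset.univ.map f := by
  intro hmem
  obtain ⟨i, -, hi⟩ := Finset.mem_map.1 hmem
  by_cases hir : i = r
  · subst hir
    refine hne (DFunLike.ext _ _ fun i' => ?_)
    by_cases h' : i' = i
    · subst h'; exact hi.symm
    · exact h i' h'
  · rw [← h i hir] at hi
    exact hir (c.injective hi)

lemma agree_off_unique {r r' : Fin p} {c f : Fin p ↪ n} (h : ∀ i, i ≠ r → c i = f i)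
    (h' : ∀ i, i ≠ r' → c i = f i) (hne : c ≠ f) : r = r' := by
  by_contra hrr
  refine hne (DFunLike.ext _ _ fun i => ?_)
  by_cases hi : i = r
  · subst hi; exact h' i hrr
  · exact h i hi

lemma eq_of_agree_off_of_map_eq {r : Fin p} {f f' : Fin p ↪ n} (h : ∀ i, i ≠ r → f i = f' i)
    (hmap : Finset.univ.map f = Finset.univ.map f') : f = f' := by
  by_contra hne
  exact agree_off_notMem h hne (hmap ▸ Finset.mem_map_of_mem f (Finset.mem_univ r))

lemma sum_comp_eq_of_agree_off {r : Fin p} {c f : Fin p ↪ n} (h : ∀ i, i ≠ r → c i = f i)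
    (lam : n → ℝ) : ∑ i, lam (c i) - ∑ i, lam (f i) = lam (c r) - lam (f r) := by
  rw [← Finset.sum_sub_distrib, Finset.sum_eq_single r]
  · intro i _ hi; rw [h i hi, sub_self]
  · simp

variable [DecidableEq n]

lemma compoundGenerator_apply_of_agree_off {W : Matrix n n ℂ} {r : Fin p} {c f : Fin p ↪ n}
    (h : ∀ i, i ≠ r → c i = f i) (hne : c ≠ f) : compoundGenerator p W c f = W (c r) (f r) := by
  rw [compoundGenerator, Finset.sum_eq_single r, if_pos h]
  · intro r' _ hr'
    exact if_neg fun h' => hr' (agree_off_unique h' h hne)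
  · simp

lemma exists_agree_off_of_compoundGenerator_ne_zero {W : Matrix n n ℂ} (hW : ∀ m, W m m = 0)
    {c f : Fin p ↪ n} (h : compoundGenerator p W c f ≠ 0) :
    c ≠ f ∧ ∃ r, (∀ i, i ≠ r → c i = f i) ∧ compoundGenerator p W c f = W (c r) (f r) := by
  have hne : c ≠ f := by
    rintro rfl
    exact h (Finset.sum_eq_zero fun r _ => by simp [hW])
  obtain ⟨r, -, hr⟩ := Finset.exists_ne_zero_of_sum_ne_zero h
  have hr' : ∀ i, i ≠ r → c i = f i := by
    by_contra hcon
    exact hr (if_neg hcon)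
  exact ⟨hne, r, hr', compoundGenerator_apply_of_agree_off hr' hne⟩

variable [Fintype n]

/-- Injective multi-indices with the same underlying set as `g` are the reorderings of `g`. -/
lemma sum_filter_map_eq {M : Type*} [AddCommMonoid M] (g : Fin p ↪ n) (Φ : (Fin p ↪ n) → M) :
    ∑ f ∈ Finset.univ.filter (fun f : Fin p ↪ n => Finset.univ.map f = Finset.univ.map g), Φ f =
      ∑ σ : Equiv.Perm (Fin p), Φ (σ.toEmbedding.trans g) := by
  symm
  refine Finset.sum_bij (fun σ _ => σ.toEmbedding.trans g) (fun σ _ => ?_) (fun σ _ σ' _ h => ?_)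
    (fun f hf => ?_) (fun _ _ => rfl)
  · rw [Finset.mem_filter]
    refine ⟨Finset.mem_univ _, ?_⟩
    rw [← Finset.map_map]
    congr 1
    simp
  · ext i
    have := DFunLike.congr_fun h i
    exact congrArg Fin.val (g.injective this)
  · have hmap := (Finset.mem_filter.1 hf).2
    have : ∀ i, ∃ i', g i' = f i := fun i => by
      have h : f i ∈ Finset.univ.map g := hmap ▸ Finset.mem_map_of_mem f (Finset.mem_univ i)
      obtain ⟨i', -, hi'⟩ := Finset.mem_map.1 h
      exact ⟨i', hi'⟩
    choose s hs using this
    have hinj : Function.Injective s := fun i i' h => f.injective (by rw [← hs, ← hs, h])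
    refine ⟨Equiv.ofBijective s (Finite.injective_iff_bijective.1 hinj), Finset.mem_univ _, ?_⟩
    ext i
    exact hs i

lemma sum_filter_map_eq_of_invariant {R : Type*} [NonAssocSemiring R] (g : Fin p ↪ n)
    (Φ : (Fin p ↪ n) → R)
    (hΦ : ∀ (f : Fin p ↪ n) (σ : Equiv.Perm (Fin p)), Φ (σ.toEmbedding.trans f) = Φ f) :
    ∑ f ∈ Finset.univ.filter (fun f : Fin p ↪ n => Finset.univ.map f = Finset.univ.map g), Φ f =
      p.factorial * Φ g := by
  rw [sum_filter_map_eq, Finset.sum_congr rfl fun σ _ => hΦ g σ, Finset.sum_const,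
    Finset.card_univ, Fintype.card_perm, Fintype.card_fin, nsmul_eq_mul]

/-- A reordering-invariant function carried by finitely many underlying sets is summed by choosing
one ordering of each. -/
lemma sum_eq_factorial_mul_sum {R A : Type*} [NonAssocSemiring R] [Fintype A] (g : A → Fin p ↪ n)
    (hg : Function.Injective fun a => Finset.univ.map (g a)) (Φ : (Fin p ↪ n) → R)
    (hΦ : ∀ (f : Fin p ↪ n) (σ : Equiv.Perm (Fin p)), Φ (σ.toEmbedding.trans f) = Φ f)
    (h0 : ∀ f, Φ f = 0 ∨ ∃ a, Finset.univ.map f = Finset.univ.map (g a)) :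
    ∑ f, Φ f = p.factorial * ∑ a, Φ (g a) := by
  rw [Finset.mul_sum]
  simp_rw [← sum_filter_map_eq_of_invariant _ Φ hΦ, Finset.sum_filter]
  rw [Finset.sum_comm]
  refine Finset.sum_congr rfl fun f _ => ?_
  rcases h0 f with h | ⟨a, ha⟩
  · simp [h]
  · rw [Finset.sum_eq_single a, if_pos ha]
    · intro a' _ ha'
      exact if_neg fun h => ha' (hg (h.symm.trans ha))
    · simp

lemma factorial_mul_sum_le {A : Type*} [Fintype A] (g : A → Fin p ↪ n)
    (hg : Function.Injective fun a => Finset.univ.map (g a)) (Φ : (Fin p ↪ n) → ℝ)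
    (hΦ : ∀ (f : Fin p ↪ n) (σ : Equiv.Perm (Fin p)), Φ (σ.toEmbedding.trans f) = Φ f)
    (h0 : ∀ f, 0 ≤ Φ f) :
    p.factorial * ∑ a, Φ (g a) ≤ ∑ f, Φ f := by
  rw [Finset.mul_sum]
  simp_rw [← sum_filter_map_eq_of_invariant _ Φ hΦ, Finset.sum_filter]
  rw [Finset.sum_comm]
  refine Finset.sum_le_sum fun f _ => ?_
  by_cases h : ∃ a, Finset.univ.map f = Finset.univ.map (g a)
  · obtain ⟨a, ha⟩ := h
    rw [Finset.sum_eq_single a, if_pos ha]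
    · intro a' _ ha'
      exact if_neg fun h => ha' (hg (h.symm.trans ha))
    · simp
  · rw [Finset.sum_eq_zero]
    · exact h0 f
    · intro a _
      exact if_neg fun ha => h ⟨a, ha⟩

section Coupling

variable {A : Type*} {g : A → Fin p ↪ n} {lam : n → ℝ} {μ : ℝ}
  {W : Matrix n n ℂ} {z : (Fin p ↪ n) → ℂ}

/-- A vector carried by multi-indices of frequency `μ` is coupled only to multi-indices of a
different frequency, because every single coupling strictly raises it. -/
lemma compoundGenerator_mulVec_eq_zero (hW : ∀ m, W m m = 0)
    (hz : ∀ f, z f ≠ 0 → ∃ a, Finset.univ.map f = Finset.univ.map (g a))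
    (hμ : ∀ (f : Fin p ↪ n) a, Finset.univ.map f = Finset.univ.map (g a) → ∑ r, lam (f r) = μ)
    (hgap : ∀ a, ∀ m ∈ Finset.univ.map (g a), ∀ l ∉ Finset.univ.map (g a),
      W l m ≠ 0 → lam m < lam l) {c : Fin p ↪ n} (hc : ∑ r, lam (c r) - μ = 0) :
    ∑ f, compoundGenerator p W c f * z f = 0 := by
  refine Finset.sum_eq_zero fun f _ => ?_
  by_contra hne0
  obtain ⟨a, ha⟩ := hz f (right_ne_zero_of_mul hne0)
  obtain ⟨hne, r, hr, hWr⟩ := exists_agree_off_of_compoundGenerator_ne_zero hW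
    (left_ne_zero_of_mul hne0)
  have h1 := hgap a (f r) (ha ▸ Finset.mem_map_of_mem f (Finset.mem_univ r)) (c r)
    (ha ▸ agree_off_notMem hr hne) (hWr ▸ left_ne_zero_of_mul hne0)
  have h2 := sum_comp_eq_of_agree_off hr lam
  rw [hμ f a ha, hc] at h2
  linarith

variable [Fintype A]

/-- Distinct multi-indices that the generator couples to the same `c` have distinct underlying
sets; hence at most `card A` terms of the sum defining `(W z) c` are nonzero. -/
lemma card_coupled_le (hW : ∀ m, W m m = 0)
    (hz : ∀ f, z f ≠ 0 → ∃ a, Finset.univ.map f = Finset.univ.map (g a)) (c : Fin p ↪ n) :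
    (Finset.univ.filter fun f => compoundGenerator p W c f * z f ≠ 0).card ≤ Fintype.card A := by
  classical
  have hsub : (Finset.univ.filter fun f => compoundGenerator p W c f * z f ≠ 0).image
      (fun f => Finset.univ.map f) ⊆ Finset.univ.image fun a => Finset.univ.map (g a) := by
    intro Q hQ
    obtain ⟨f, hf, rfl⟩ := Finset.mem_image.1 hQ
    obtain ⟨a, ha⟩ := hz f (right_ne_zero_of_mul (Finset.mem_filter.1 hf).2)
    exact Finset.mem_image.2 ⟨a, Finset.mem_univ _, ha.symm⟩
  rw [← Finset.card_image_of_injOn (f := fun f : Fin p ↪ n => Finset.univ.map f)]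
  · exact (Finset.card_le_card hsub).trans (Finset.card_image_le)
  · intro f hf f' hf' hmap
    have hf := (Finset.mem_filter.1 (Finset.mem_coe.1 hf)).2
    have hf' := (Finset.mem_filter.1 (Finset.mem_coe.1 hf')).2
    obtain ⟨hne, r, hr, -⟩ := exists_agree_off_of_compoundGenerator_ne_zero hW
      (left_ne_zero_of_mul hf)
    obtain ⟨hne', r', hr', -⟩ := exists_agree_off_of_compoundGenerator_ne_zero hW
      (left_ne_zero_of_mul hf')
    have hrr : r = r' := by
      by_contra hrr
      have h1 := agree_off_notMem hr hne
      simp only at hmap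
      rw [hmap, hr' r hrr] at h1
      exact h1 (Finset.mem_map_of_mem f' (Finset.mem_univ r))
    subst hrr
    exact eq_of_agree_off_of_map_eq (fun i hi => (hr i hi).symm.trans (hr' i hi)) hmap

/-- The weighted size of the coupling `W z` of a vector `z` carried by `card A` underlying sets:
each pair `(m, l)` with `m` inside and `l` outside such a set is counted with the weight
`1 / (lam l - lam m)`, and at most `card A` terms interfere. -/
lemma sum_norm_compoundGenerator_mulVec_sq_le (hW : ∀ m, W m m = 0)
    (hz : ∀ f, z f ≠ 0 → ∃ a, Finset.univ.map f = Finset.univ.map (g a))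
    (hμ : ∀ (f : Fin p ↪ n) a, Finset.univ.map f = Finset.univ.map (g a) → ∑ r, lam (f r) = μ)
    (hd : ∀ c : Fin p ↪ n, 0 ≤ ∑ r, lam (c r) - μ)
    {ω : n → n → ℝ} (hω0 : ∀ m l, 0 ≤ ω m l)
    (hω : ∀ a, ∀ m ∈ Finset.univ.map (g a), ∀ l ∉ Finset.univ.map (g a),
      ‖W l m‖ ^ 2 / (lam l - lam m) ≤ ω m l) :
    ∑ c, ‖∑ f, compoundGenerator p W c f * z f‖ ^ 2 / (∑ r, lam (c r) - μ) ≤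
      Fintype.card A * (∑ m, ∑ l, ω m l) * ∑ f, ‖z f‖ ^ 2 := by
  have hsq : ∀ c, ‖∑ f, compoundGenerator p W c f * z f‖ ^ 2 ≤
      Fintype.card A * ∑ f, ‖compoundGenerator p W c f‖ ^ 2 * ‖z f‖ ^ 2 := by
    intro c
    have h1 : ∑ f, compoundGenerator p W c f * z f =
        ∑ f ∈ Finset.univ.filter (fun f => compoundGenerator p W c f * z f ≠ 0),
          compoundGenerator p W c f * z f := (Finset.sum_filter_ne_zero _).symm
    rw [h1]
    set s := Finset.univ.filter fun f => compoundGenerator p W c f * z f ≠ 0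
    calc ‖∑ f ∈ s, compoundGenerator p W c f * z f‖ ^ 2
        ≤ (∑ f ∈ s, ‖compoundGenerator p W c f * z f‖) ^ 2 := by
          gcongr; exact norm_sum_le _ _
      _ ≤ s.card * ∑ f ∈ s, ‖compoundGenerator p W c f * z f‖ ^ 2 := sq_sum_le_card_mul_sum_sq
      _ ≤ Fintype.card A * ∑ f, ‖compoundGenerator p W c f * z f‖ ^ 2 := by
          have h2 : (s.card : ℝ) ≤ Fintype.card A := by exact_mod_cast card_coupled_le hW hz c
          have h3 : ∑ f ∈ s, ‖compoundGenerator p W c f * z f‖ ^ 2 ≤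
              ∑ f, ‖compoundGenerator p W c f * z f‖ ^ 2 :=
            Finset.sum_le_sum_of_subset_of_nonneg (Finset.subset_univ _)
              fun _ _ _ => sq_nonneg _
          gcongr
      _ = _ := by simp_rw [norm_mul, mul_pow]
  have hcol : ∀ f, z f ≠ 0 →
      ∑ c, ‖compoundGenerator p W c f‖ ^ 2 / (∑ r, lam (c r) - μ) ≤ ∑ m, ∑ l, ω m l := by
    intro f hf
    obtain ⟨a, ha⟩ := hz f hf
    have h1 : ∀ c, ‖compoundGenerator p W c f‖ ^ 2 / (∑ r, lam (c r) - μ) ≤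
        ∑ r, if ∀ i, i ≠ r → c i = f i then ω (f r) (c r) else 0 := by
      intro c
      have hnn : ∀ r ∈ Finset.univ,
          0 ≤ if ∀ i, i ≠ r → c i = f i then ω (f r) (c r) else 0 := fun r _ => by
        split_ifs
        · exact hω0 _ _
        · exact le_rfl
      by_cases h0 : compoundGenerator p W c f = 0
      · rw [h0]; simpa using Finset.sum_nonneg hnn
      obtain ⟨hne, r, hr, hWr⟩ := exists_agree_off_of_compoundGenerator_ne_zero hW h0
      have h2 := sum_comp_eq_of_agree_off hr lam
      rw [hμ f a ha] at h2
      refine le_trans ?_ (Finset.single_le_sum hnn (Finset.mem_univ r))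
      rw [if_pos hr, h2, hWr]
      exact hω a _ (ha ▸ Finset.mem_map_of_mem f (Finset.mem_univ r)) _
        (ha ▸ agree_off_notMem hr hne)
    refine (Finset.sum_le_sum fun c _ => h1 c).trans ?_
    rw [Finset.sum_comm]
    have h3 : ∀ r, ∑ c : Fin p ↪ n, (if ∀ i, i ≠ r → c i = f i then ω (f r) (c r) else 0) ≤
        ∑ l, ω (f r) l := by
      intro r
      rw [← Finset.sum_filter, ← Finset.sum_image (f := fun l => ω (f r) l)
        (g := fun c : Fin p ↪ n => c r)]
      · exact Finset.sum_le_sum_of_subset_of_nonneg (Finset.subset_univ _)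
          fun _ _ _ => hω0 _ _
      · intro c hc c' hc' h
        ext i
        by_cases hi : i = r
        · subst hi; exact h
        · rw [(Finset.mem_filter.1 hc).2 i hi, (Finset.mem_filter.1 hc').2 i hi]
    refine (Finset.sum_le_sum fun r _ => h3 r).trans ?_
    rw [← Finset.sum_map Finset.univ f fun m => ∑ l, ω m l]
    exact Finset.sum_le_sum_of_subset_of_nonneg (Finset.subset_univ _)
      fun m _ _ => Finset.sum_nonneg fun l _ => hω0 _ _
  calc ∑ c, ‖∑ f, compoundGenerator p W c f * z f‖ ^ 2 / (∑ r, lam (c r) - μ)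
      ≤ ∑ c, (Fintype.card A * ∑ f, ‖compoundGenerator p W c f‖ ^ 2 * ‖z f‖ ^ 2) /
          (∑ r, lam (c r) - μ) :=
        Finset.sum_le_sum fun c _ => div_le_div_of_nonneg_right (hsq c) (hd c)
    _ = Fintype.card A * ∑ f, ‖z f‖ ^ 2 *
          ∑ c, ‖compoundGenerator p W c f‖ ^ 2 / (∑ r, lam (c r) - μ) := by
        simp_rw [Finset.mul_sum, Finset.sum_div]
        rw [Finset.sum_comm]
        exact Finset.sum_congr rfl fun f _ => Finset.sum_congr rfl fun c _ => by ring
    _ ≤ Fintype.card A * ∑ f, ‖z f‖ ^ 2 * ∑ m, ∑ l, ω m l := by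
        refine mul_le_mul_of_nonneg_left (Finset.sum_le_sum fun f _ => ?_) (Nat.cast_nonneg _)
        by_cases hf : z f = 0
        · simp [hf]
        · exact mul_le_mul_of_nonneg_left (hcol f hf) (sq_nonneg _)
    _ = _ := by rw [← Finset.sum_mul]; ring

end Coupling

end MultiIndex

/-! ### A Poisson-type estimate on the real line -/

lemma inv_sq_add_sq_eq {y : ℝ} (hy : 0 < y) (k : ℝ) :
    (k ^ 2 + y ^ 2)⁻¹ = (y ^ 2)⁻¹ * (1 + (y⁻¹ * k) ^ 2)⁻¹ := by
  rw [← mul_inv]; congr 1; field_simp; ring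

lemma integrable_inv_sq_add_sq {y : ℝ} (hy : 0 < y) :
    Integrable fun k : ℝ => (k ^ 2 + y ^ 2)⁻¹ := by
  simp_rw [inv_sq_add_sq_eq hy]
  exact ((integrable_inv_one_add_sq.comp_mul_left' (inv_ne_zero hy.ne')).const_mul _)

lemma integral_univ_inv_sq_add_sq {y : ℝ} (hy : 0 < y) :
    ∫ k : ℝ, (k ^ 2 + y ^ 2)⁻¹ = Real.pi / y := by
  simp_rw [inv_sq_add_sq_eq hy]
  rw [integral_const_mul, Measure.integral_comp_mul_left (fun x : ℝ => (1 + x ^ 2)⁻¹) y⁻¹,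
    integral_univ_inv_one_add_sq, inv_inv, abs_of_pos hy, smul_eq_mul]
  field_simp

/-- The Poisson formula on the imaginary axis for an entire function bounded in the closed upper
half-plane. The difference quotient of `F` at `i y`, divided by `z + i y`, is analytic there and
`O(|z|⁻²)`, so its integral over large rectangles based on the real axis leaves only the real axis
in the limit. -/
lemma poisson_formula_upperHalfPlane {F : ℂ → ℂ} (hF : Differentiable ℂ F) {B : ℝ}
    (hB : ∀ z : ℂ, 0 ≤ z.im → ‖F z‖ ≤ B) {y : ℝ} (hy : 0 < y) :
    ∫ k : ℝ, F k * ((k ^ 2 + y ^ 2)⁻¹ : ℝ) = F (Complex.I * y) * (Real.pi / y : ℝ) := by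
  set w : ℂ := Complex.I * y with hw
  have hwim : w.im = y := by simp [hw]
  have hwnorm : ‖w‖ = y := by simp [hw, abs_of_pos hy]
  have hB0 : 0 ≤ B := (norm_nonneg _).trans (hB w (by rw [hwim]; exact hy.le))
  set h : ℂ → ℂ := fun z => dslope F w z / (z + w) with hh
  have hds : Differentiable ℂ (dslope F w) := by
    rw [← differentiableOn_univ, Complex.differentiableOn_dslope (by simp)]
    exact hF.differentiableOn
  have hne : ∀ z : ℂ, 0 ≤ z.im → z + w ≠ 0 := fun z hz h0 => by
    have := congrArg Complex.im h0
    rw [Complex.add_im, hwim, Complex.zero_im] at this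
    linarith
  have hformula : ∀ z : ℂ, z ≠ w → h z = (F z - F w) / ((z - w) * (z + w)) := by
    intro z hz
    simp only [hh]
    rw [dslope_of_ne _ hz, slope_def_field, div_div]
  have hreal : ∀ k : ℝ, h k = (F k - F w) * ((k ^ 2 + y ^ 2)⁻¹ : ℝ) := by
    intro k
    have hk : (k : ℂ) ≠ w := fun e => by
      have := congrArg Complex.im e
      rw [hwim, Complex.ofReal_im] at this; linarith
    rw [hformula k hk, div_eq_mul_inv]
    congr 1
    push_cast
    congr 1
    rw [hw]; ring_nf; rw [Complex.I_sq]; ring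
  have hconti : Continuous fun k : ℝ => F k := hF.continuous.comp Complex.continuous_ofReal
  have hint1 : Integrable fun k : ℝ => F k * ((k ^ 2 + y ^ 2)⁻¹ : ℝ) := by
    refine (integrable_inv_sq_add_sq hy).ofReal.bdd_mul (c := B) hconti.aestronglyMeasurable ?_
    exact Eventually.of_forall fun k => hB k (by simp)
  have hint2 : Integrable fun k : ℝ => F w * ((k ^ 2 + y ^ 2)⁻¹ : ℝ) :=
    (integrable_inv_sq_add_sq hy).ofReal.const_mul _
  have hint : Integrable fun k : ℝ => h k := by
    simp_rw [hreal, sub_mul]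
    exact hint1.sub hint2
  have hbound : ∀ R : ℝ, 2 * y ≤ R → ∀ z : ℂ, 0 ≤ z.im → R ≤ ‖z‖ → ‖h z‖ ≤ 8 * B / R ^ 2 := by
    intro R hR z hz hRz
    have hR0 : 0 < R := by linarith
    have h1 : R / 2 ≤ ‖z - w‖ := by
      have := norm_sub_norm_le z w; rw [hwnorm] at this; linarith
    have h2 : R / 2 ≤ ‖z + w‖ := by
      have := norm_sub_norm_le z (-w); rw [norm_neg, hwnorm, sub_neg_eq_add] at this; linarith
    have hzw : z ≠ w := fun e => by
      rw [e, hwnorm] at hRz; linarith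
    rw [hformula z hzw, norm_div, norm_mul]
    have h3 : ‖F z - F w‖ ≤ 2 * B :=
      (norm_sub_le _ _).trans (by linarith [hB z hz, hB w (by rw [hwim]; exact hy.le)])
    calc ‖F z - F w‖ / (‖z - w‖ * ‖z + w‖) ≤ 2 * B / (R / 2 * (R / 2)) := by gcongr
      _ = 8 * B / R ^ 2 := by field_simp; ring
  -- the three other sides of the rectangle have total length `4 R`
  have hrect : ∀ R : ℝ, 2 * y ≤ R → ‖∫ x in -R..R, h x‖ ≤ 32 * B / R := by
    intro R hR
    have hR0 : 0 < R := by linarith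
    have hdiff : DifferentiableOn ℂ h
        (uIcc (-R : ℂ).re (R + R * Complex.I : ℂ).re ×ℂ
          uIcc (-R : ℂ).im (R + R * Complex.I : ℂ).im) := by
      intro z hz
      have hz' : 0 ≤ z.im := by
        have := hz.2
        simp only [Complex.neg_im, Complex.ofReal_im, neg_zero, Complex.add_im, Complex.mul_im,
          Complex.ofReal_re, Complex.I_im, Complex.I_re, mul_one, mul_zero, add_zero,
          zero_add] at this
        rw [mem_preimage, uIcc_of_le hR0.le] at this
        exact this.1
      exact ((hds z).div ((differentiableAt_id).add_const w) (hne z hz')).differentiableWithinAt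
    have hC := Complex.integral_boundary_rect_eq_zero_of_differentiableOn h (-R : ℂ)
      (R + R * Complex.I) hdiff
    simp only [Complex.neg_re, Complex.ofReal_re, Complex.add_re, Complex.mul_re, Complex.I_re,
      mul_zero, Complex.ofReal_im, Complex.I_im, mul_one, sub_self, add_zero, Complex.neg_im,
      neg_zero, Complex.ofReal_zero, zero_mul, Complex.add_im, Complex.mul_im, zero_add] at hC
    have htop : ‖∫ x in -R..R, h (x + R * Complex.I)‖ ≤ 8 * B / R ^ 2 * |R - -R| := by
      refine intervalIntegral.norm_integral_le_of_norm_le_const fun x _ => hbound R hR _ ?_ ?_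
      · simp [hR0.le]
      · refine le_trans ?_ (Complex.abs_im_le_norm _)
        simp [abs_of_pos hR0]
    have hright : ‖∫ x in (0 : ℝ)..R, h (R + x * Complex.I)‖ ≤ 8 * B / R ^ 2 * |R - 0| := by
      refine intervalIntegral.norm_integral_le_of_norm_le_const fun x hx => hbound R hR _ ?_ ?_
      · rw [uIoc_of_le hR0.le] at hx; simp [hx.1.le]
      · refine le_trans ?_ (Complex.abs_re_le_norm _)
        simp [abs_of_pos hR0]
    have hleft : ‖∫ x in (0 : ℝ)..R, h ((-R : ℝ) + x * Complex.I)‖ ≤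
        8 * B / R ^ 2 * |R - 0| := by
      refine intervalIntegral.norm_integral_le_of_norm_le_const fun x hx => hbound R hR _ ?_ ?_
      · rw [uIoc_of_le hR0.le] at hx; simp [hx.1.le]
      · refine le_trans ?_ (Complex.abs_re_le_norm _)
        simp [abs_of_pos hR0]
    have e : ∫ x in -R..R, h x = (∫ x in -R..R, h (x + R * Complex.I)) -
        Complex.I * (∫ x in (0 : ℝ)..R, h (R + x * Complex.I)) +
        Complex.I * ∫ x in (0 : ℝ)..R, h ((-R : ℝ) + x * Complex.I) := by
      simp only [smul_eq_mul] at hC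
      linear_combination hC
    rw [e]
    have hI : ∀ z : ℂ, ‖Complex.I * z‖ = ‖z‖ := fun z => by simp
    refine (norm_add_le _ _).trans ?_
    refine (add_le_add_left (norm_sub_le _ _) _).trans ?_
    rw [hI, hI]
    rw [abs_of_pos (by linarith)] at htop hright hleft
    have : 8 * B / R ^ 2 * (R - -R) + 8 * B / R ^ 2 * (R - 0) + 8 * B / R ^ 2 * (R - 0) =
        32 * B / R := by field_simp; ring
    linarith
  have hlim : Tendsto (fun R : ℝ => ∫ x in -R..R, h x) atTop (𝓝 (∫ x : ℝ, h x)) :=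
    intervalIntegral_tendsto_integral hint tendsto_neg_atTop_atBot tendsto_id
  have hlim0 : Tendsto (fun R : ℝ => ∫ x in -R..R, h x) atTop (𝓝 0) := by
    refine squeeze_zero_norm' (a := fun R => 32 * B / R) ?_
      (tendsto_const_nhds.div_atTop tendsto_id)
    filter_upwards [eventually_ge_atTop (2 * y)] with R hR using hrect R hR
  have hzero := tendsto_nhds_unique hlim hlim0
  simp_rw [hreal, sub_mul] at hzero
  rw [integral_sub hint1 hint2, sub_eq_zero] at hzero
  rw [hzero, integral_const_mul, ← integral_univ_inv_sq_add_sq hy]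
  exact congrArg _ integral_ofReal

/-- If `F` is entire, bounded by `1` in the closed upper half-plane, and tends to `1` along the
imaginary axis at the rate `M / y`, then `1 - Re F ≥ 0` has integral at most `π M` over the real
line. -/
lemma lintegral_one_sub_re_le {F : ℂ → ℂ} (hF : Differentiable ℂ F)
    (hB : ∀ z : ℂ, 0 ≤ z.im → ‖F z‖ ≤ 1) {M : ℝ}
    (hM : ∀ y : ℝ, 0 < y → y * (1 - (F (Complex.I * y)).re) ≤ M) :
    ∫⁻ k : ℝ, ENNReal.ofReal (1 - (F k).re) ≤ ENNReal.ofReal (Real.pi * M) := by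
  have hconti : Continuous fun k : ℝ => F k := hF.continuous.comp Complex.continuous_ofReal
  have hre : ∀ k : ℝ, 0 ≤ 1 - (F k).re := fun k => by
    have := (Complex.re_le_norm (F k)).trans (hB k (by simp)); linarith
  have hstep : ∀ y : ℝ, 0 < y →
      ∫⁻ k : ℝ, ENNReal.ofReal ((1 - (F k).re) * (y ^ 2 * (k ^ 2 + y ^ 2)⁻¹)) ≤
        ENNReal.ofReal (Real.pi * M) := by
    intro y hy
    have hG : Differentiable ℂ fun z => 1 - F z := (differentiable_const 1).sub hF
    have hGB : ∀ z : ℂ, 0 ≤ z.im → ‖1 - F z‖ ≤ 2 := fun z hz =>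
      (norm_sub_le _ _).trans (by rw [norm_one]; linarith [hB z hz])
    have hp := poisson_formula_upperHalfPlane hG hGB hy
    have hint : Integrable fun k : ℝ => (1 - F k) * ((k ^ 2 + y ^ 2)⁻¹ : ℝ) := by
      refine (integrable_inv_sq_add_sq hy).ofReal.bdd_mul (c := 2)
        (continuous_const.sub hconti).aestronglyMeasurable ?_
      exact Eventually.of_forall fun k => hGB k (by simp)
    have hpr := congrArg Complex.re hp
    rw [← RCLike.re_eq_complex_re, ← integral_re hint] at hpr
    simp only [RCLike.re_eq_complex_re, Complex.mul_re, Complex.ofReal_re, Complex.ofReal_im,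
      mul_zero, sub_zero, Complex.sub_re, Complex.one_re] at hpr
    have hint' := hint.re
    simp only [RCLike.re_eq_complex_re, Complex.mul_re, Complex.ofReal_re, Complex.ofReal_im,
      mul_zero, sub_zero, Complex.sub_re, Complex.one_re] at hint'
    simp_rw [mul_left_comm (1 - (F _).re) (y ^ 2)]
    rw [← ofReal_integral_eq_lintegral_ofReal (hint'.const_mul _)
      (Eventually.of_forall fun k => by have := hre k; positivity), integral_const_mul, hpr]
    apply ENNReal.ofReal_le_ofReal
    have : y ^ 2 * ((1 - (F (Complex.I * y)).re) * (Real.pi / y)) =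
        Real.pi * (y * (1 - (F (Complex.I * y)).re)) := by field_simp
    rw [this]
    have := hM y hy
    have := Real.pi_pos
    gcongr
  have hpt : ∀ k : ℝ, Tendsto (fun n : ℕ =>
      ENNReal.ofReal ((1 - (F k).re) * (((n : ℝ) + 1) ^ 2 * (k ^ 2 + ((n : ℝ) + 1) ^ 2)⁻¹)))
      atTop (𝓝 (ENNReal.ofReal (1 - (F k).re))) := by
    intro k
    refine (ENNReal.continuous_ofReal.tendsto _).comp ?_
    have h1 : Tendsto (fun y : ℝ => y ^ 2 * (k ^ 2 + y ^ 2)⁻¹) atTop (𝓝 1) := by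
      have h2 : Tendsto (fun y : ℝ => 1 - k ^ 2 / (k ^ 2 + y ^ 2)) atTop (𝓝 (1 - 0)) := by
        refine tendsto_const_nhds.sub (tendsto_const_nhds.div_atTop ?_)
        exact tendsto_atTop_add_const_left _ _ (tendsto_pow_atTop two_ne_zero)
      rw [sub_zero] at h2
      refine h2.congr' ?_
      filter_upwards [eventually_gt_atTop 0] with y hy
      field_simp; ring
    have h3 : Tendsto (fun n : ℕ => (n : ℝ) + 1) atTop atTop :=
      tendsto_atTop_add_const_right _ _ tendsto_natCast_atTop_atTop
    simpa using (h1.comp h3).const_mul (1 - (F k).re)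
  calc ∫⁻ k : ℝ, ENNReal.ofReal (1 - (F k).re)
      = ∫⁻ k : ℝ, liminf (fun n : ℕ => ENNReal.ofReal
          ((1 - (F k).re) * (((n : ℝ) + 1) ^ 2 * (k ^ 2 + ((n : ℝ) + 1) ^ 2)⁻¹))) atTop :=
        lintegral_congr fun k => (hpt k).liminf_eq.symm
    _ ≤ liminf (fun n : ℕ => ∫⁻ k : ℝ, ENNReal.ofReal
          ((1 - (F k).re) * (((n : ℝ) + 1) ^ 2 * (k ^ 2 + ((n : ℝ) + 1) ^ 2)⁻¹))) atTop := by
        refine lintegral_liminf_le fun n => ENNReal.measurable_ofReal.comp ?_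
        exact ((measurable_const.sub (Complex.measurable_re.comp hconti.measurable))).mul
          (by fun_prop)
    _ ≤ ENNReal.ofReal (Real.pi * M) := by
        refine liminf_le_of_le (by isBoundedDefault) fun b hb => ?_
        obtain ⟨n, hn⟩ := hb.exists
        exact hn.trans (hstep _ (by positivity))

/-! ### The integrated defect of an overlap of minors -/

section Minors

variable {n : Type*} {p : ℕ}

lemma det_submatrix_perm (X : Matrix n n ℂ) (f : Fin p ↪ n) (g : Fin p → n)
    (σ : Equiv.Perm (Fin p)) :
    (X.submatrix (σ.toEmbedding.trans f) g).det =
      ((Equiv.Perm.sign σ : ℤ) : ℂ) * (X.submatrix f g).det :=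
  Matrix.det_permute σ (X.submatrix f g)

lemma star_sign_mul_sign (σ : Equiv.Perm (Fin p)) :
    star ((Equiv.Perm.sign σ : ℤ) : ℂ) * ((Equiv.Perm.sign σ : ℤ) : ℂ) = 1 := by
  rcases Int.units_eq_one_or (Equiv.Perm.sign σ) with h | h <;> simp [h]

lemma norm_det_submatrix_perm (X : Matrix n n ℂ) (f : Fin p ↪ n) (g : Fin p → n)
    (σ : Equiv.Perm (Fin p)) :
    ‖(X.submatrix (σ.toEmbedding.trans f) g).det‖ ^ 2 = ‖(X.submatrix f g).det‖ ^ 2 := by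
  rw [det_submatrix_perm, norm_mul]
  rcases Int.units_eq_one_or (Equiv.Perm.sign σ) with h | h <;> simp [h]

variable [DecidableEq n]

lemma map_eq_of_det_one_submatrix_ne_zero {f g : Fin p ↪ n}
    (h : ((1 : Matrix n n ℂ).submatrix f g).det ≠ 0) :
    Finset.univ.map f = Finset.univ.map g := by
  refine Finset.eq_of_subset_of_card_le (fun x hx => ?_) (by simp)
  obtain ⟨i, -, rfl⟩ := Finset.mem_map.1 hx
  by_contra hcon
  refine h (Matrix.det_eq_zero_of_row_eq_zero i fun i' => ?_)
  rw [Matrix.submatrix_apply, Matrix.one_apply_ne]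
  intro he
  exact hcon (he ▸ Finset.mem_map_of_mem g (Finset.mem_univ i'))

variable [Fintype n]

lemma sum_norm_det_one_submatrix_sq (g : Fin p ↪ n) :
    ∑ f : Fin p ↪ n, ‖((1 : Matrix n n ℂ).submatrix f g).det‖ ^ 2 = p.factorial := by
  rw [sum_eq_factorial_mul_sum (A := Unit) (fun _ => g) (fun _ _ _ => rfl)
    _ (fun f σ => norm_det_submatrix_perm 1 f g σ)]
  · simp [Matrix.submatrix_one _ g.injective]
  · intro f
    by_cases h : ((1 : Matrix n n ℂ).submatrix f g).det = 0
    · left; rw [h]; simp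
    · exact Or.inr ⟨(), map_eq_of_det_one_submatrix_ne_zero h⟩

/-- For a unitary propagator the squares of the `p × p` minors with fixed columns, taken over
distinct sets of rows, sum to at most one. -/
lemma IsFundamentalMatrix.sum_norm_minor_sq_le_one {A : Type*} [Fintype A] {k : ℂ} {d : n → ℝ}
    {H X : ℝ → Matrix n n ℂ} (hX : IsFundamentalMatrix k d H X)
    (hH : ∀ t, 0 ≤ t → (H t).IsHermitian) (hk : k.im = 0) (g : A → Fin p ↪ n)
    (hg : Function.Injective fun a => Finset.univ.map (g a)) (g₀ : Fin p ↪ n)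
    {t : ℝ} (ht : 0 ≤ t) :
    ∑ a, ‖((X t).submatrix (g a) g₀).det‖ ^ 2 ≤ 1 := by
  have h1 := (hX.isEvolution_minor g₀).sum_norm_sq_eq
    (fun s hs => compoundGenerator_isHermitian (hH s hs)) hk ht
  rw [hX.zero_eq, sum_norm_det_one_submatrix_sq] at h1
  have h2 := factorial_mul_sum_le g hg (fun f => ‖((X t).submatrix f g₀).det‖ ^ 2)
    (fun f σ => norm_det_submatrix_perm (X t) f g₀ σ) fun _ => sq_nonneg _
  rw [h1] at h2
  have h3 : (0 : ℝ) < p.factorial := by exact_mod_cast p.factorial_pos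
  exact le_of_mul_le_mul_left (by linarith) h3

/-- At `k = 0` the frequencies are irrelevant. -/
lemma IsEvolution.of_zero {ι : Type*} [Fintype ι] {d d' : ι → ℝ} {H : ℝ → Matrix ι ι ℂ}
    {u : ℝ → ι → ℂ} (hu : IsEvolution 0 d H u) : IsEvolution 0 d' H u := fun i =>
  (hu i).congr (fun _ _ => rfl) fun t _ => by simp

/-- The main analytic estimate. The multi-indices `g a` have the lowest frequency `μ`, and the
minors of the evolution `Z`, which has no spectral parameter, vanish off the sets underlying them.
For each `k` the integrand is `1 - Re F(k)`, where `F(k)` is the overlap of the minors of `Z` with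
those of the full evolution, normalized by its phase. As a function of `k`, `F` is entire, bounded
by one in the upper half-plane by the energy identity, and tends to one along the imaginary axis at
a rate given by the total weighted coupling `ω`; hence the bound on the integral. -/
lemma lintegral_one_sub_overlap_le {A : Type*} [Fintype A] (g : A → Fin p ↪ n)
    (hg : Function.Injective fun a => Finset.univ.map (g a)) (b : A) {lam : n → ℝ} {μ : ℝ}
    {H H' : ℝ → Matrix n n ℂ} (hH : ∀ t, 0 ≤ t → (H t).IsHermitian)
    (hH' : ∀ t, 0 ≤ t → (H' t).IsHermitian) (hdiag : ∀ t, 0 ≤ t → ∀ m, (H t - H' t) m m = 0)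
    {X : ℂ → ℝ → Matrix n n ℂ} (hX : ∀ k, IsFundamentalMatrix k lam H (X k))
    (hXd : ∀ t, 0 ≤ t → ∀ a b, Differentiable ℂ fun k => X k t a b)
    {Z : ℝ → Matrix n n ℂ} {d' : n → ℝ} (hZ : IsFundamentalMatrix 0 d' H' Z)
    (hz : ∀ t, 0 ≤ t → ∀ f : Fin p ↪ n, ((Z t).submatrix f (g b)).det ≠ 0 →
      ∃ a, Finset.univ.map f = Finset.univ.map (g a))
    (hμ : ∀ a, ∑ r, lam (g a r) = μ) (hd : ∀ c : Fin p ↪ n, μ ≤ ∑ r, lam (c r))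
    (hgap : ∀ s, 0 ≤ s → ∀ a, ∀ m ∈ Finset.univ.map (g a), ∀ l ∉ Finset.univ.map (g a),
      (H s - H' s) l m ≠ 0 → lam m < lam l)
    {ω : ℝ → n → n → ℝ} (hω0 : ∀ s m l, 0 ≤ ω s m l)
    (hω : ∀ s, 0 ≤ s → ∀ a, ∀ m ∈ Finset.univ.map (g a), ∀ l ∉ Finset.univ.map (g a),
      ‖(H s - H' s) l m‖ ^ 2 / (lam l - lam m) ≤ ω s m l)
    {t : ℝ} (ht : 0 ≤ t) (hωi : IntervalIntegrable (fun s => ∑ m, ∑ l, ω s m l) volume 0 t) :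
    ∫⁻ k : ℝ, ENNReal.ofReal (1 - (∑ a, star ((Z t).submatrix (g a) (g b)).det *
        (Complex.exp (-(Complex.I * k * μ) * t) * ((X k t).submatrix (g a) (g b)).det)).re) ≤
      ENNReal.ofReal (Real.pi * (Fintype.card A * ∫ s in (0 : ℝ)..t, ∑ m, ∑ l, ω s m l)) := by
  set z : ℝ → (Fin p ↪ n) → ℂ := fun t f => ((Z t).submatrix f (g b)).det with hzdef
  set u : ℂ → ℝ → (Fin p ↪ n) → ℂ := fun k t f =>
    Complex.exp (-(Complex.I * k * μ) * t) * ((X k t).submatrix f (g b)).det with hudef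
  set F : ℂ → ℂ := fun k => ∑ a, star (z t (g a)) * u k t (g a) with hF
  have hcompH : ∀ s, 0 ≤ s → (compoundGenerator p (H s)).IsHermitian := fun s hs =>
    compoundGenerator_isHermitian (hH s hs)
  have hcompH' : ∀ s, 0 ≤ s → (compoundGenerator p (H' s)).IsHermitian := fun s hs =>
    compoundGenerator_isHermitian (hH' s hs)
  have hu : ∀ k, IsEvolution k (fun f : Fin p ↪ n => ∑ r, lam (f r) - μ)
      (fun t => compoundGenerator p (H t)) (u k) := fun k =>
    ((hX k).isEvolution_minor (g b)).gauge μ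
  have hw : IsEvolution 0 (fun f : Fin p ↪ n => ∑ r, lam (f r) - μ)
      (fun t => compoundGenerator p (H' t)) z := (hZ.isEvolution_minor (g b)).of_zero
  have hfac : (0 : ℝ) < p.factorial := by exact_mod_cast p.factorial_pos
  have hd0 : ∀ c : Fin p ↪ n, 0 ≤ ∑ r, lam (c r) - μ := fun c => sub_nonneg.2 (hd c)
  have hμ' : ∀ (f : Fin p ↪ n) a, Finset.univ.map f = Finset.univ.map (g a) →
      ∑ r, lam (f r) = μ := by
    intro f a h
    rw [← hμ a, ← Finset.sum_map Finset.univ f lam, h, Finset.sum_map]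
  have hz0 : ∑ f, ‖z 0 f‖ ^ 2 = p.factorial := by
    simp only [hzdef, hZ.zero_eq]; exact sum_norm_det_one_submatrix_sq (g b)
  have hzt : ∑ f, ‖z t f‖ ^ 2 = p.factorial := by
    rw [hw.sum_norm_sq_eq hcompH' (by simp) ht, hz0]
  have hu0 : ∀ k, u k 0 = z 0 := by
    intro k
    ext f
    simp [hudef, hzdef, hZ.zero_eq, (hX k).zero_eq]
  have hsum : ∀ k, ∑ f, star (z t f) * u k t f = p.factorial * F k := by
    intro k
    refine sum_eq_factorial_mul_sum g hg (fun f => star (z t f) * u k t f) (fun f σ => ?_)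
      fun f => ?_
    · simp only [hzdef, hudef, det_submatrix_perm, star_mul']
      have := star_sign_mul_sign σ
      linear_combination (star ((Z t).submatrix f (g b)).det *
        (Complex.exp (-(Complex.I * k * μ) * t) * ((X k t).submatrix f (g b)).det)) * this
    · by_cases h : z t f = 0
      · left; simp [h]
      · exact Or.inr (hz t ht f h)
  have hdetd : ∀ f : Fin p → n, Differentiable ℂ fun k => ((X k t).submatrix f (g b)).det := by
    intro f
    simp_rw [det_submatrix_eq_sum]
    refine Differentiable.fun_sum fun σ _ => Differentiable.const_mul ?_ _
    refine Differentiable.fun_finsetProd fun i _ => hXd t ht _ _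
  have hFd : Differentiable ℂ F := by
    refine Differentiable.fun_sum fun a _ => Differentiable.const_mul ?_ _
    refine Differentiable.mul ?_ (hdetd _)
    fun_prop
  refine lintegral_one_sub_re_le hFd (fun k hk => ?_) fun y hy => ?_
  · have h1 := norm_sum_star_mul_sq_le (z t) (u k t)
    have h2 := (hu k).sum_norm_sq_le hcompH hk hd0 ht
    rw [hu0, hz0] at h2
    rw [hsum, hzt, norm_mul, mul_pow, Complex.norm_natCast] at h1
    have h3 : (p.factorial : ℝ) ^ 2 * ‖F k‖ ^ 2 ≤ (p.factorial : ℝ) ^ 2 * 1 := by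
      nlinarith
    have h4 := le_of_mul_le_mul_left h3 (by positivity)
    nlinarith [norm_nonneg (F k)]
  · have hW : ∀ s, 0 ≤ s → ∀ c, ∑ f, (compoundGenerator p (H s) c f -
        compoundGenerator p (H' s) c f) * z s f =
        ∑ f, compoundGenerator p (H s - H' s) c f * z s f := fun s _ c => by
      simp_rw [compoundGenerator_sub]
    have h1 := (hu (Complex.I * y)).overlap_decay hy hd0 hcompH hcompH' hw (hu0 _) hfac hz0
      (fun s hs f => by
        by_cases h : z s f = 0
        · exact Or.inr h
        · obtain ⟨a, ha⟩ := hz s hs f h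
          left; rw [hμ' f a ha, sub_self])
      (fun s hs c hc => by
        rw [hW s hs]
        exact compoundGenerator_mulVec_eq_zero (hdiag s hs) (hz s hs) hμ' (hgap s hs) hc)
      ht (hωi.const_mul (Fintype.card A : ℝ))
      (fun s hs => by
        simp_rw [hW s hs]
        refine (sum_norm_compoundGenerator_mulVec_sq_le (hdiag s hs) (hz s hs) hμ' hd0
          (hω0 s) (hω s hs)).trans (le_of_eq ?_)
        rw [hw.sum_norm_sq_eq hcompH' (by simp) hs, hz0])
    rw [hsum, intervalIntegral.integral_const_mul] at h1
    have h2 : ((p.factorial : ℂ) * F (Complex.I * y)) / ((p.factorial : ℝ) : ℂ) =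
        F (Complex.I * y) := by
      have : (p.factorial : ℂ) ≠ 0 := by exact_mod_cast p.factorial_ne_zero
      push_cast
      field_simp
    rwa [h2] at h1

end Minors

/-! ### The double frequency and its low multi-indices -/

section DoubleFrequency

variable {N j : ℕ}

/-- The standing assumptions: `lam` has the double value `lam j = lam (j + 1)`, isolated from the
others, and `V` is a locally integrable Hermitian perturbation with zero diagonal and finite
mass. -/
structure IsDoubleFrequency (j : ℕ) (lam : Fin N → ℝ) (V : ℝ → Matrix (Fin N) (Fin N) ℂ) :
    Prop where
  lt : j + 1 < N
  monotone : Monotone lam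
  low : ∀ m l : Fin N, (m : ℕ) < j → j ≤ (l : ℕ) → lam m < lam l
  double : ∀ m l : Fin N, (m : ℕ) = j → (l : ℕ) = j + 1 → lam m = lam l
  high : ∀ m l : Fin N, (m : ℕ) ≤ j + 1 → j + 2 ≤ (l : ℕ) → lam m < lam l
  locallyIntegrableOn : ∀ m l, LocallyIntegrableOn (fun t => V t m l) (Ici 0)
  isHermitian : ∀ t, 0 ≤ t → (V t).IsHermitian
  diag_eq_zero : ∀ t, 0 ≤ t → ∀ m, V t m m = 0
  mass_lt_top : doubleMass lam V j < ∞

/-- The two indices `j`, `j + 1` of the double frequency. -/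
def pairIndex (h : j + 1 < N) : Fin 2 ↪ Fin N where
  toFun a := ⟨j + a, by omega⟩
  inj' a b hab := by
    have := congrArg Fin.val hab
    ext
    simpa using this

@[simp] lemma coe_pairIndex (h : j + 1 < N) (a : Fin 2) : (pairIndex h a : ℕ) = j + a := rfl

/-- The multi-index `(0, …, j - 1)`. -/
def lowIndex (h : j + 1 < N) : Fin j ↪ Fin N := Fin.castLEEmb (by omega)

@[simp] lemma coe_lowIndex (h : j + 1 < N) (i : Fin j) : (lowIndex h i : ℕ) = i := rfl

/-- The multi-index `(0, …, j - 1, j + a)`, with `a = 0` or `a = 1`. -/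
def lowPairIndex (h : j + 1 < N) (a : Fin 2) : Fin (j + 1) ↪ Fin N where
  toFun := Fin.snoc (α := fun _ => Fin N) (lowIndex h) (pairIndex h a)
  inj' := by
    intro x y
    induction x using Fin.lastCases <;> induction y using Fin.lastCases <;>
      simp [Fin.ext_iff] <;> omega

@[simp] lemma lowPairIndex_castSucc (h : j + 1 < N) (a : Fin 2) (i : Fin j) :
    lowPairIndex h a i.castSucc = lowIndex h i :=
  Fin.snoc_castSucc (α := fun _ => Fin N) _ _ i

@[simp] lemma lowPairIndex_last (h : j + 1 < N) (a : Fin 2) :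
    lowPairIndex h a (Fin.last j) = pairIndex h a :=
  Fin.snoc_last (α := fun _ => Fin N) _ _

lemma mem_map_lowIndex (h : j + 1 < N) (x : Fin N) :
    x ∈ Finset.univ.map (lowIndex h) ↔ (x : ℕ) < j := by
  constructor
  · intro hx
    obtain ⟨i, -, rfl⟩ := Finset.mem_map.1 hx
    exact i.2
  · intro hx
    exact Finset.mem_map.2 ⟨⟨x, hx⟩, Finset.mem_univ _, Fin.ext rfl⟩

lemma mem_map_lowPairIndex (h : j + 1 < N) (a : Fin 2) (x : Fin N) :
    x ∈ Finset.univ.map (lowPairIndex h a) ↔ (x : ℕ) < j ∨ x = pairIndex h a := by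
  constructor
  · intro hx
    obtain ⟨i, -, rfl⟩ := Finset.mem_map.1 hx
    induction i using Fin.lastCases with
    | last => right; simp
    | cast i => left; simp
  · rintro (hx | rfl)
    · exact Finset.mem_map.2 ⟨Fin.castSucc ⟨x, hx⟩, Finset.mem_univ _, by
        rw [lowPairIndex_castSucc]; exact Fin.ext rfl⟩
    · exact Finset.mem_map.2 ⟨Fin.last j, Finset.mem_univ _, by simp⟩

lemma map_lowPairIndex_injective (h : j + 1 < N) :
    Function.Injective fun a => Finset.univ.map (lowPairIndex h a) := by
  intro a b hab
  have h1 : pairIndex h a ∈ Finset.univ.map (lowPairIndex h a) :=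
    (mem_map_lowPairIndex h a _).2 (Or.inr rfl)
  simp only at hab
  rw [hab, mem_map_lowPairIndex] at h1
  rcases h1 with h1 | h1
  · simp at h1
  · exact (pairIndex h).injective h1

/-- Removing one entry of `lowPairIndex h a` leaves multi-indices with distinct underlying sets. -/
lemma map_succAbove_injective {p : ℕ} {n : Type*} (g : Fin (p + 1) ↪ n) :
    Function.Injective fun i : Fin (p + 1) =>
      Finset.univ.map ((Fin.succAboveEmb i).trans g) := by
  intro i i' hii
  by_contra hne
  simp only at hii
  have h1 : g i ∉ Finset.univ.map ((Fin.succAboveEmb i).trans g) := by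
    intro hmem
    obtain ⟨x, -, hx⟩ := Finset.mem_map.1 hmem
    exact Fin.succAbove_ne i x (g.injective hx)
  obtain ⟨x, hx⟩ := Fin.exists_succAbove_eq hne
  exact h1 (hii ▸ Finset.mem_map.2 ⟨x, Finset.mem_univ _, by simp [hx]⟩)

/-- The sum of a monotone function over `p` distinct indices is at least its sum over the first
`p` indices. -/
lemma sum_monotone_le {lam : Fin N → ℝ} (hlam : Monotone lam) {p : ℕ} (hp : p ≤ N)
    (c : Fin p ↪ Fin N) : ∑ i : Fin p, lam (Fin.castLE hp i) ≤ ∑ i, lam (c i) := by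
  have hcard : (Finset.univ.map c).card = p := by simp
  set e := (Finset.univ.map c).orderEmbOfFin hcard
  have h1 : ∑ i, lam (c i) = ∑ i, lam (e i) := by
    have h2 : ∑ i, lam (e i) = ∑ x ∈ Finset.univ.map e.toEmbedding, lam x := by
      rw [Finset.sum_map]; rfl
    rw [h2, Finset.map_orderEmbOfFin_univ, Finset.sum_map]
  rw [h1]
  refine Finset.sum_le_sum fun i _ => hlam ?_
  rw [Fin.le_def, Fin.val_castLE]
  obtain ⟨i, hi⟩ := i
  induction i with
  | zero => simp
  | succ i ih =>
    have h2 : i ≤ (e ⟨i, by omega⟩ : ℕ) := ih (by omega) (Finset.mem_univ _)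
    have h3 : e ⟨i, by omega⟩ < e ⟨i + 1, hi⟩ := e.strictMono (by simp [Fin.lt_def])
    rw [Fin.lt_def] at h3
    change i + 1 ≤ (e ⟨i + 1, hi⟩ : ℕ)
    omega

/-- The weighted density `|lam l - lam m|⁻¹ |V_{ml}(s)|²` of the pair `(m, l)`, if that pair
contributes to `doubleMass`. -/
noncomputable def pairDensity (j : ℕ) (lam : Fin N → ℝ) (V : ℝ → Matrix (Fin N) (Fin N) ℂ) (s : ℝ)
    (m l : Fin N) : ℝ :=
  (if (m : ℕ) < j ∧ ((l : ℕ) = j ∨ (l : ℕ) = j + 1) then |lam l - lam m|⁻¹ * ‖V s m l‖ ^ 2 else 0) +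
  if (m : ℕ) ≤ j + 1 ∧ j + 2 ≤ (l : ℕ) then |lam l - lam m|⁻¹ * ‖V s m l‖ ^ 2 else 0

lemma pairDensity_nonneg (j : ℕ) (lam : Fin N → ℝ) (V : ℝ → Matrix (Fin N) (Fin N) ℂ) (s : ℝ)
    (m l : Fin N) : 0 ≤ pairDensity j lam V s m l := by
  unfold pairDensity
  refine add_nonneg ?_ ?_ <;> split_ifs <;> positivity

lemma le_pairDensity {lam : Fin N → ℝ} {V : ℝ → Matrix (Fin N) (Fin N) ℂ} {s : ℝ} {m l : Fin N}
    (h : ((m : ℕ) < j ∧ ((l : ℕ) = j ∨ (l : ℕ) = j + 1)) ∨ ((m : ℕ) ≤ j + 1 ∧ j + 2 ≤ (l : ℕ))) :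
    |lam l - lam m|⁻¹ * ‖V s m l‖ ^ 2 ≤ pairDensity j lam V s m l := by
  have h0 : 0 ≤ |lam l - lam m|⁻¹ * ‖V s m l‖ ^ 2 := by positivity
  unfold pairDensity
  rcases h with h | h
  · rw [if_pos h]; split_ifs <;> linarith
  · rw [if_pos h]; split_ifs <;> linarith

lemma sum_pairDensity (j : ℕ) (lam : Fin N → ℝ) (V : ℝ → Matrix (Fin N) (Fin N) ℂ) (s : ℝ) :
    ∑ m, ∑ l, pairDensity j lam V s m l =
      (∑ m ∈ Finset.univ.filter (fun m : Fin N => (m : ℕ) < j),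
        ∑ l ∈ Finset.univ.filter (fun l : Fin N => (l : ℕ) = j ∨ (l : ℕ) = j + 1),
          |lam l - lam m|⁻¹ * ‖V s m l‖ ^ 2) +
      ∑ m ∈ Finset.univ.filter (fun m : Fin N => (m : ℕ) ≤ j + 1),
        ∑ l ∈ Finset.univ.filter (fun l : Fin N => j + 2 ≤ (l : ℕ)),
          |lam l - lam m|⁻¹ * ‖V s m l‖ ^ 2 := by
  simp only [pairDensity, Finset.sum_add_distrib, Finset.sum_filter, ite_and]
  congr 1 <;>
  · refine Finset.sum_congr rfl fun m _ => ?_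
    split_ifs <;> simp

lemma lintegral_density_eq_entryMass (lam : Fin N → ℝ) (V : ℝ → Matrix (Fin N) (Fin N) ℂ)
    (m l : Fin N) (S : Set ℝ) :
    ∫⁻ s in S, ‖|lam l - lam m|⁻¹ * ‖V s m l‖ ^ 2‖ₑ =
      ENNReal.ofReal |lam l - lam m|⁻¹ * ∫⁻ s in S, ‖V s m l‖ₑ ^ 2 := by
  rw [← lintegral_const_mul' _ _ ENNReal.ofReal_ne_top]
  refine lintegral_congr fun s => ?_
  rw [enorm_mul, enorm_pow, enorm_norm, Real.enorm_of_nonneg (by positivity)]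

namespace IsDoubleFrequency

variable {lam : Fin N → ℝ} {V : ℝ → Matrix (Fin N) (Fin N) ℂ}

lemma aestronglyMeasurable_density (h : IsDoubleFrequency j lam V) (m l : Fin N) :
    AEStronglyMeasurable (fun s => |lam l - lam m|⁻¹ * ‖V s m l‖ ^ 2)
      (volume.restrict (Ici 0)) :=
  ((h.locallyIntegrableOn m l).aestronglyMeasurable.norm.pow 2).const_mul _

lemma lintegral_sum_pairDensity (h : IsDoubleFrequency j lam V) :
    ∫⁻ s in Ici 0, ENNReal.ofReal (∑ m, ∑ l, pairDensity j lam V s m l) = doubleMass lam V j := by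
  have hm : ∀ m l, AEMeasurable (fun s => ENNReal.ofReal (|lam l - lam m|⁻¹ * ‖V s m l‖ ^ 2))
      (volume.restrict (Ici 0)) := fun m l =>
    (h.aestronglyMeasurable_density m l).aemeasurable.ennreal_ofReal
  have hnn : ∀ s m l, 0 ≤ |lam l - lam m|⁻¹ * ‖V s m l‖ ^ 2 := fun s m l => by positivity
  have hsum : ∀ s (M L : Finset (Fin N)),
      ENNReal.ofReal (∑ m ∈ M, ∑ l ∈ L, |lam l - lam m|⁻¹ * ‖V s m l‖ ^ 2) =
        ∑ m ∈ M, ∑ l ∈ L, ENNReal.ofReal (|lam l - lam m|⁻¹ * ‖V s m l‖ ^ 2) := by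
    intro s M L
    rw [ENNReal.ofReal_sum_of_nonneg fun m _ => Finset.sum_nonneg fun l _ => hnn s m l]
    exact Finset.sum_congr rfl fun m _ => ENNReal.ofReal_sum_of_nonneg fun l _ => hnn s m l
  have hint : ∀ (M L : Finset (Fin N)), ∫⁻ s in Ici 0,
      ∑ m ∈ M, ∑ l ∈ L, ENNReal.ofReal (|lam l - lam m|⁻¹ * ‖V s m l‖ ^ 2) =
        ∑ m ∈ M, ∑ l ∈ L, entryMass lam V m l := by
    intro M L
    rw [lintegral_finsetSum' _ fun m _ => Finset.aemeasurable_fun_sum _ fun l _ => hm m l]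
    refine Finset.sum_congr rfl fun m _ => ?_
    rw [lintegral_finsetSum' _ fun l _ => hm m l]
    refine Finset.sum_congr rfl fun l _ => ?_
    rw [entryMass, ← lintegral_density_eq_entryMass]
    exact lintegral_congr fun s => (Real.enorm_of_nonneg (hnn s m l)).symm
  simp_rw [sum_pairDensity]
  have hadd : ∀ s, ENNReal.ofReal
      ((∑ m ∈ Finset.univ.filter (fun m : Fin N => (m : ℕ) < j),
        ∑ l ∈ Finset.univ.filter (fun l : Fin N => (l : ℕ) = j ∨ (l : ℕ) = j + 1),
          |lam l - lam m|⁻¹ * ‖V s m l‖ ^ 2) +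
      ∑ m ∈ Finset.univ.filter (fun m : Fin N => (m : ℕ) ≤ j + 1),
        ∑ l ∈ Finset.univ.filter (fun l : Fin N => j + 2 ≤ (l : ℕ)),
          |lam l - lam m|⁻¹ * ‖V s m l‖ ^ 2) = _ := fun s =>
    ENNReal.ofReal_add (Finset.sum_nonneg fun m _ => Finset.sum_nonneg fun l _ => hnn s m l)
      (Finset.sum_nonneg fun m _ => Finset.sum_nonneg fun l _ => hnn s m l)
  simp_rw [hadd, hsum]
  rw [lintegral_add_left' (Finset.aemeasurable_fun_sum _ fun m _ =>
    Finset.aemeasurable_fun_sum _ fun l _ => hm m l), hint, hint, doubleMass]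

lemma integrableOn_sum_pairDensity (h : IsDoubleFrequency j lam V) :
    IntegrableOn (fun s => ∑ m, ∑ l, pairDensity j lam V s m l) (Ici 0) := by
  have hnn : ∀ s, 0 ≤ ∑ m, ∑ l, pairDensity j lam V s m l := fun s =>
    Finset.sum_nonneg fun m _ => Finset.sum_nonneg fun l _ => pairDensity_nonneg _ _ _ _ _ _
  refine ⟨?_, ?_⟩
  · simp_rw [sum_pairDensity]
    refine AEStronglyMeasurable.add ?_ ?_ <;>
    exact Finset.aestronglyMeasurable_fun_sum _ fun m _ =>
      Finset.aestronglyMeasurable_fun_sum _ fun l _ => h.aestronglyMeasurable_density m l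
  · rw [HasFiniteIntegral]
    simp_rw [Real.enorm_of_nonneg (hnn _)]
    rw [h.lintegral_sum_pairDensity]
    exact h.mass_lt_top

lemma integral_sum_pairDensity_le (h : IsDoubleFrequency j lam V) {t : ℝ} (ht : 0 ≤ t) :
    ∫ s in (0 : ℝ)..t, ∑ m, ∑ l, pairDensity j lam V s m l ≤ (doubleMass lam V j).toReal := by
  have hnn : ∀ s, 0 ≤ ∑ m, ∑ l, pairDensity j lam V s m l := fun s =>
    Finset.sum_nonneg fun m _ => Finset.sum_nonneg fun l _ => pairDensity_nonneg _ _ _ _ _ _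
  rw [intervalIntegral.integral_of_le ht, ← h.lintegral_sum_pairDensity,
    ← integral_eq_lintegral_of_nonneg_ae (Eventually.of_forall hnn)
      h.integrableOn_sum_pairDensity.aestronglyMeasurable]
  exact setIntegral_mono_set h.integrableOn_sum_pairDensity (Eventually.of_forall hnn)
    (LE.le.eventuallyLE fun x hx => hx.1.le)

lemma intervalIntegrable_sum_pairDensity (h : IsDoubleFrequency j lam V) {t : ℝ} (ht : 0 ≤ t) :
    IntervalIntegrable (fun s => ∑ m, ∑ l, pairDensity j lam V s m l) volume 0 t := by
  rw [intervalIntegrable_iff_integrableOn_Ioc_of_le ht]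
  exact h.integrableOn_sum_pairDensity.mono_set fun x hx => hx.1.le

end IsDoubleFrequency

end DoubleFrequency

/-! ### Minors of low multi-indices -/

section Block

variable {N j : ℕ}

/-- `m` is one of the two indices `j`, `j + 1`. -/
def InPair (j : ℕ) (m : Fin N) : Prop := j ≤ (m : ℕ) ∧ (m : ℕ) ≤ j + 1

instance (j : ℕ) : DecidablePred (InPair (N := N) j) := fun _ => inferInstanceAs (Decidable (_ ∧ _))

/-- The position `0` or `1` of `m` in the pair `j`, `j + 1` (meaningful only if `InPair j m`). -/
def pairPos (j : ℕ) (m : Fin N) : Fin 2 := if (m : ℕ) = j then 0 else 1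

lemma inPair_pairIndex (h : j + 1 < N) (a : Fin 2) : InPair j (pairIndex h a) := by
  constructor <;> simp; omega

lemma pairPos_pairIndex (h : j + 1 < N) (a : Fin 2) : pairPos j (pairIndex h a) = a := by
  fin_cases a <;> simp [pairPos]

lemma pairIndex_pairPos (h : j + 1 < N) {m : Fin N} (hm : InPair j m) :
    pairIndex h (pairPos j m) = m := by
  obtain ⟨h1, h2⟩ := hm
  unfold pairPos
  split_ifs with h0 <;> ext <;> simp <;> omega

lemma sum_inPair {M : Type*} [AddCommMonoid M] (h : j + 1 < N) (F : Fin N → M) :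
    ∑ m, (if InPair j m then F m else 0) = ∑ a, F (pairIndex h a) := by
  rw [← Finset.sum_filter, ← Finset.sum_map Finset.univ (pairIndex h) F]
  congr 1
  ext m
  simp only [Finset.mem_filter, Finset.mem_univ, true_and, Finset.mem_map]
  exact ⟨fun hm => ⟨_, pairIndex_pairPos h hm⟩, by rintro ⟨a, rfl⟩; exact inPair_pairIndex h a⟩

/-- The `2 × 2` block of `V` at the pair `j`, `j + 1`. -/
def pairCoupling (h : j + 1 < N) (V : ℝ → Matrix (Fin N) (Fin N) ℂ) (t : ℝ) :
    Matrix (Fin 2) (Fin 2) ℂ :=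
  (V t).submatrix (pairIndex h) (pairIndex h)

/-- The part of `V` that couples `j` and `j + 1` with each other. -/
def innerCoupling (j : ℕ) (V : ℝ → Matrix (Fin N) (Fin N) ℂ) (t : ℝ) : Matrix (Fin N) (Fin N) ℂ :=
  fun m l => if InPair j m ∧ InPair j l then V t m l else 0

/-- The `N × N` matrix acting as `M` on the coordinates `j`, `j + 1` and as the identity on the
others. -/
def extendPair (j : ℕ) (M : Matrix (Fin 2) (Fin 2) ℂ) : Matrix (Fin N) (Fin N) ℂ :=
  fun m l => if InPair j m ∧ InPair j l then M (pairPos j m) (pairPos j l) else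
    if m = l then 1 else 0

lemma extendPair_pairIndex (h : j + 1 < N) (M : Matrix (Fin 2) (Fin 2) ℂ) (a b : Fin 2) :
    extendPair j M (pairIndex h a) (pairIndex h b) = M a b := by
  simp [extendPair, inPair_pairIndex, pairPos_pairIndex]

lemma extendPair_of_not_inPair_right (M : Matrix (Fin 2) (Fin 2) ℂ) {m l : Fin N}
    (hl : ¬ InPair j l) : extendPair j M m l = if m = l then 1 else 0 := by
  simp [extendPair, hl]

lemma extendPair_of_not_inPair_left (M : Matrix (Fin 2) (Fin 2) ℂ) {m l : Fin N}
    (hm : ¬ InPair j m) : extendPair j M m l = if m = l then 1 else 0 := by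
  simp [extendPair, hm]

lemma not_inPair_lowIndex (h : j + 1 < N) (i : Fin j) : ¬ InPair j (lowIndex h i) := by
  intro hi
  have := hi.1
  simp at this
  omega

/-- Laplace expansion along the last column, which carries the index `j + b`. -/
lemma det_submatrix_lowPairIndex (h : j + 1 < N) (M : Matrix (Fin N) (Fin N) ℂ) (a b : Fin 2) :
    (M.submatrix (lowPairIndex h a) (lowPairIndex h b)).det =
      ∑ i : Fin j, (-1) ^ ((i : ℕ) + j) * M (lowIndex h i) (pairIndex h b) *
        (M.submatrix ((Fin.succAboveEmb i.castSucc).trans (lowPairIndex h a)) (lowIndex h)).det +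
      M (pairIndex h a) (pairIndex h b) * (M.submatrix (lowIndex h) (lowIndex h)).det := by
  have hcol : ∀ i : Fin (j + 1), (M.submatrix (lowPairIndex h a) (lowPairIndex h b)).submatrix
      i.succAbove (Fin.last j).succAbove =
      M.submatrix ((Fin.succAboveEmb i).trans (lowPairIndex h a)) (lowIndex h) := by
    intro i
    ext x y
    simp
  rw [Matrix.det_succ_column _ (Fin.last j), Fin.sum_univ_castSucc]
  simp_rw [hcol]
  have hlast : M.submatrix ((Fin.succAboveEmb (Fin.last j)).trans (lowPairIndex h a))
      (lowIndex h) = M.submatrix (lowIndex h) (lowIndex h) := by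
    ext x y
    simp
  rw [hlast]
  simp [← two_mul]

lemma extendPair_submatrix_lowIndex (h : j + 1 < N) (M : Matrix (Fin 2) (Fin 2) ℂ) :
    (extendPair j M).submatrix (lowIndex h) (lowIndex h) = 1 := by
  ext x y
  rw [Matrix.submatrix_apply, extendPair_of_not_inPair_right _ (not_inPair_lowIndex h y),
    Matrix.one_apply]
  simp

lemma det_extendPair_lowPairIndex (h : j + 1 < N) (M : Matrix (Fin 2) (Fin 2) ℂ) (a b : Fin 2) :
    ((extendPair j M).submatrix (lowPairIndex h a) (lowPairIndex h b)).det = M a b := by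
  rw [det_submatrix_lowPairIndex, extendPair_submatrix_lowIndex, extendPair_pairIndex,
    Matrix.det_one, mul_one, Finset.sum_eq_zero, zero_add]
  intro i _
  rw [extendPair_of_not_inPair_left _ (not_inPair_lowIndex h i), if_neg, mul_zero, zero_mul]
  intro he
  exact not_inPair_lowIndex h i (he ▸ inPair_pairIndex h b)

lemma map_eq_of_det_extendPair_lowIndex_ne_zero (h : j + 1 < N) (M : Matrix (Fin 2) (Fin 2) ℂ)
    {f : Fin j ↪ Fin N} (hf : ((extendPair j M).submatrix f (lowIndex h)).det ≠ 0) :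
    Finset.univ.map f = Finset.univ.map (lowIndex h) := by
  refine Finset.eq_of_subset_of_card_le (fun x hx => ?_) (by simp)
  obtain ⟨i, -, rfl⟩ := Finset.mem_map.1 hx
  by_contra hcon
  refine hf (Matrix.det_eq_zero_of_row_eq_zero i fun i' => ?_)
  rw [Matrix.submatrix_apply, extendPair_of_not_inPair_right _ (not_inPair_lowIndex h i'), if_neg]
  exact fun he => hcon (he ▸ Finset.mem_map_of_mem _ (Finset.mem_univ i'))

lemma map_eq_of_det_extendPair_lowPairIndex_ne_zero (h : j + 1 < N)
    (M : Matrix (Fin 2) (Fin 2) ℂ) (b : Fin 2) {f : Fin (j + 1) ↪ Fin N}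
    (hf : ((extendPair j M).submatrix f (lowPairIndex h b)).det ≠ 0) :
    ∃ a, Finset.univ.map f = Finset.univ.map (lowPairIndex h a) := by
  rw [det_submatrix_eq_sum] at hf
  obtain ⟨σ, -, hσ⟩ := Finset.exists_ne_zero_of_sum_ne_zero hf
  have hent : ∀ i, extendPair j M (f i) (lowPairIndex h b (σ i)) ≠ 0 := fun i =>
    Finset.prod_ne_zero_iff.1 (right_ne_zero_of_mul hσ) i (Finset.mem_univ i)
  have hpair : InPair j (f (σ.symm (Fin.last j))) := by
    have h1 := hent (σ.symm (Fin.last j))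
    rw [Equiv.apply_symm_apply, lowPairIndex_last] at h1
    by_contra hcon
    rw [extendPair_of_not_inPair_left _ hcon, ne_eq, ite_eq_right_iff] at h1
    push Not at h1
    exact hcon (h1.1 ▸ inPair_pairIndex h b)
  refine ⟨pairPos j (f (σ.symm (Fin.last j))), ?_⟩
  refine Finset.eq_of_subset_of_card_le (fun x hx => ?_) (by simp)
  obtain ⟨i, -, rfl⟩ := Finset.mem_map.1 hx
  rw [mem_map_lowPairIndex, pairIndex_pairPos h hpair]
  have h1 := hent i
  rcases Fin.eq_castSucc_or_eq_last (σ i) with ⟨i', hi'⟩ | hi'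
  · left
    rw [hi', lowPairIndex_castSucc, extendPair_of_not_inPair_right _ (not_inPair_lowIndex h i'),
      ne_eq, ite_eq_right_iff] at h1
    push Not at h1
    rw [h1.1]; simp
  · right
    rw [← hi', Equiv.symm_apply_apply]

namespace IsDoubleFrequency

variable {lam : Fin N → ℝ} {V : ℝ → Matrix (Fin N) (Fin N) ℂ}

lemma innerCoupling_isHermitian (h : IsDoubleFrequency j lam V) {t : ℝ} (ht : 0 ≤ t) :
    (innerCoupling j V t).IsHermitian := by
  ext m l
  rw [Matrix.conjTranspose_apply, innerCoupling, innerCoupling]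
  by_cases hc : InPair j l ∧ InPair j m
  · rw [if_pos hc, if_pos hc.symm, (h.isHermitian t ht).apply]
  · rw [if_neg hc, if_neg fun hc' => hc hc'.symm, star_zero]

lemma pairCoupling_isHermitian (h : IsDoubleFrequency j lam V) {t : ℝ} (ht : 0 ≤ t) :
    (pairCoupling h.lt V t).IsHermitian :=
  (h.isHermitian t ht).submatrix _

lemma sub_innerCoupling_diag (h : IsDoubleFrequency j lam V) {t : ℝ} (ht : 0 ≤ t) (m : Fin N) :
    (V t - innerCoupling j V t) m m = 0 := by
  simp [innerCoupling, h.diag_eq_zero t ht]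

/-- The `2 × 2` evolution without spectral parameter, extended by the identity, is the evolution
generated by `innerCoupling` alone. -/
lemma isFundamentalMatrix_extendPair (h : IsDoubleFrequency j lam V) {d : Fin 2 → ℝ}
    {d' : Fin N → ℝ} {Ψ : ℝ → Matrix (Fin 2) (Fin 2) ℂ}
    (hΨ : IsFundamentalMatrix 0 d (pairCoupling h.lt V) Ψ) :
    IsFundamentalMatrix 0 d' (innerCoupling j V) fun t => extendPair j (Ψ t) := by
  refine ⟨fun l m => ?_, ?_⟩
  · by_cases hm : InPair j m
    · by_cases hl : InPair j l
      · refine ((hΨ.isEvolution (pairPos j l)) (pairPos j m)).congr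
          (fun t _ => by simp [extendPair, hm, hl]) fun t _ => ?_
        have e : ∀ c, innerCoupling j V t m c * extendPair j (Ψ t) c l =
            if InPair j c then V t m c * Ψ t (pairPos j c) (pairPos j l) else 0 := by
          intro c
          by_cases hc : InPair j c <;> simp [innerCoupling, extendPair, hm, hl, hc]
        simp_rw [e]
        rw [sum_inPair h.lt]
        simp only [pairPos_pairIndex, pairCoupling, Matrix.submatrix_apply,
          pairIndex_pairPos h.lt hm, zero_mul]
      · refine (IsPrimitive.const (if m = l then 1 else 0)).congr
          (fun t _ => extendPair_of_not_inPair_right _ hl) fun t _ => ?_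
        rw [Finset.sum_eq_zero]
        · simp
        · intro c _
          by_cases hc : InPair j c
          · have h0 : extendPair j (Ψ t) c l = 0 := by
              rw [extendPair_of_not_inPair_right _ hl, if_neg fun he : c = l => hl (he ▸ hc)]
            simp [h0]
          · simp [innerCoupling, hc]
    · refine (IsPrimitive.const (if m = l then 1 else 0)).congr
        (fun t _ => extendPair_of_not_inPair_left _ hm) fun t _ => ?_
      rw [Finset.sum_eq_zero]
      · simp
      · intro c _
        simp [innerCoupling, hm]
  · ext m l
    rw [hΨ.zero_eq]
    by_cases hm : InPair j m
    · by_cases hl : InPair j l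
      · simp only [extendPair, hm, hl, and_self, if_true, Matrix.one_apply]
        congr 1
        refine propext ⟨fun he => ?_, fun he => he ▸ rfl⟩
        rw [← pairIndex_pairPos h.lt hm, ← pairIndex_pairPos h.lt hl, he]
      · rw [extendPair_of_not_inPair_right _ hl, Matrix.one_apply]
    · rw [extendPair_of_not_inPair_left _ hm, Matrix.one_apply]

/-- Which pairs of indices are coupled across the boundary of the sets underlying `lowIndex` and
`lowPairIndex`. -/
lemma coupled_lowPairIndex (h : IsDoubleFrequency j lam V) {s : ℝ} {a : Fin 2} {m l : Fin N}
    (hm : m ∈ Finset.univ.map (lowPairIndex h.lt a))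
    (hl : l ∉ Finset.univ.map (lowPairIndex h.lt a))
    (hW : (V s - innerCoupling j V s) l m ≠ 0) :
    ((m : ℕ) < j ∧ ((l : ℕ) = j ∨ (l : ℕ) = j + 1)) ∨ ((m : ℕ) ≤ j + 1 ∧ j + 2 ≤ (l : ℕ)) := by
  rw [mem_map_lowPairIndex] at hm hl
  push Not at hl
  rcases hm with hm | rfl
  · omega
  · have hlp : ¬ InPair j l := fun hlp => hW (by
      rw [Matrix.sub_apply, innerCoupling, if_pos ⟨hlp, inPair_pairIndex _ _⟩, sub_self])
    have h1 : ¬ (j ≤ (l : ℕ) ∧ (l : ℕ) ≤ j + 1) := hlp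
    right
    refine ⟨?_, by omega⟩
    simp; omega

lemma coupled_lowIndex (h : IsDoubleFrequency j lam V) {m l : Fin N}
    (hm : m ∈ Finset.univ.map (lowIndex h.lt)) (hl : l ∉ Finset.univ.map (lowIndex h.lt)) :
    ((m : ℕ) < j ∧ ((l : ℕ) = j ∨ (l : ℕ) = j + 1)) ∨ ((m : ℕ) ≤ j + 1 ∧ j + 2 ≤ (l : ℕ)) := by
  rw [mem_map_lowIndex] at hm hl
  omega

lemma lt_of_coupled (h : IsDoubleFrequency j lam V) {m l : Fin N}
    (hml : ((m : ℕ) < j ∧ ((l : ℕ) = j ∨ (l : ℕ) = j + 1)) ∨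
      ((m : ℕ) ≤ j + 1 ∧ j + 2 ≤ (l : ℕ))) : lam m < lam l := by
  rcases hml with ⟨h1, h2⟩ | ⟨h1, h2⟩
  · exact h.low m l h1 (by omega)
  · exact h.high m l h1 h2

lemma norm_sub_innerCoupling_sq_div_le (h : IsDoubleFrequency j lam V) {s : ℝ} (hs : 0 ≤ s)
    {m l : Fin N}
    (hml : (V s - innerCoupling j V s) l m ≠ 0 →
      ((m : ℕ) < j ∧ ((l : ℕ) = j ∨ (l : ℕ) = j + 1)) ∨ ((m : ℕ) ≤ j + 1 ∧ j + 2 ≤ (l : ℕ))) :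
    ‖(V s - innerCoupling j V s) l m‖ ^ 2 / (lam l - lam m) ≤ pairDensity j lam V s m l := by
  by_cases hW : (V s - innerCoupling j V s) l m = 0
  · rw [hW]; simpa using pairDensity_nonneg j lam V s m l
  · have hc := hml hW
    refine le_trans (le_of_eq ?_) (le_pairDensity hc)
    have h1 : (V s - innerCoupling j V s) l m = V s l m := by
      rw [Matrix.sub_apply, innerCoupling, if_neg, sub_zero]
      rintro ⟨⟨h1, h2⟩, h3, h4⟩
      omega
    have h2 : ‖V s l m‖ = ‖V s m l‖ := by
      rw [← (h.isHermitian s hs).apply m l, norm_star]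
    rw [h1, h2, abs_of_pos (sub_pos.2 (h.lt_of_coupled hc)), div_eq_mul_inv, mul_comm]

/-- The sum of the frequencies below the double one. -/
def lowFrequency (h : IsDoubleFrequency j lam V) : ℝ := ∑ i, lam (lowIndex h.lt i)

lemma lam_pairIndex (h : IsDoubleFrequency j lam V) (a : Fin 2) :
    lam (pairIndex h.lt a) = lam (pairIndex h.lt 0) := by
  fin_cases a
  · rfl
  · exact (h.double _ _ (by simp) (by simp)).symm

lemma sum_lam_lowPairIndex (h : IsDoubleFrequency j lam V) (a : Fin 2) :
    ∑ i, lam (lowPairIndex h.lt a i) = h.lowFrequency + lam (pairIndex h.lt 0) := by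
  rw [Fin.sum_univ_castSucc, lowFrequency]
  simp [h.lam_pairIndex a]

/-- The leading principal minor of size `j` stays close to `exp (i k lowFrequency t)`. -/
lemma lintegral_lowMinor_le (h : IsDoubleFrequency j lam V) {X : ℂ → ℝ → Matrix (Fin N) (Fin N) ℂ}
    (hX : ∀ k, IsFundamentalMatrix k lam V (X k))
    (hXd : ∀ t, 0 ≤ t → ∀ a b, Differentiable ℂ fun k => X k t a b)
    {Ψ : ℝ → Matrix (Fin 2) (Fin 2) ℂ} {d : Fin 2 → ℝ}
    (hΨ : IsFundamentalMatrix 0 d (pairCoupling h.lt V) Ψ) {t : ℝ} (ht : 0 ≤ t) :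
    ∫⁻ k : ℝ, ENNReal.ofReal (1 - (Complex.exp (-(Complex.I * k * h.lowFrequency) * t) *
        ((X k t).submatrix (lowIndex h.lt) (lowIndex h.lt)).det).re) ≤
      ENNReal.ofReal (Real.pi * (doubleMass lam V j).toReal) := by
  have hZ : IsFundamentalMatrix 0 lam (innerCoupling j V) fun t => extendPair j (Ψ t) :=
    h.isFundamentalMatrix_extendPair hΨ
  have key := lintegral_one_sub_overlap_le (A := Unit) (fun _ => lowIndex h.lt)
    (fun _ _ _ => rfl) () h.isHermitian (fun t ht => h.innerCoupling_isHermitian ht)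
    (fun t ht m => h.sub_innerCoupling_diag ht m) hX hXd hZ
    (fun s _ f hf => ⟨(), map_eq_of_det_extendPair_lowIndex_ne_zero h.lt (Ψ s) hf⟩)
    (fun _ => rfl)
    (fun c => sum_monotone_le h.monotone (by have := h.lt; omega) c)
    (fun s _ _ m hm l hl _ => h.lt_of_coupled (h.coupled_lowIndex hm hl))
    (pairDensity_nonneg j lam V)
    (fun s hs _ m hm l hl => h.norm_sub_innerCoupling_sq_div_le hs
      fun _ => h.coupled_lowIndex hm hl) ht (h.intervalIntegrable_sum_pairDensity ht)
  simp only [Finset.univ_unique, Finset.sum_singleton, extendPair_submatrix_lowIndex,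
    Matrix.det_one, star_one, one_mul, Fintype.card_unit, Nat.cast_one] at key
  refine key.trans (ENNReal.ofReal_le_ofReal ?_)
  exact mul_le_mul_of_nonneg_left (h.integral_sum_pairDensity_le ht) Real.pi_pos.le

/-- The minors of size `j + 1` with rows and columns `0, …, j - 1` and one of `j`, `j + 1` stay
close to the `2 × 2` evolution, up to a phase. -/
lemma lintegral_lowPairMinor_le (h : IsDoubleFrequency j lam V)
    {X : ℂ → ℝ → Matrix (Fin N) (Fin N) ℂ}
    (hX : ∀ k, IsFundamentalMatrix k lam V (X k))
    (hXd : ∀ t, 0 ≤ t → ∀ a b, Differentiable ℂ fun k => X k t a b)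
    {Ψ : ℝ → Matrix (Fin 2) (Fin 2) ℂ} {d : Fin 2 → ℝ}
    (hΨ : IsFundamentalMatrix 0 d (pairCoupling h.lt V) Ψ) {t : ℝ} (ht : 0 ≤ t) (b : Fin 2) :
    ∫⁻ k : ℝ, ENNReal.ofReal (1 - (∑ a, star (Ψ t a b) *
        (Complex.exp (-(Complex.I * k * (h.lowFrequency + lam (pairIndex h.lt 0) : ℝ)) * t) *
        ((X k t).submatrix (lowPairIndex h.lt a) (lowPairIndex h.lt b)).det)).re) ≤
      ENNReal.ofReal (Real.pi * (2 * (doubleMass lam V j).toReal)) := by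
  have hZ : IsFundamentalMatrix 0 lam (innerCoupling j V) fun t => extendPair j (Ψ t) :=
    h.isFundamentalMatrix_extendPair hΨ
  have hlow : ∀ c : Fin (j + 1) ↪ Fin N,
      h.lowFrequency + lam (pairIndex h.lt 0) ≤ ∑ i, lam (c i) := by
    intro c
    refine le_trans (le_of_eq ?_)
      (sum_monotone_le h.monotone (by have := h.lt; omega : j + 1 ≤ N) c)
    rw [Fin.sum_univ_castSucc, lowFrequency]
    rfl
  have key := lintegral_one_sub_overlap_le (lowPairIndex h.lt)
    (map_lowPairIndex_injective h.lt) b h.isHermitian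
    (fun t ht => h.innerCoupling_isHermitian ht)
    (fun t ht m => h.sub_innerCoupling_diag ht m) hX hXd hZ
    (fun s _ f hf => map_eq_of_det_extendPair_lowPairIndex_ne_zero h.lt (Ψ s) b hf)
    h.sum_lam_lowPairIndex hlow
    (fun s _ _ m hm l hl hW => h.lt_of_coupled (h.coupled_lowPairIndex hm hl hW))
    (pairDensity_nonneg j lam V)
    (fun s hs _ m hm l hl => h.norm_sub_innerCoupling_sq_div_le hs
      fun hW => h.coupled_lowPairIndex hm hl hW) ht (h.intervalIntegrable_sum_pairDensity ht)
  simp only [det_extendPair_lowPairIndex, Fintype.card_fin, Nat.cast_ofNat] at key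
  refine key.trans (ENNReal.ofReal_le_ofReal ?_)
  have := h.integral_sum_pairDensity_le ht
  have := Real.pi_pos
  gcongr

end IsDoubleFrequency

end Block

/-! ### From the defects of the minors to a column of the block -/

section Pointwise

lemma norm_sq_add_sub_sq (x : ℂ) : ‖1 - x‖ ^ 2 = 1 + ‖x‖ ^ 2 - 2 * x.re := by
  rw [← Complex.normSq_eq_norm_sq, ← Complex.normSq_eq_norm_sq, Complex.normSq_sub]
  simp

lemma sum_norm_sub_sq {ι : Type*} [Fintype ι] (w ψ : ι → ℂ) :
    ∑ a, ‖w a - ψ a‖ ^ 2 =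
      ∑ a, ‖w a‖ ^ 2 + ∑ a, ‖ψ a‖ ^ 2 - 2 * (∑ a, star (ψ a) * w a).re := by
  rw [Complex.re_sum, Finset.mul_sum, ← Finset.sum_add_distrib, ← Finset.sum_sub_distrib]
  refine Finset.sum_congr rfl fun a _ => ?_
  rw [← Complex.normSq_eq_norm_sq, ← Complex.normSq_eq_norm_sq, ← Complex.normSq_eq_norm_sq,
    Complex.normSq_sub, Complex.star_def, mul_comm ((starRingEnd ℂ) (ψ a))]

lemma add_add_sq_le (a b c : ℝ) : (a + b + c) ^ 2 ≤ 3 * (a ^ 2 + b ^ 2 + c ^ 2) := by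
  nlinarith [sq_nonneg (a - b), sq_nonneg (a - c), sq_nonneg (b - c)]

/-- The passage from minors to the block itself. Here `y` is a column of the block, `s` its defect
from being a unit vector, `D` the low minor, and `D y = w + e` where `w` collects the bordered
minors; the error `e` is small relative to both `s` and the defect of `D`, which closes the
estimate of `s`. -/
lemma column_defect_le {y ψ w e : Fin 2 → ℂ} {D : ℂ} {s q qD : ℝ} (hD : ‖D‖ ≤ 1)
    (hqD : qD = 1 - D.re) (hq : q = 1 - (∑ a, star (ψ a) * w a).re)
    (hψ : ∑ a, ‖ψ a‖ ^ 2 = 1) (hw : ∑ a, ‖w a‖ ^ 2 ≤ 1) (hy : ∑ a, ‖y a‖ ^ 2 = 1 - s)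
    (hs : 0 ≤ s) (hDy : ∀ a, D * y a = w a + e a) (he : ∀ a, ‖e a‖ ^ 2 ≤ 2 * s * qD) :
    ∑ a, ‖y a - ψ a‖ ^ 2 + s ≤ 10 * q + 50 * qD := by
  have hqD0 : 0 ≤ qD := by
    have := (Complex.re_le_norm D).trans hD; linarith
  have hs1 : s ≤ 1 := by
    have : 0 ≤ ∑ a, ‖y a‖ ^ 2 := Finset.sum_nonneg fun _ _ => sq_nonneg _
    linarith
  have hD1 : ‖1 - D‖ ^ 2 ≤ 2 * qD := by
    rw [norm_sq_add_sub_sq]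
    have : ‖D‖ ^ 2 ≤ 1 := pow_le_one₀ (norm_nonneg _) hD
    linarith
  have hwψ : ∑ a, ‖w a - ψ a‖ ^ 2 ≤ 2 * q := by
    rw [sum_norm_sub_sq]; linarith
  have hlow : 1 - 2 * q ≤ ∑ a, ‖w a‖ ^ 2 := by
    have h1 := norm_sum_star_mul_sq_le ψ w
    rw [hψ, one_mul] at h1
    have h2 : (∑ a, star (ψ a) * w a).re ^ 2 ≤ ‖∑ a, star (ψ a) * w a‖ ^ 2 := by
      rw [← sq_abs]; exact pow_le_pow_left₀ (abs_nonneg _) (Complex.abs_re_le_norm _) 2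
    nlinarith [sq_nonneg q]
  have hdiff : ∀ a, ‖y a - ψ a‖ ^ 2 ≤
      3 * (2 * qD * ‖y a‖ ^ 2 + ‖e a‖ ^ 2 + ‖w a - ψ a‖ ^ 2) := by
    intro a
    have h1 : y a - ψ a = (1 - D) * y a + e a + (w a - ψ a) := by
      linear_combination hDy a
    have h2 : ‖y a - ψ a‖ ≤ ‖1 - D‖ * ‖y a‖ + ‖e a‖ + ‖w a - ψ a‖ := by
      rw [h1, ← norm_mul]; exact norm_add₃_le
    have h3 : (‖1 - D‖ * ‖y a‖) ^ 2 ≤ 2 * qD * ‖y a‖ ^ 2 := by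
      rw [mul_pow]; exact mul_le_mul_of_nonneg_right hD1 (sq_nonneg _)
    have h4 := pow_le_pow_left₀ (norm_nonneg _) h2 2
    have h5 := add_add_sq_le (‖1 - D‖ * ‖y a‖) ‖e a‖ ‖w a - ψ a‖
    linarith
  have herr : ∀ a, ‖w a‖ ^ 2 - ‖D * y a‖ ^ 2 ≤ s / 4 + 8 * qD := by
    intro a
    have h1 : ‖e a‖ ≤ s / 8 + 4 * qD := by
      refine abs_le_of_sq_le_sq' ?_ (by positivity) |>.2
      nlinarith [he a, sq_nonneg (s / 8 - 4 * qD)]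
    have h2 : ‖w a‖ ≤ ‖D * y a‖ + ‖e a‖ := by
      have : w a = D * y a - e a := by rw [hDy]; ring
      rw [this]; exact norm_sub_le _ _
    have h3 : ‖w a‖ ≤ 1 := by
      have : ‖w a‖ ^ 2 ≤ 1 := (Finset.single_le_sum (f := fun a => ‖w a‖ ^ 2)
        (fun _ _ => sq_nonneg _) (Finset.mem_univ a)).trans hw
      nlinarith [norm_nonneg (w a)]
    have h4 := norm_nonneg (w a)
    have h5 := norm_nonneg (D * y a)
    have h6 := norm_nonneg (e a)
    rcases le_total ‖w a‖ ‖D * y a‖ with h | h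
    · have : ‖w a‖ ^ 2 ≤ ‖D * y a‖ ^ 2 := pow_le_pow_left₀ h4 h 2
      have : 0 ≤ s / 4 + 8 * qD := by positivity
      linarith
    · have h7 : (‖w a‖ - ‖D * y a‖) * (‖w a‖ + ‖D * y a‖) ≤ ‖e a‖ * 2 :=
        mul_le_mul (by linarith) (by linarith) (by positivity) h6
      linarith
  have hDyle : ∑ a, ‖D * y a‖ ^ 2 ≤ 1 - s := by
    rw [← hy]
    refine Finset.sum_le_sum fun a _ => ?_
    rw [norm_mul, mul_pow]
    exact mul_le_of_le_one_left (sq_nonneg _) (pow_le_one₀ (norm_nonneg _) hD)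
  have hylt : qD * ∑ a, ‖y a‖ ^ 2 ≤ qD := mul_le_of_le_one_right hqD0 (by linarith)
  have hsq : s * qD ≤ qD := mul_le_of_le_one_left hqD0 hs1
  rw [Fin.sum_univ_two] at hylt hDyle hlow hwψ ⊢
  have e0 := herr 0
  have e1 := herr 1
  have d0 := hdiff 0
  have d1 := hdiff 1
  have g0 := he 0
  have g1 := he 1
  have hs' : s ≤ 4 * q + 32 * qD := by linarith
  linarith

end Pointwise

/-! ### The uniform estimate of the block -/

section CoreBound

variable {N j : ℕ}

/-- For a matrix `M` with orthonormal columns and a `2 × 2` matrix `P`: the squared Frobenius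
distance between `P` and the block of `M` at the pair `j`, `j + 1`, plus the squared norm of the
remaining entries in the two columns `j`, `j + 1`. -/
noncomputable def blockDefect (h : j + 1 < N) (M : Matrix (Fin N) (Fin N) ℂ)
    (P : Matrix (Fin 2) (Fin 2) ℂ) : ℝ :=
  ∑ b, (∑ a, ‖M (pairIndex h a) (pairIndex h b) - P a b‖ ^ 2 +
    (1 - ∑ a, ‖M (pairIndex h a) (pairIndex h b)‖ ^ 2))

lemma sum_norm_sq_col_eq_one {n : Type*} [Fintype n] [DecidableEq n] {M : Matrix n n ℂ}
    (hM : M.conjTranspose * M = 1) (b : n) : ∑ a, ‖M a b‖ ^ 2 = 1 := by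
  have h := congrFun (congrFun hM b) b
  rw [Matrix.mul_apply, Matrix.one_apply_eq] at h
  have h2 : ((∑ a, ‖M a b‖ ^ 2 : ℝ) : ℂ) = 1 := by
    rw [← h]
    push_cast
    refine Finset.sum_congr rfl fun a _ => ?_
    rw [Matrix.conjTranspose_apply]
    exact (Complex.conj_mul' _).symm
  exact_mod_cast h2

lemma norm_sum_mul_sq_le {ι : Type*} [Fintype ι] (x y : ι → ℂ) :
    ‖∑ i, x i * y i‖ ^ 2 ≤ (∑ i, ‖x i‖ ^ 2) * ∑ i, ‖y i‖ ^ 2 := by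
  simpa using norm_sum_star_mul_sq_le (fun i => star (x i)) y

lemma sum_low_add_sum_pair_le (h : j + 1 < N) {F : Fin N → ℝ} (hF : ∀ m, 0 ≤ F m) :
    ∑ i, F (lowIndex h i) + ∑ a, F (pairIndex h a) ≤ ∑ m, F m := by
  rw [← Finset.sum_map Finset.univ (lowIndex h) F, ← Finset.sum_map Finset.univ (pairIndex h) F,
    ← Finset.sum_union]
  · exact Finset.sum_le_sum_of_subset_of_nonneg (Finset.subset_univ _) fun _ _ _ => hF _
  · rw [Finset.disjoint_left]
    intro x hx hx'
    rw [mem_map_lowIndex] at hx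
    obtain ⟨a, -, rfl⟩ := Finset.mem_map.1 hx'
    simp at hx

lemma norm_exp_neg_I_mul (k μ t : ℝ) : ‖Complex.exp (-(Complex.I * k * μ) * t)‖ = 1 := by
  rw [Complex.norm_exp]; simp

/-- For constant `d` the spectral parameter only contributes a phase. -/
lemma IsFundamentalMatrix.exp_mul_apply {n : Type*} [Fintype n] [DecidableEq n] {k μ : ℝ}
    {d' : n → ℝ} {H Ψ Ψ₀ : ℝ → Matrix n n ℂ} (hΨ : IsFundamentalMatrix k (fun _ => μ) H Ψ)
    (hΨ₀ : IsFundamentalMatrix 0 d' H Ψ₀) (hH : ∀ t, 0 ≤ t → (H t).IsHermitian) {t : ℝ}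
    (ht : 0 ≤ t) (a b : n) : Complex.exp (-(Complex.I * k * μ) * t) * Ψ t a b = Ψ₀ t a b := by
  have h1 : IsEvolution 0 (fun _ => 0) H
      (fun t i => Complex.exp (-(Complex.I * k * μ) * t) * Ψ t i b) := fun i =>
    ((hΨ.isEvolution b).gauge μ i).congr (fun _ _ => rfl) fun t _ => by simp
  exact congrFun (h1.unique (hΨ₀.isEvolution b).of_zero hH (by simp)
    (by ext i; simp [hΨ.zero_eq, hΨ₀.zero_eq]) ht) a

namespace IsDoubleFrequency

variable {lam : Fin N → ℝ} {V : ℝ → Matrix (Fin N) (Fin N) ℂ}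

/-- The pointwise estimate of the block defect by the defects of the minors. -/
lemma column_bound (h : IsDoubleFrequency j lam V) {k : ℝ} {X : ℝ → Matrix (Fin N) (Fin N) ℂ}
    (hX : IsFundamentalMatrix k lam V X) {Ψ Ψ₀ : ℝ → Matrix (Fin 2) (Fin 2) ℂ} {d : Fin 2 → ℝ}
    (hΨ : IsFundamentalMatrix k (fun _ => lam (pairIndex h.lt 0)) (pairCoupling h.lt V) Ψ)
    (hΨ₀ : IsFundamentalMatrix 0 d (pairCoupling h.lt V) Ψ₀) {t : ℝ} (ht : 0 ≤ t) (b : Fin 2) :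
    ∑ a, ‖X t (pairIndex h.lt a) (pairIndex h.lt b) - Ψ t a b‖ ^ 2 +
        (1 - ∑ a, ‖X t (pairIndex h.lt a) (pairIndex h.lt b)‖ ^ 2) ≤
      10 * (1 - (∑ a, star (Ψ₀ t a b) *
        (Complex.exp (-(Complex.I * k * (h.lowFrequency + lam (pairIndex h.lt 0) : ℝ)) * t) *
          ((X t).submatrix (lowPairIndex h.lt a) (lowPairIndex h.lt b)).det)).re) +
      50 * (1 - (Complex.exp (-(Complex.I * k * h.lowFrequency) * t) *
          ((X t).submatrix (lowIndex h.lt) (lowIndex h.lt)).det).re) := by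
  set μ := lam (pairIndex h.lt 0)
  set ν := h.lowFrequency
  set φ := Complex.exp (-(Complex.I * k * μ) * t) with hφ
  set χ := Complex.exp (-(Complex.I * k * ν) * t) with hχ
  have hφ1 : ‖φ‖ = 1 := norm_exp_neg_I_mul k μ t
  have hχ1 : ‖χ‖ = 1 := norm_exp_neg_I_mul k ν t
  have hφχ : Complex.exp (-(Complex.I * k * (ν + μ : ℝ)) * t) = χ * φ := by
    rw [hφ, hχ, ← Complex.exp_add]
    congr 1
    push_cast
    ring
  have hcol := sum_norm_sq_col_eq_one
    (hX.conjTranspose_mul_self h.isHermitian (by simp) ht) (pairIndex h.lt b)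
  have hsplit := sum_low_add_sum_pair_le h.lt
    (F := fun m => ‖X t m (pairIndex h.lt b)‖ ^ 2) fun _ => sq_nonneg _
  rw [hcol] at hsplit
  set s := 1 - ∑ a, ‖X t (pairIndex h.lt a) (pairIndex h.lt b)‖ ^ 2 with hs
  have hlow : ∑ i, ‖X t (lowIndex h.lt i) (pairIndex h.lt b)‖ ^ 2 ≤ s := by rw [hs]; linarith
  have hs0 : 0 ≤ s := le_trans (Finset.sum_nonneg fun _ _ => sq_nonneg _) hlow
  set D := ((X t).submatrix (lowIndex h.lt) (lowIndex h.lt)).det with hD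
  have hminor : ∀ a, ∑ i : Fin j, ‖((X t).submatrix
      ((Fin.succAboveEmb i.castSucc).trans (lowPairIndex h.lt a)) (lowIndex h.lt)).det‖ ^ 2 +
        ‖D‖ ^ 2 ≤ 1 := by
    intro a
    have h1 := hX.sum_norm_minor_sq_le_one h.isHermitian (by simp)
      (fun i => (Fin.succAboveEmb i).trans (lowPairIndex h.lt a))
      (map_succAbove_injective (lowPairIndex h.lt a)) (lowIndex h.lt) ht
    rw [Fin.sum_univ_castSucc] at h1
    have h2 : (X t).submatrix ((Fin.succAboveEmb (Fin.last j)).trans (lowPairIndex h.lt a))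
        (lowIndex h.lt) = (X t).submatrix (lowIndex h.lt) (lowIndex h.lt) := by
      ext x y
      simp
    rwa [h2] at h1
  have hDle : ‖D‖ ^ 2 ≤ 1 :=
    le_trans (le_add_of_nonneg_left (Finset.sum_nonneg fun _ _ => sq_nonneg _)) (hminor 0)
  have hD1 : ‖χ * D‖ ≤ 1 := by
    rw [norm_mul, hχ1, one_mul]
    nlinarith [norm_nonneg D]
  have hdefect : 1 - ‖D‖ ^ 2 ≤ 2 * (1 - (χ * D).re) := by
    have h1 := norm_sq_add_sub_sq (χ * D)
    rw [norm_mul χ D, hχ1, one_mul] at h1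
    have h2 : (1 - (χ * D).re) ^ 2 ≤ ‖1 - χ * D‖ ^ 2 := by
      have := pow_le_pow_left₀ (abs_nonneg _) (Complex.abs_re_le_norm (1 - χ * D)) 2
      rwa [sq_abs, Complex.sub_re, Complex.one_re] at this
    nlinarith [sq_nonneg (1 - (χ * D).re)]
  -- The Laplace expansion gives `D y = w + e`; Cauchy-Schwarz bounds the remainder `e` by the
  -- defect `s` of the column and the minors bordering `D`, whose squares sum to at most `1 - ‖D‖²`.
  have hmain := column_defect_le (y := fun a => φ * X t (pairIndex h.lt a) (pairIndex h.lt b))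
    (ψ := fun a => Ψ₀ t a b)
    (w := fun a => χ * φ * ((X t).submatrix (lowPairIndex h.lt a) (lowPairIndex h.lt b)).det)
    (e := fun a => -(χ * φ * ∑ i : Fin j, (-1) ^ ((i : ℕ) + j) *
      X t (lowIndex h.lt i) (pairIndex h.lt b) * ((X t).submatrix
        ((Fin.succAboveEmb i.castSucc).trans (lowPairIndex h.lt a)) (lowIndex h.lt)).det))
    (D := χ * D) (s := s) hD1 rfl rfl
    (sum_norm_sq_col_eq_one (hΨ₀.conjTranspose_mul_self
      (fun t ht => h.pairCoupling_isHermitian ht) (by simp) ht) b)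
    (by
      have := hX.sum_norm_minor_sq_le_one h.isHermitian (by simp) (lowPairIndex h.lt)
        (map_lowPairIndex_injective h.lt) (lowPairIndex h.lt b) ht
      simpa [norm_mul, hφ1, hχ1] using this)
    (by simp only [norm_mul, hφ1, one_mul]; rw [hs]; ring) hs0
    (fun a => by
      rw [det_submatrix_lowPairIndex, ← hD]
      ring)
    (fun a => by
      rw [norm_neg, norm_mul, norm_mul, hφ1, hχ1, one_mul, one_mul]
      have h1 := norm_sum_mul_sq_le
        (fun i : Fin j => (-1) ^ ((i : ℕ) + j) * X t (lowIndex h.lt i) (pairIndex h.lt b))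
        (fun i => ((X t).submatrix
          ((Fin.succAboveEmb i.castSucc).trans (lowPairIndex h.lt a)) (lowIndex h.lt)).det)
      simp only [norm_mul, norm_pow, norm_neg, norm_one, one_pow, one_mul] at h1
      refine h1.trans ?_
      have h2 : ∑ i : Fin j, ‖((X t).submatrix
          ((Fin.succAboveEmb i.castSucc).trans (lowPairIndex h.lt a)) (lowIndex h.lt)).det‖ ^ 2 ≤
          2 * (1 - (χ * D).re) := by linarith [hminor a]
      calc _ ≤ s * (2 * (1 - (χ * D).re)) :=
            mul_le_mul hlow h2 (Finset.sum_nonneg fun _ _ => sq_nonneg _) hs0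
        _ = 2 * s * (1 - (χ * D).re) := by ring)
  rw [hφχ]
  refine le_trans (le_of_eq ?_) hmain
  congr 1
  refine Finset.sum_congr rfl fun a _ => ?_
  rw [← hΨ.exp_mul_apply hΨ₀ (fun t ht => h.pairCoupling_isHermitian ht) ht a b, ← hφ, ← mul_sub,
    norm_mul, hφ1, one_mul]

/-- The integrated bound on the block defect, uniform in time. -/
lemma lintegral_blockDefect_le (h : IsDoubleFrequency j lam V)
    {X : ℝ → ℝ → Matrix (Fin N) (Fin N) ℂ}
    (hX : ∀ k : ℝ, IsFundamentalMatrix k lam V fun t => X t k)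
    {Ψ : ℝ → ℝ → Matrix (Fin 2) (Fin 2) ℂ}
    (hΨ : ∀ k : ℝ, IsFundamentalMatrix k (fun _ => lam (pairIndex h.lt 0)) (pairCoupling h.lt V)
      fun t => Ψ t k) {t : ℝ} (ht : 0 ≤ t) :
    ∫⁻ k : ℝ, ENNReal.ofReal (blockDefect h.lt (X t k) (Ψ t k)) ≤
      ENNReal.ofReal (140 * Real.pi) * doubleMass lam V j := by
  have hX0 := hX 0
  have hΨ0 := hΨ 0
  rw [Complex.ofReal_zero] at hX0 hΨ0
  obtain ⟨Z, hZ, hZd⟩ := hX0.exists_entire (d := lam) h.isHermitian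
  have hZX : ∀ k : ℝ, Z k t = X t k := fun k => (hZ k).unique (hX k) h.isHermitian (by simp) ht
  have hZc : Continuous fun k : ℝ => Z k t := continuous_matrix fun a b =>
    (hZd t ht a b).continuous.comp Complex.continuous_ofReal
  set qD : ℝ → ℝ := fun k => 1 - (Complex.exp (-(Complex.I * k * h.lowFrequency) * t) *
    ((Z k t).submatrix (lowIndex h.lt) (lowIndex h.lt)).det).re with hqD
  set q : Fin 2 → ℝ → ℝ := fun b k => 1 - (∑ a, star (Ψ t 0 a b) *
    (Complex.exp (-(Complex.I * k * (h.lowFrequency + lam (pairIndex h.lt 0) : ℝ)) * t) *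
      ((Z k t).submatrix (lowPairIndex h.lt a) (lowPairIndex h.lt b)).det)).re with hq
  have hqm : ∀ b, Measurable (q b) := by
    intro b
    refine Continuous.measurable (continuous_const.sub (Complex.continuous_re.comp ?_))
    refine continuous_finsetSum _ fun a _ => continuous_const.mul (Continuous.mul (by fun_prop) ?_)
    exact (hZc.matrix_submatrix _ _).matrix_det
  have hpt : ∀ k : ℝ, ENNReal.ofReal (blockDefect h.lt (X t k) (Ψ t k)) ≤
      (ENNReal.ofReal 10 * ENNReal.ofReal (q 0 k) + ENNReal.ofReal 10 * ENNReal.ofReal (q 1 k)) +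
        ENNReal.ofReal 100 * ENNReal.ofReal (qD k) := by
    intro k
    have h0 := h.column_bound (hX k) (hΨ k) hΨ0 ht 0
    have h1 := h.column_bound (hX k) (hΨ k) hΨ0 ht 1
    simp only [← hZX k] at h0 h1
    rw [← ENNReal.ofReal_mul (by norm_num), ← ENNReal.ofReal_mul (by norm_num),
      ← ENNReal.ofReal_mul (by norm_num)]
    refine le_trans (ENNReal.ofReal_le_ofReal ?_) (ENNReal.ofReal_add_le.trans
      (add_le_add_left ENNReal.ofReal_add_le _))
    rw [blockDefect, Fin.sum_univ_two (f := fun b => _ + _), ← hZX k]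
    simp only [hq, hqD]
    linarith
  refine (lintegral_mono hpt).trans ?_
  have hm : Measurable fun k => ENNReal.ofReal 10 * ENNReal.ofReal (q 0 k) +
      ENNReal.ofReal 10 * ENNReal.ofReal (q 1 k) :=
    ((hqm 0).ennreal_ofReal.const_mul _).add ((hqm 1).ennreal_ofReal.const_mul _)
  rw [lintegral_add_left hm,
    lintegral_add_left ((hqm 0).ennreal_ofReal.const_mul _),
    lintegral_const_mul' _ _ ENNReal.ofReal_ne_top, lintegral_const_mul' _ _ ENNReal.ofReal_ne_top,
    lintegral_const_mul' _ _ ENNReal.ofReal_ne_top]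
  have hD := h.lintegral_lowMinor_le hZ hZd hΨ0 ht
  have hW := fun b => h.lintegral_lowPairMinor_le hZ hZd hΨ0 ht b
  refine (add_le_add (add_le_add (mul_le_mul_right (hW 0) _) (mul_le_mul_right (hW 1) _))
    (mul_le_mul_right hD _)).trans (le_of_eq ?_)
  have hI : 0 ≤ (doubleMass lam V j).toReal := ENNReal.toReal_nonneg
  have hpi := Real.pi_pos
  rw [← ENNReal.ofReal_mul (by norm_num), ← ENNReal.ofReal_mul (by norm_num),
    ← ENNReal.ofReal_add (by positivity) (by positivity),
    ← ENNReal.ofReal_add (by positivity) (by positivity)]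
  conv_rhs => rw [← ENNReal.ofReal_toReal h.mass_lt_top.ne, ← ENNReal.ofReal_mul (by positivity)]
  congr 1
  ring

end IsDoubleFrequency

end CoreBound

/-! ### Translation in time -/

section Shift

lemma IsPrimitive.shift {f f' : ℝ → ℂ} (h : IsPrimitive f f') {s : ℝ} (hs : 0 ≤ s) :
    IsPrimitive (fun t => f (s + t)) fun t => f' (s + t) := by
  have hi : ∀ t, 0 ≤ t → IntervalIntegrable f' volume s (s + t) := fun t ht =>
    (h.intervalIntegrable s hs).symm.trans (h.intervalIntegrable (s + t) (by linarith))
  refine ⟨fun t ht => ?_, fun t ht => ?_⟩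
  · simpa using (hi t ht).comp_add_left (c := s)
  · rw [h.eq_add_integral (s + t) (by linarith), h.eq_add_integral (s + 0) (by linarith),
      intervalIntegral.integral_comp_add_left, add_assoc]
    congr 1
    rw [intervalIntegral.integral_add_adjacent_intervals] <;> simp only [add_zero]
    exacts [h.intervalIntegrable s hs, hi t ht]

/-- The evolution from time `s` on, `t ↦ X(s + t) X(s)⁻¹`. -/
lemma IsFundamentalMatrix.shift {n : Type*} [Fintype n] [DecidableEq n] {k : ℂ} {d : n → ℝ}
    {H X : ℝ → Matrix n n ℂ} (hX : IsFundamentalMatrix k d H X)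
    (hH : ∀ t, 0 ≤ t → (H t).IsHermitian) (hk : k.im = 0) {s : ℝ} (hs : 0 ≤ s) :
    IsFundamentalMatrix k d (fun t => H (s + t)) fun t => X (s + t) * (X s).conjTranspose := by
  refine ⟨fun b a => ?_, by simp only [add_zero]; exact hX.mul_conjTranspose_self hH hk hs⟩
  refine (IsPrimitive.sum Finset.univ fun c _ =>
    (((hX.isEvolution c) a).shift hs).const_mul (star (X s b c))).congr
    (fun t _ => ?_) fun t _ => ?_
  · change (X (s + t) * (X s).conjTranspose) a b = _
    rw [Matrix.mul_apply]
    exact Finset.sum_congr rfl fun c _ => by rw [Matrix.conjTranspose_apply, mul_comm]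
  · have h1 : ∑ e, H (s + t) a e * ∑ c, X (s + t) e c * star (X s b c) =
        ∑ c, star (X s b c) * ∑ e, H (s + t) a e * X (s + t) e c := by
      simp_rw [Finset.mul_sum]
      rw [Finset.sum_comm]
      exact Finset.sum_congr rfl fun c _ => Finset.sum_congr rfl fun e _ => by ring
    simp only [Matrix.mul_apply, Matrix.conjTranspose_apply]
    rw [h1, Finset.mul_sum, ← Finset.sum_add_distrib, Finset.mul_sum]
    exact Finset.sum_congr rfl fun c _ => by ring

lemma setLIntegral_comp_add_left (f : ℝ → ℝ≥0∞) (s : ℝ) :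
    ∫⁻ τ in Ici (0 : ℝ), f (s + τ) = ∫⁻ τ in Ici s, f τ := by
  have h := (measurePreserving_add_left volume s).setLIntegral_comp_preimage_emb
    (measurableEmbedding_addLeft s) f (Ici s)
  rwa [show (fun x => s + x) ⁻¹' Ici s = Ici (0 : ℝ) by ext x; simp] at h

lemma locallyIntegrableOn_comp_add_left {f : ℝ → ℂ} (hf : LocallyIntegrableOn f (Ici 0)) {s : ℝ}
    (hs : 0 ≤ s) : LocallyIntegrableOn (fun t => f (s + t)) (Ici 0) := by
  rw [locallyIntegrableOn_iff isClosed_Ici.isLocallyClosed]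
  intro K hK hKc
  rw [← Function.comp_def f, ← (measurePreserving_add_left volume s).integrableOn_image
    (measurableEmbedding_addLeft s)]
  refine hf.integrableOn_compact_subset ?_ (hKc.image (continuous_const.add continuous_id))
  rintro _ ⟨x, hx, rfl⟩
  exact add_nonneg hs (hK hx)

lemma entryMass_shift_le {N : ℕ} (lam : Fin N → ℝ) (V : ℝ → Matrix (Fin N) (Fin N) ℂ)
    (m l : Fin N) {s : ℝ} (hs : 0 ≤ s) :
    entryMass lam (fun t => V (s + t)) m l ≤ entryMass lam V m l := by
  unfold entryMass
  rw [setLIntegral_comp_add_left (fun t => ‖V t m l‖ₑ ^ 2) s]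
  exact mul_le_mul_right (lintegral_mono_set (Ici_subset_Ici.2 hs)) _

namespace IsDoubleFrequency

variable {N j : ℕ} {lam : Fin N → ℝ} {V : ℝ → Matrix (Fin N) (Fin N) ℂ}

lemma shift (h : IsDoubleFrequency j lam V) {s : ℝ} (hs : 0 ≤ s) :
    IsDoubleFrequency j lam fun t => V (s + t) where
  lt := h.lt
  monotone := h.monotone
  low := h.low
  double := h.double
  high := h.high
  locallyIntegrableOn m l := locallyIntegrableOn_comp_add_left (h.locallyIntegrableOn m l) hs
  isHermitian t ht := h.isHermitian _ (add_nonneg hs ht)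
  diag_eq_zero t ht := h.diag_eq_zero _ (add_nonneg hs ht)
  mass_lt_top := by
    refine lt_of_le_of_lt ?_ h.mass_lt_top
    unfold doubleMass
    gcongr <;> exact entryMass_shift_le lam V _ _ hs

lemma tendsto_doubleMass_shift (h : IsDoubleFrequency j lam V) :
    Tendsto (fun s => doubleMass lam (fun t => V (s + t)) j) atTop (𝓝 0) := by
  set F : ℝ → ℝ≥0∞ := fun s => ENNReal.ofReal (∑ m, ∑ l, pairDensity j lam V s m l) with hF
  set ν := (volume.restrict (Ici (0 : ℝ))).withDensity F with hν
  have hfin : ν univ ≠ ∞ := by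
    rw [hν, withDensity_apply _ MeasurableSet.univ, Measure.restrict_univ,
      h.lintegral_sum_pairDensity]
    exact h.mass_lt_top.ne
  have htend : Tendsto (fun s : ℝ => ν (Ici s)) atTop (𝓝 0) := by
    have h1 := tendsto_measure_iInter_atTop (μ := ν) (s := fun s : ℝ => Ici s)
      (fun s => measurableSet_Ici.nullMeasurableSet) (fun a b hab => Ici_subset_Ici.2 hab)
      ⟨0, measure_ne_top_of_subset (subset_univ _) hfin⟩
    rwa [show ⋂ s : ℝ, Ici s = ∅ by
      ext x; simpa using exists_gt x, measure_empty] at h1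
  refine htend.congr' ?_
  filter_upwards [eventually_ge_atTop 0] with s hs
  rw [hν, withDensity_apply _ measurableSet_Ici, Measure.restrict_restrict measurableSet_Ici,
    Ici_inter_Ici, max_eq_left hs, ← (h.shift hs).lintegral_sum_pairDensity,
    ← setLIntegral_comp_add_left F s]
  rfl

end IsDoubleFrequency

end Shift

/-! ### Frobenius norm estimates and completeness of the space of square integrable functions -/

section Frobenius

/-- The squared Frobenius norm. -/
noncomputable def frobSq {m n : Type*} [Fintype m] [Fintype n] (M : Matrix m n ℂ) : ℝ :=
  ∑ a, ∑ b, ‖M a b‖ ^ 2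

lemma frobSq_nonneg {m n : Type*} [Fintype m] [Fintype n] (M : Matrix m n ℂ) : 0 ≤ frobSq M :=
  Finset.sum_nonneg fun _ _ => Finset.sum_nonneg fun _ _ => sq_nonneg _

lemma ofReal_frobSq {m n : Type*} [Fintype m] [Fintype n] (M : Matrix m n ℂ) :
    ((frobSq M : ℝ) : ℂ) = (M.conjTranspose * M).trace := by
  simp only [frobSq, Matrix.trace, Matrix.diag_apply, Matrix.mul_apply, Matrix.conjTranspose_apply]
  rw [Finset.sum_comm]
  push_cast
  exact Finset.sum_congr rfl fun a _ => Finset.sum_congr rfl fun b _ =>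
    (Complex.conj_mul' _).symm

lemma frobSq_mul_of_isometry {m n : Type*} [Fintype m] [Fintype n] [DecidableEq m]
    {U : Matrix m m ℂ} (hU : U.conjTranspose * U = 1) (M : Matrix m n ℂ) :
    frobSq (U * M) = frobSq M := by
  have h : ((frobSq (U * M) : ℝ) : ℂ) = frobSq M := by
    rw [ofReal_frobSq, ofReal_frobSq, Matrix.conjTranspose_mul, Matrix.mul_assoc,
      ← Matrix.mul_assoc U.conjTranspose, hU, Matrix.one_mul]
  exact_mod_cast h

/-- The operator norm is at most the Frobenius norm. -/
lemma matENorm_sq_le (M : Matrix (Fin 2) (Fin 2) ℂ) :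
    matENorm M ^ 2 ≤ ENNReal.ofReal (frobSq M) := by
  have h1 : ‖Matrix.toEuclideanCLM (n := Fin 2) (𝕜 := ℂ) M‖ ≤ √(frobSq M) := by
    refine ContinuousLinearMap.opNorm_le_bound _ (Real.sqrt_nonneg _) fun x => ?_
    refine le_of_sq_le_sq ?_ (by positivity)
    rw [mul_pow, Real.sq_sqrt (frobSq_nonneg M), EuclideanSpace.norm_sq_eq,
      EuclideanSpace.norm_sq_eq, frobSq, Finset.sum_mul]
    refine Finset.sum_le_sum fun a _ => ?_
    rw [Matrix.ofLp_toEuclideanCLM]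
    exact norm_sum_mul_sq_le _ _
  rw [matENorm, ← ofReal_norm, ← ENNReal.ofReal_pow (norm_nonneg _)]
  refine ENNReal.ofReal_le_ofReal ?_
  rw [← Real.sq_sqrt (frobSq_nonneg M)]
  exact pow_le_pow_left₀ (norm_nonneg _) h1 2

lemma sqDistL2_le (F G : ℝ → Matrix (Fin 2) (Fin 2) ℂ) :
    sqDistL2 F G ≤ ∫⁻ k, ENNReal.ofReal (frobSq (F k - G k)) :=
  lintegral_mono fun _ => matENorm_sq_le _

variable {N j : ℕ}

lemma frobSq_sub_le_blockDefect (h : j + 1 < N) {M : Matrix (Fin N) (Fin N) ℂ}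
    (hM : M.conjTranspose * M = 1) (P : Matrix (Fin 2) (Fin 2) ℂ) :
    frobSq (M.submatrix (pairIndex h) (pairIndex h) - P) ≤ blockDefect h M P := by
  rw [frobSq, Finset.sum_comm, blockDefect]
  refine Finset.sum_le_sum fun b _ => ?_
  have h1 := sum_low_add_sum_pair_le h (F := fun m => ‖M m (pairIndex h b)‖ ^ 2)
    fun _ => sq_nonneg _
  rw [sum_norm_sq_col_eq_one hM] at h1
  have h2 : 0 ≤ ∑ i, ‖M (lowIndex h i) (pairIndex h b)‖ ^ 2 :=
    Finset.sum_nonneg fun _ _ => sq_nonneg _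
  simp only [Matrix.sub_apply, Matrix.submatrix_apply]
  linarith

/-- For unitary matrices, the difference between `U⁻¹` times the block of `T` at the pair `j`,
`j + 1` and `Q⁻¹` times the block of `B` is controlled by the block defect of the relative
propagators `T B⁻¹` and `U Q⁻¹`. -/
lemma frobSq_conjTranspose_mul_sub_le (h : j + 1 < N) {T B : Matrix (Fin N) (Fin N) ℂ}
    {U Q : Matrix (Fin 2) (Fin 2) ℂ} (hT : T.conjTranspose * T = 1)
    (hB : B.conjTranspose * B = 1) (hU : U.conjTranspose * U = 1) :
    frobSq (U.conjTranspose * T.submatrix (pairIndex h) (pairIndex h) -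
        Q.conjTranspose * B.submatrix (pairIndex h) (pairIndex h)) ≤
      2 * blockDefect h (T * B.conjTranspose) (U * Q.conjTranspose) := by
  set M := T * B.conjTranspose with hM
  set P := U * Q.conjTranspose with hP
  have hMB : M * B = T := by rw [hM, Matrix.mul_assoc, hB, Matrix.mul_one]
  have hUU : U.conjTranspose.conjTranspose * U.conjTranspose = 1 := by
    rw [Matrix.conjTranspose_conjTranspose]; exact mul_eq_one_comm.1 hU
  have hrow : ∀ a, ∑ l, ‖M a l‖ ^ 2 = 1 := by
    intro a
    have h1 : M.conjTranspose.conjTranspose * M.conjTranspose = 1 := by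
      rw [hM, Matrix.conjTranspose_conjTranspose, Matrix.conjTranspose_mul,
        Matrix.conjTranspose_conjTranspose, Matrix.mul_assoc, ← Matrix.mul_assoc B.conjTranspose,
        hB, Matrix.one_mul]
      exact mul_eq_one_comm.1 hT
    simpa [Matrix.conjTranspose_apply] using sum_norm_sq_col_eq_one h1 a
  rw [show U.conjTranspose * T.submatrix (pairIndex h) (pairIndex h) -
      Q.conjTranspose * B.submatrix (pairIndex h) (pairIndex h) =
      U.conjTranspose * (T.submatrix (pairIndex h) (pairIndex h) -
        P * B.submatrix (pairIndex h) (pairIndex h)) by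
    rw [Matrix.mul_sub, hP, Matrix.mul_assoc U, ← Matrix.mul_assoc U.conjTranspose U, hU,
      Matrix.one_mul], frobSq_mul_of_isometry hUU]
  -- `C` is the difference between the two rows of `M` and those of `P` extended by zero.
  set C : Fin 2 → Fin N → ℂ := fun a l =>
    M (pairIndex h a) l - if InPair j l then P a (pairPos j l) else 0 with hC
  have hentry : ∀ a b, (T.submatrix (pairIndex h) (pairIndex h) -
      P * B.submatrix (pairIndex h) (pairIndex h)) a b =
      ∑ l, C a l * B l (pairIndex h b) := by
    intro a b
    simp only [hC, sub_mul, Finset.sum_sub_distrib, ite_mul, zero_mul]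
    rw [sum_inPair h fun l => P a (pairPos j l) * B l (pairIndex h b), ← hMB]
    simp only [pairPos_pairIndex]
    rfl
  have hCsum : ∀ a, ∑ l, ‖C a l‖ ^ 2 = ∑ a', ‖M (pairIndex h a) (pairIndex h a') - P a a'‖ ^ 2 +
      (1 - ∑ a', ‖M (pairIndex h a) (pairIndex h a')‖ ^ 2) := by
    intro a
    have h1 : ∀ l, ‖C a l‖ ^ 2 = ‖M (pairIndex h a) l‖ ^ 2 + if InPair j l then
        ‖M (pairIndex h a) l - P a (pairPos j l)‖ ^ 2 - ‖M (pairIndex h a) l‖ ^ 2 else 0 := by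
      intro l
      simp only [hC]
      split_ifs <;> simp
    rw [Finset.sum_congr rfl fun l _ => h1 l, Finset.sum_add_distrib, hrow, sum_inPair h
      fun l => ‖M (pairIndex h a) l - P a (pairPos j l)‖ ^ 2 - ‖M (pairIndex h a) l‖ ^ 2]
    simp only [pairPos_pairIndex, Finset.sum_sub_distrib]
    ring
  have hle : ∀ a b, ‖(T.submatrix (pairIndex h) (pairIndex h) -
      P * B.submatrix (pairIndex h) (pairIndex h)) a b‖ ^ 2 ≤ ∑ l, ‖C a l‖ ^ 2 := by
    intro a b
    rw [hentry]
    refine (norm_sum_mul_sq_le _ _).trans (le_of_eq ?_)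
    rw [sum_norm_sq_col_eq_one hB, mul_one]
  refine (Finset.sum_le_sum fun a _ => Finset.sum_le_sum fun b _ => hle a b).trans (le_of_eq ?_)
  simp only [hCsum, Finset.sum_const, Finset.card_univ, Fintype.card_fin, nsmul_eq_mul,
    ← Finset.mul_sum]
  rw [blockDefect, Finset.sum_add_distrib, Finset.sum_add_distrib, Finset.sum_sub_distrib,
    Finset.sum_sub_distrib, Finset.sum_comm,
    Finset.sum_comm (f := fun a a' => ‖M (pairIndex h a) (pairIndex h a')‖ ^ 2)]
  norm_num

end Frobenius

section LTwoLimit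

/-- Completeness of `L²` for a family indexed by time, with the rate of convergence. Only the
differences `g t - g 0` need to be square integrable. -/
lemma exists_limit_of_lintegral_sub_le {α E : Type*} [MeasurableSpace α] {μ : Measure α}
    [NormedAddCommGroup E] [CompleteSpace E] {g : ℝ → α → E} {δ : ℝ → ℝ≥0∞}
    (hg : ∀ t, 0 ≤ t → StronglyMeasurable (g t)) (hδ : Tendsto δ atTop (𝓝 0)) (hδ₀ : δ 0 < ∞)
    (hc : ∀ s t, 0 ≤ s → s ≤ t → ∫⁻ x, ‖g t x - g s x‖ₑ ^ 2 ∂μ ≤ δ s) :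
    ∃ L : α → E, StronglyMeasurable L ∧
      ∀ s, 0 ≤ s → ∫⁻ x, ‖g s x - L x‖ₑ ^ 2 ∂μ ≤ δ s := by
  have hsq : ∀ f : α → E, eLpNorm f 2 μ ^ 2 = ∫⁻ x, ‖f x‖ₑ ^ 2 ∂μ := by
    intro f
    have h1 := eLpNorm_nnreal_pow_eq_lintegral (f := f) (μ := μ) (p := 2) two_ne_zero
    norm_num at h1
    exact_mod_cast h1
  have hmem : ∀ t, MemLp (fun x => g (max t 0) x - g 0 x) 2 μ := by
    intro t
    refine ⟨((hg _ (le_max_right _ _)).sub (hg 0 le_rfl)).aestronglyMeasurable, ?_⟩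
    have h1 := (hsq fun x => g (max t 0) x - g 0 x).trans_le (hc 0 _ le_rfl (le_max_right t 0))
    exact lt_top_iff_ne_top.2 fun htop => by
      rw [htop] at h1
      exact absurd (h1.trans_lt hδ₀) (by simp)
  set f : ℝ → Lp E 2 μ := fun t => (hmem t).toLp _ with hf
  have hedist : ∀ s t, 0 ≤ s → s ≤ t → edist (f t) (f s) ^ 2 ≤ δ s := by
    intro s t hs hst
    rw [hf, Lp.edist_toLp_toLp, hsq]
    refine le_trans (le_of_eq (lintegral_congr fun x => ?_)) (hc s t hs hst)
    simp [max_eq_left hs, max_eq_left (hs.trans hst)]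
  have hcau : CauchySeq f := by
    rw [EMetric.cauchySeq_iff]
    intro ε hε
    have hε2 : 0 < (ε / 2) ^ 2 := by
      have := ENNReal.half_pos hε.ne'
      positivity
    obtain ⟨s, hs, hs0⟩ := ((hδ.eventually_lt_const hε2).and (eventually_ge_atTop 0)).exists
    have hlt : ∀ t, s ≤ t → edist (f t) (f s) < ε / 2 := fun t ht =>
      lt_of_pow_lt_pow_left' 2 ((hedist s t hs0 ht).trans_lt hs)
    refine ⟨s, fun t ht u hu => (edist_triangle_right _ _ (f s)).trans_lt ?_⟩
    rw [← ENNReal.add_halves ε]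
    exact ENNReal.add_lt_add (hlt t ht) (hlt u hu)
  obtain ⟨ℓ, hℓ⟩ := cauchySeq_tendsto_of_complete hcau
  refine ⟨fun x => ℓ x + g 0 x, (Lp.stronglyMeasurable ℓ).add (hg 0 le_rfl), fun s hs => ?_⟩
  have h1 : edist ℓ (f s) ^ 2 ≤ δ s := by
    refine le_of_tendsto (((ENNReal.continuous_pow 2).tendsto _).comp
      (hℓ.edist (tendsto_const_nhds (x := f s)))) ?_
    filter_upwards [eventually_ge_atTop s] with t ht using hedist s t hs ht
  rw [Lp.edist_def, hsq] at h1
  refine le_trans (le_of_eq (lintegral_congr_ae ?_)) h1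
  filter_upwards [(hmem s).coeFn_toLp] with x hx
  rw [Pi.sub_apply, hf, hx, max_eq_left hs, ← enorm_neg]
  congr 2
  abel

end LTwoLimit

/-! ### The limit as time tends to infinity -/

section Limit

lemma IsFundamentalMatrix.congr_coupling {n : Type*} [Fintype n] [DecidableEq n] {k : ℂ}
    {d : n → ℝ} {H H' X : ℝ → Matrix n n ℂ} (hX : IsFundamentalMatrix k d H X)
    (hH : ∀ t, 0 ≤ t → H' t = H t) : IsFundamentalMatrix k d H' X :=
  ⟨fun b a => ((hX.isEvolution b) a).congr (fun _ _ => rfl) fun t ht => by rw [hH t ht],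
    hX.zero_eq⟩

/-- On the real line the propagator is continuous in the spectral parameter, by uniqueness and the
existence of an entire family. -/
lemma IsFundamentalMatrix.continuous {n : Type*} [Fintype n] [DecidableEq n] {d : n → ℝ}
    {H : ℝ → Matrix n n ℂ} {X : ℝ → ℝ → Matrix n n ℂ}
    (hX : ∀ k : ℝ, IsFundamentalMatrix k d H fun t => X t k)
    (hH : ∀ t, 0 ≤ t → (H t).IsHermitian) {t : ℝ} (ht : 0 ≤ t) : Continuous fun k => X t k := by
  have hX0 := hX 0
  rw [Complex.ofReal_zero] at hX0
  obtain ⟨Z, hZ, hZd⟩ := hX0.exists_entire (d := d) hH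
  have hZc : Continuous fun k : ℝ => Z k t := continuous_matrix fun a b =>
    (hZd t ht a b).continuous.comp Complex.continuous_ofReal
  exact hZc.congr fun k => (hZ k).unique (hX k) hH (by simp) ht

namespace IsDoubleFrequency

variable {N j : ℕ} {lam : Fin N → ℝ} {V : ℝ → Matrix (Fin N) (Fin N) ℂ}

/-- The `L²` increments of `Ψ⁻¹ Y` after time `s` are controlled by the mass of `V` on
`[s, ∞)`. -/
lemma lintegral_frobSq_sub_le (h : IsDoubleFrequency j lam V)
    {X : ℝ → ℝ → Matrix (Fin N) (Fin N) ℂ}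
    (hX : ∀ k : ℝ, IsFundamentalMatrix k lam V fun t => X t k)
    {Ψ : ℝ → ℝ → Matrix (Fin 2) (Fin 2) ℂ}
    (hΨ : ∀ k : ℝ, IsFundamentalMatrix k (fun _ => lam (pairIndex h.lt 0)) (pairCoupling h.lt V)
      fun t => Ψ t k) {s t : ℝ} (hs : 0 ≤ s) (hst : s ≤ t) :
    ∫⁻ k : ℝ, ENNReal.ofReal (frobSq
        ((Ψ t k).conjTranspose * (X t k).submatrix (pairIndex h.lt) (pairIndex h.lt) -
          (Ψ s k).conjTranspose * (X s k).submatrix (pairIndex h.lt) (pairIndex h.lt))) ≤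
      ENNReal.ofReal (280 * Real.pi) * doubleMass lam (fun τ => V (s + τ)) j := by
  have hP := fun t ht => h.pairCoupling_isHermitian (t := t) ht
  have ht := hs.trans hst
  have hcore := (h.shift hs).lintegral_blockDefect_le
    (X := fun τ k => X (s + τ) k * (X s k).conjTranspose)
    (fun k => (hX k).shift h.isHermitian (by simp) hs)
    (Ψ := fun τ k => Ψ (s + τ) k * (Ψ s k).conjTranspose)
    (fun k => (hΨ k).shift hP (by simp) hs) (sub_nonneg.2 hst)
  simp only [add_sub_cancel] at hcore
  have hpt : ∀ k, ENNReal.ofReal (frobSq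
        ((Ψ t k).conjTranspose * (X t k).submatrix (pairIndex h.lt) (pairIndex h.lt) -
          (Ψ s k).conjTranspose * (X s k).submatrix (pairIndex h.lt) (pairIndex h.lt))) ≤
      ENNReal.ofReal 2 * ENNReal.ofReal (blockDefect h.lt (X t k * (X s k).conjTranspose)
        (Ψ t k * (Ψ s k).conjTranspose)) := by
    intro k
    rw [← ENNReal.ofReal_mul zero_le_two]
    exact ENNReal.ofReal_le_ofReal (frobSq_conjTranspose_mul_sub_le h.lt
      ((hX k).conjTranspose_mul_self h.isHermitian (by simp) ht)
      ((hX k).conjTranspose_mul_self h.isHermitian (by simp) hs)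
      ((hΨ k).conjTranspose_mul_self hP (by simp) ht))
  refine (lintegral_mono hpt).trans ?_
  rw [lintegral_const_mul' _ _ ENNReal.ofReal_ne_top]
  refine (mul_le_mul_right hcore _).trans (le_of_eq ?_)
  rw [← mul_assoc, ← ENNReal.ofReal_mul zero_le_two]
  ring_nf

/-- The limit of `Ψ⁻¹ Y` in `L²`, with the rate of convergence. -/
lemma exists_limit (h : IsDoubleFrequency j lam V)
    {X : ℝ → ℝ → Matrix (Fin N) (Fin N) ℂ}
    (hX : ∀ k : ℝ, IsFundamentalMatrix k lam V fun t => X t k)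
    {Ψ : ℝ → ℝ → Matrix (Fin 2) (Fin 2) ℂ}
    (hΨ : ∀ k : ℝ, IsFundamentalMatrix k (fun _ => lam (pairIndex h.lt 0)) (pairCoupling h.lt V)
      fun t => Ψ t k) :
    ∃ L : ℝ → Matrix (Fin 2) (Fin 2) ℂ, (∀ a b, Measurable fun k => L k a b) ∧
      ∀ s, 0 ≤ s → ∫⁻ k : ℝ, ENNReal.ofReal (frobSq ((Ψ s k).conjTranspose *
        (X s k).submatrix (pairIndex h.lt) (pairIndex h.lt) - L k)) ≤
        ENNReal.ofReal (280 * Real.pi) * doubleMass lam (fun τ => V (s + τ)) j := by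
  set G : ℝ → ℝ → Matrix (Fin 2) (Fin 2) ℂ := fun t k =>
    (Ψ t k).conjTranspose * (X t k).submatrix (pairIndex h.lt) (pairIndex h.lt) with hG
  set g : ℝ → ℝ → EuclideanSpace ℂ (Fin 2 × Fin 2) := fun t k =>
    WithLp.toLp 2 fun p => G t k p.1 p.2 with hg
  have hnorm : ∀ x : EuclideanSpace ℂ (Fin 2 × Fin 2),
      ‖x‖ₑ ^ 2 = ENNReal.ofReal (frobSq fun a b => x (a, b)) := by
    intro x
    rw [← ofReal_norm, ← ENNReal.ofReal_pow (norm_nonneg _), EuclideanSpace.norm_sq_eq,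
      Fintype.sum_prod_type]
    rfl
  have hgc : ∀ t, 0 ≤ t → StronglyMeasurable (g t) := by
    intro t ht
    have hXc := IsFundamentalMatrix.continuous hX h.isHermitian ht
    have hΨc := IsFundamentalMatrix.continuous hΨ
      (fun t ht => h.pairCoupling_isHermitian (t := t) ht) ht
    have hGc : Continuous (G t) := hΨc.matrix_conjTranspose.matrix_mul (hXc.matrix_submatrix _ _)
    exact ((PiLp.continuous_toLp 2 _).comp
      (continuous_pi fun p : Fin 2 × Fin 2 => hGc.matrix_elem p.1 p.2)).stronglyMeasurable
  have hδ : Tendsto (fun s => ENNReal.ofReal (280 * Real.pi) *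
      doubleMass lam (fun τ => V (s + τ)) j) atTop (𝓝 0) := by
    have h1 := ENNReal.Tendsto.const_mul (a := ENNReal.ofReal (280 * Real.pi))
      h.tendsto_doubleMass_shift (Or.inr ENNReal.ofReal_ne_top)
    rwa [mul_zero] at h1
  obtain ⟨L, hLm, hL⟩ := exists_limit_of_lintegral_sub_le (μ := volume) hgc hδ
    (ENNReal.mul_lt_top ENNReal.ofReal_lt_top (h.shift le_rfl).mass_lt_top)
    (fun s t hs hst => by
      simp_rw [hnorm]
      exact h.lintegral_frobSq_sub_le hX hΨ hs hst)
  refine ⟨fun k a b => L k (a, b), fun a b => ?_, fun s hs => ?_⟩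
  · exact (measurable_pi_apply (a, b)).comp
      ((PiLp.continuous_ofLp 2 _).measurable.comp hLm.measurable)
  · have h1 := hL s hs
    simp_rw [hnorm] at h1
    exact h1

end IsDoubleFrequency

end Limit

section Conclusion

lemma twoBlock_eq_submatrix {N j : ℕ} (h : j + 1 < N) (M : Matrix (Fin N) (Fin N) ℂ) :
    twoBlock (pairIndex h 0) (pairIndex h 1) M = M.submatrix (pairIndex h) (pairIndex h) := by
  ext a b
  fin_cases a <;> fin_cases b <;> rfl

lemma IsFundamentalSolution.isFundamentalMatrix_block {μ k : ℝ} {v w : ℝ → ℂ}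
    {Ψ : ℝ → Matrix (Fin 2) (Fin 2) ℂ} (hΨ : IsFundamentalSolution (blockGenerator μ v w k) 0 Ψ)
    (hv : LocallyIntegrableOn v (Ici 0)) (hw : LocallyIntegrableOn w (Ici 0)) :
    IsFundamentalMatrix k (fun _ => μ) (fun t => !![0, v t; w t, 0]) Ψ := by
  refine hΨ.isFundamentalMatrix (fun t => ?_) fun a b => ?_
  · ext a b
    fin_cases a <;> fin_cases b <;> simp [blockGenerator]
  · have h0 : LocallyIntegrableOn (fun _ : ℝ => (0 : ℂ)) (Ici 0) :=
      (locallyIntegrable_zero).locallyIntegrableOn _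
    fin_cases a <;> fin_cases b
    exacts [h0, hv, hw, h0]

theorem mainTheorem3 :
    ∃ C : ℝ≥0, ∀ (N j : ℕ) (hj : 0 < j) (hjN : j + 1 < N)
      (lam : Fin N → ℝ) (_hmono : Monotone lam)
      (_hlow : lam ⟨j - 1, by omega⟩ < lam ⟨j, by omega⟩)
      (_hdouble : lam ⟨j, by omega⟩ = lam ⟨j + 1, hjN⟩)
      (_hhigh : ∀ h : j + 2 < N, lam ⟨j + 1, hjN⟩ < lam ⟨j + 2, h⟩)
      (V : ℝ → Matrix (Fin N) (Fin N) ℂ)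
      (_hVloc : ∀ m l, LocallyIntegrableOn (fun t => V t m l) (Ici 0))
      (_hVherm : ∀ t, 0 ≤ t → (V t).IsHermitian)
      (_hVdiag : ∀ t, 0 ≤ t → ∀ m, V t m m = 0)
      (_hVfin : doubleMass lam V j < ∞)
      (X : ℝ → ℝ → Matrix (Fin N) (Fin N) ℂ)
      (_hX : ∀ k, IsFundamentalSolution (evolutionGenerator lam V k) 0 (fun t => X t k))
      (Ψ : ℝ → ℝ → Matrix (Fin 2) (Fin 2) ℂ)
      (_hΨ : ∀ k, IsFundamentalSolution
        (blockGenerator (lam ⟨j, by omega⟩)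
          (fun t => V t ⟨j, by omega⟩ ⟨j + 1, hjN⟩)
          (fun t => V t ⟨j + 1, hjN⟩ ⟨j, by omega⟩) k) 0 (fun t => Ψ t k))
      (Y : ℝ → ℝ → Matrix (Fin 2) (Fin 2) ℂ)
      (_hY : ∀ t k, Y t k = twoBlock ⟨j, by omega⟩ ⟨j + 1, hjN⟩ (X t k)),
      (∀ t, 0 ≤ t →
        sqDistL2 (fun k => Y t k) (fun k => Ψ t k) ≤ (C : ℝ≥0∞) * doubleMass lam V j) ∧
      ∃ Yinf : ℝ → Matrix (Fin 2) (Fin 2) ℂ,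
        (∀ a b, Measurable (fun k => Yinf k a b)) ∧
        Tendsto (fun t => sqDistL2 (fun k => (Ψ t k)⁻¹ * Y t k) Yinf) atTop (𝓝 0) ∧
        sqDistL2 Yinf (fun _ => 1) ≤ (C : ℝ≥0∞) * doubleMass lam V j := by
  refine ⟨Real.toNNReal (280 * Real.pi), ?_⟩
  intro N j hj hjN lam hmono hlow hdouble hhigh V hVloc hVherm hVdiag hVfin X hX Ψ hΨ Y hY
  rw [ENNReal.ofNNReal_toNNReal]
  have h : IsDoubleFrequency j lam V :=
    { lt := hjN
      monotone := hmono
      low := fun m l hm hl => ((hmono (Fin.le_def.2 (Nat.le_sub_one_of_lt hm))).trans_lt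
        hlow).trans_le (hmono (Fin.le_def.2 hl))
      double := fun m l hm hl => 
        (congrArg lam (Fin.ext hm)).trans (hdouble.trans (congrArg lam (Fin.ext hl.symm)))
      high := fun m l hm hl => ((hmono (Fin.le_def.2 hm)).trans_lt
        (hhigh (lt_of_le_of_lt hl l.2))).trans_le (hmono (Fin.le_def.2 hl))
      locallyIntegrableOn := hVloc
      isHermitian := hVherm
      diag_eq_zero := hVdiag
      mass_lt_top := hVfin }
  have hXf : ∀ k : ℝ, IsFundamentalMatrix k lam V fun t => X t k := fun k =>
    (hX k).isFundamentalMatrix (fun _ => rfl) hVloc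
  have hΨf : ∀ k : ℝ, IsFundamentalMatrix k (fun _ => lam (pairIndex h.lt 0))
      (pairCoupling h.lt V) fun t => Ψ t k := fun k =>
    ((hΨ k).isFundamentalMatrix_block (hVloc _ _) (hVloc _ _)).congr_coupling fun t ht => by
      ext a b
      fin_cases a <;> fin_cases b
      exacts [hVdiag t ht _, rfl, rfl, hVdiag t ht _]
  have hYs : ∀ t k, Y t k = (X t k).submatrix (pairIndex h.lt) (pairIndex h.lt) := fun t k =>
    (hY t k).trans (twoBlock_eq_submatrix h.lt (X t k))
  have hinv : ∀ t, 0 ≤ t → ∀ k, (Ψ t k)⁻¹ = (Ψ t k).conjTranspose := fun t ht k =>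
    Matrix.inv_eq_left_inv ((hΨf k).conjTranspose_mul_self
      (fun t ht => h.pairCoupling_isHermitian ht) (by simp) ht)
  have hpi := Real.pi_pos
  refine ⟨fun t ht => ?_, ?_⟩
  -- The bound on the increments costs a factor two over the bound on the block itself.
  · refine (sqDistL2_le _ _).trans (le_trans (lintegral_mono fun k => ?_)
      ((h.lintegral_blockDefect_le hXf hΨf ht).trans
        (mul_le_mul_left (ENNReal.ofReal_le_ofReal (by linarith)) _)))
    rw [hYs]
    exact ENNReal.ofReal_le_ofReal (frobSq_sub_le_blockDefect h.lt
      ((hXf k).conjTranspose_mul_self hVherm (by simp) ht) _)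
  · obtain ⟨L, hLm, hL⟩ := h.exists_limit hXf hΨf
    refine ⟨L, hLm, ?_, ?_⟩
    · have hlim := ENNReal.Tendsto.const_mul (a := ENNReal.ofReal (280 * Real.pi))
        h.tendsto_doubleMass_shift (Or.inr ENNReal.ofReal_ne_top)
      rw [mul_zero] at hlim
      refine tendsto_of_tendsto_of_tendsto_of_le_of_le' tendsto_const_nhds hlim
        (Eventually.of_forall fun _ => zero_le) ?_
      filter_upwards [eventually_ge_atTop 0] with t ht
      refine (sqDistL2_le _ _).trans (le_trans (le_of_eq ?_) (hL t ht))
      simp_rw [hinv t ht, hYs]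
    · have h0 := hL 0 le_rfl
      simp only [zero_add] at h0
      refine (sqDistL2_le _ _).trans (le_trans (le_of_eq (lintegral_congr fun k => ?_)) h0)
      rw [(hXf k).zero_eq, (hΨf k).zero_eq, Matrix.conjTranspose_one, Matrix.one_mul,
        Matrix.submatrix_one_embedding]
      simp only [frobSq, Matrix.sub_apply]
      simp_rw [norm_sub_rev]

end Conclusion
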